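/- All directed graphs are finite, with vertex set $\{0,\dots,n-1\}$ for some $n\ge 0$. A tournament is a directed graph without loops in which any two distinct vertices $u,v$ are joined by exactly one of the directed edges $(u,v)$, $(v,u)$. For a class $\mathcal T$ of directed graphs, $\#\textsc{IndSub}_{\mathrm{To}}(\mathcal T)$ is the following parameterized counting problem. The input is a directed graph $T\in\mathcal T$ and a tournament $G$; the output is the number of sets $A\subseteq V(G)$ such that the induced subgraph $G[A]$ is isomorphic to $T$; the parameter is $k=|V(T)|$. The problem $\#\textsc{Clique}$ has as input a finite simple graph $G$ and a number $k$, as output the number of $k$-cliques of $G$, and as parameter $k$. Inputs are encoded as binary words by unary numbers and adjacency matrices; $|x|$ denotes the length of the encoding of $x$. A parameterized counting problem $P$ with parameterization $\kappa$ is fixed-parameter tractable (FPT) if some deterministic algorithm computes $P(x)$ in time $f(\kappa(x))\cdot|x|^{O(1)}$ for all inputs $x$ of the problem, for some computable function $f$. It is $\#\mathrm W[1]$-hard if there is a parameterized Turing reduction from $\#\textsc{Clique}$ to it, that is, a deterministic algorithm with oracle access to $P$ that computes $\#\textsc{Clique}(x)$ in time $f(k)\cdot|x|^{O(1)}$ for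 every input $x$ with parameter $k$ and asks the oracle only inputs $y$ of $P$ with $\kappa(y)\le g(k)$, for some computable functions $f$ and $g$. Algorithms are programs of a random access machine with addition, truncated subtraction and halving at unit cost, where an oracle call is charged for the lengths of the query and of the answer. Theorem. Let $\mathcal T$ be a recursively enumerable class of directed graphs. If $\mathcal T$ contains infinitely many tournaments, then $\#\textsc{IndSub}_{\mathrm{To}}(\mathcal T)$ is $\#\mathrm W[1]$-hard. Otherwise, $\#\textsc{IndSub}_{\mathrm{To}}(\mathcal T)$ is fixed-parameter tractable. -/

import Mathlib

namespace TourCount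

/-! ## Machine model: random access machines with unit cost

Programs of a random access machine in structured form.  A program uses finitely many registers
and finitely many arrays, all of whose cells hold natural numbers.  The arithmetic instructions
are addition, truncated subtraction and halving (there is no multiplication), so that the
unit-cost measure is polynomially equivalent to running time on a multitape Turing machine. -/

/-- RAM programs, with an instruction that calls an oracle. -/
inductive Prog : Type
  /-- `d := n` -/
  | const (d n : ℕ)
  /-- `d := a + b` -/
  | add (d a b : ℕ)
  /-- `d := a - b` (truncated at zero) -/
  | sub (d a b : ℕ)
  /-- `d := ⌊a / 2⌋` -/
  | half (d a : ℕ)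
  /-- `d := A[i]`, where `A` is an array and `i` a register -/
  | load (d A i : ℕ)
  /-- `A[i] := a`, where `A` is an array and `i`, `a` are registers -/
  | store (A i a : ℕ)
  /-- `d :=` the oracle's answer to the word in the first `l` cells of the array `A`,
  where `l` is a register -/
  | query (d A l : ℕ)
  /-- first `p`, then `q` -/
  | seq (p q : Prog)
  /-- if the register `a` is nonzero then `p` else `q` -/
  | ite (a : ℕ) (p q : Prog)
  /-- while the register `a` is nonzero do `p` -/
  | loop (a : ℕ) (p : Prog)

/-- A memory state: the contents of the registers and of the arrays. -/
@[ext]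
structure Mem where
  reg : ℕ → ℕ
  arr : ℕ → ℕ → ℕ

/-- The state after writing `v` to the register `d`. -/
def Mem.setReg (s : Mem) (d v : ℕ) : Mem :=
  { s with reg := Function.update s.reg d v }

/-- The state after writing `v` to the cell `i` of the array `A`. -/
def Mem.setArr (s : Mem) (A i v : ℕ) : Mem :=
  { s with arr := Function.update s.arr A (Function.update (s.arr A) i v) }

/-- The word in the first `l` cells of the array `A`; a nonzero cell is the letter `true`. -/
def Mem.word (s : Mem) (A l : ℕ) : List Bool :=
  (List.range l).map fun i => s.arr A i != 0

/-- The initial state on the input word `w`: the array `0` holds the letters of `w` as zeros and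
ones, the register `0` holds the length of `w`, and everything else is zero. -/
def Mem.init (w : List Bool) : Mem where
  reg := Function.update (fun _ => 0) 0 w.length
  arr := Function.update (fun _ _ => 0) 0 fun i => (w.getD i false).toNat

/-- `Exec O p s s' t`: with the oracle `O`, the program `p` started in the state `s` halts in the
state `s'` after `t` units of time.  `O y v` means that the oracle may be asked the word `y` and
answers `v`; a program that asks any other word gets stuck.  An instruction and a test take one
unit; an oracle call is charged in addition for the length of the query and for the number of
binary digits of the answer. -/
inductive Exec (O : List Bool → ℕ → Prop) : Prog → Mem → Mem → ℕ → Prop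
  | const (s : Mem) (d n : ℕ) : Exec O (.const d n) s (s.setReg d n) 1
  | add (s : Mem) (d a b : ℕ) : Exec O (.add d a b) s (s.setReg d (s.reg a + s.reg b)) 1
  | sub (s : Mem) (d a b : ℕ) : Exec O (.sub d a b) s (s.setReg d (s.reg a - s.reg b)) 1
  | half (s : Mem) (d a : ℕ) : Exec O (.half d a) s (s.setReg d (s.reg a / 2)) 1
  | load (s : Mem) (d A i : ℕ) : Exec O (.load d A i) s (s.setReg d (s.arr A (s.reg i))) 1
  | store (s : Mem) (A i a : ℕ) : Exec O (.store A i a) s (s.setArr A (s.reg i) (s.reg a)) 1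
  | query (s : Mem) (d A l v : ℕ) (h : O (s.word A (s.reg l)) v) :
      Exec O (.query d A l) s (s.setReg d v) (1 + s.reg l + Nat.size v)
  | seq {p q : Prog} {s s₁ s₂ : Mem} {t₁ t₂ : ℕ} (h₁ : Exec O p s s₁ t₁)
      (h₂ : Exec O q s₁ s₂ t₂) : Exec O (.seq p q) s s₂ (t₁ + t₂)
  | ite_true {a : ℕ} {p q : Prog} {s s₁ : Mem} {t : ℕ} (ha : s.reg a ≠ 0)
      (h : Exec O p s s₁ t) : Exec O (.ite a p q) s s₁ (1 + t)
  | ite_false {a : ℕ} {p q : Prog} {s s₁ : Mem} {t : ℕ} (ha : s.reg a = 0)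
      (h : Exec O q s s₁ t) : Exec O (.ite a p q) s s₁ (1 + t)
  | loop_stop {a : ℕ} {p : Prog} {s : Mem} (ha : s.reg a = 0) : Exec O (.loop a p) s s 1
  | loop_step {a : ℕ} {p : Prog} {s s₁ s₂ : Mem} {t₁ t₂ : ℕ} (ha : s.reg a ≠ 0)
      (h₁ : Exec O p s s₁ t₁) (h₂ : Exec O (.loop a p) s₁ s₂ t₂) :
      Exec O (.loop a p) s s₂ (1 + t₁ + t₂)

/-- With the oracle `O`, the program `p` halts on the input word `w` after `t` units of time with
the number `v` as its output (in the register `0`). -/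
def Outputs (O : List Bool → ℕ → Prop) (p : Prog) (w : List Bool) (v t : ℕ) : Prop :=
  ∃ s, Exec O p (Mem.init w) s t ∧ s.reg 0 = v

/-! ## Parameterized counting problems -/

/-- A parameterized counting problem: a set of instances, each encoded by a binary word, a number
to be computed for each instance, and a computable parameterization of words. -/
structure ParamProblem where
  Inst : Type
  enc : Inst → List Bool
  enc_injective : Function.Injective enc
  val : Inst → ℕ
  param : List Bool → ℕ
  param_computable : Computable param

/-- The absent oracle: no word may be asked. -/
def noOracle : List Bool → ℕ → Prop := fun _ _ => False

/-- The oracle for `P`, which may be asked only instances of `P` with parameter at most `b`. -/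
def ParamProblem.oracle (P : ParamProblem) (b : ℕ) : List Bool → ℕ → Prop :=
  fun y v => ∃ j : P.Inst, P.enc j = y ∧ P.param y ≤ b ∧ v = P.val j

/-- Fixed-parameter tractability: one program solves all instances in time `f(κ(x)) · |x|^O(1)`
for a computable function `f`. -/
def ParamProblem.IsFPT (P : ParamProblem) : Prop :=
  ∃ (p : Prog) (f : ℕ → ℕ) (d : ℕ), Computable f ∧
    ∀ i : P.Inst, ∃ t ≤ f (P.param (P.enc i)) * ((P.enc i).length + 1) ^ d,
      Outputs noOracle p (P.enc i) (P.val i) t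

/-- Parameterized Turing reductions from `P` to `P'`: one program with an oracle for `P'` solves
all instances of `P` in time `f(κ(x)) · |x|^O(1)` and asks only instances `y` of `P'` with
`κ'(y) ≤ g(κ(x))`, where `f` and `g` are computable. -/
def ParamProblem.FPTTuringReducible (P P' : ParamProblem) : Prop :=
  ∃ (p : Prog) (f g : ℕ → ℕ) (d : ℕ), Computable f ∧ Computable g ∧
    ∀ i : P.Inst, ∃ t ≤ f (P.param (P.enc i)) * ((P.enc i).length + 1) ^ d,
      Outputs (P'.oracle (g (P.param (P.enc i)))) p (P.enc i) (P.val i) t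

/-! ## Encodings -/

open Classical in
/-- The adjacency matrix of a relation on `{0, …, n-1}`, row by row. -/
noncomputable def adjBits {n : ℕ} (r : Fin n → Fin n → Prop) : List Bool :=
  (List.finRange n ×ˢ List.finRange n).map fun p => decide (r p.1 p.2)

/-- A natural number in unary, with an end marker, followed by the word `l`. -/
def unaryThen (n : ℕ) (l : List Bool) : List Bool :=
  List.replicate n true ++ false :: l

/-- A relation on `{0, …, n-1}` as a word: `n` in unary and the adjacency matrix. -/
noncomputable def encodeRel {n : ℕ} (r : Fin n → Fin n → Prop) : List Bool :=
  unaryThen n (adjBits r)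

/-- The number of letters `true` at the beginning of a word. -/
def leadingOnes (w : List Bool) : ℕ := w.findIdx fun b => !b

theorem leadingOnes_computable : Computable leadingOnes :=
  (Primrec.list_findIdx Primrec.id (Primrec.not.comp Primrec.snd).to₂).to_comp

theorem leadingOnes_unaryThen (n : ℕ) (l : List Bool) : leadingOnes (unaryThen n l) = n := by
  induction n with
  | zero => simp [leadingOnes, unaryThen, List.findIdx_cons]
  | succ n ih => simpa [leadingOnes, unaryThen, List.replicate_succ, List.findIdx_cons] using ih

theorem unaryThen_inj {n m : ℕ} {l l' : List Bool} (h : unaryThen n l = unaryThen m l') :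
    n = m ∧ l = l' := by
  have hn : n = m := by
    rw [← leadingOnes_unaryThen n l, h, leadingOnes_unaryThen]
  subst hn
  simpa [unaryThen] using h

theorem encodeRel_append {n : ℕ} (r : Fin n → Fin n → Prop) (l : List Bool) :
    encodeRel r ++ l = unaryThen n (adjBits r ++ l) := by
  simp [encodeRel, unaryThen]

theorem adjBits_append_inj {n : ℕ} {r r' : Fin n → Fin n → Prop} {l l' : List Bool}
    (h : adjBits r ++ l = adjBits r' ++ l') : r = r' ∧ l = l' := by
  obtain ⟨h₁, h₂⟩ := List.append_inj h (by simp [adjBits])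
  refine ⟨?_, h₂⟩
  funext u v
  have := (List.map_inj_left.1 h₁) (u, v) (by simp [List.mem_product])
  simpa using this

/-! ## Directed graphs and tournaments -/

/-- Finite directed graphs, with vertex set `{0, …, n-1}`. -/
abbrev FinDigraph : Type := Σ n : ℕ, Digraph (Fin n)

/-- A tournament: no loops, and exactly one directed edge between any two distinct vertices. -/
def IsTournament {V : Type*} (T : Digraph V) : Prop :=
  (∀ u, ¬ T.Adj u u) ∧ ∀ u v, u ≠ v → Xor (T.Adj u v) (T.Adj v u)

/-- The number of sets `A` of vertices of `G` such that the subgraph of `G` induced by `A` is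
isomorphic to `T`. -/
noncomputable def inducedCount (T G : FinDigraph) : ℕ :=
  {A : Finset (Fin G.1) | Nonempty (T.2.Adj ≃r Subrel G.2.Adj (· ∈ A))}.ncard

/-- A directed graph as a word. -/
noncomputable def encodeDigraph (T : FinDigraph) : List Bool := encodeRel T.2.Adj

theorem encodeDigraph_append_inj {T T' : FinDigraph} {l l' : List Bool}
    (h : encodeDigraph T ++ l = encodeDigraph T' ++ l') : T = T' ∧ l = l' := by
  obtain ⟨n, T⟩ := T
  obtain ⟨m, T'⟩ := T'
  simp only [encodeDigraph, encodeRel_append] at h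
  obtain ⟨rfl, h⟩ := unaryThen_inj h
  obtain ⟨h, hl⟩ := adjBits_append_inj h
  obtain rfl : T = T' := Digraph.ext h
  exact ⟨rfl, hl⟩

/-- Recursive enumerability of a class of finite directed graphs. -/
def RecursivelyEnumerable (𝒯 : Set FinDigraph) : Prop :=
  REPred fun w : List Bool => ∃ T ∈ 𝒯, encodeDigraph T = w

/-! ## The two counting problems -/

/-- Given a directed graph `T` in the class `𝒯` and a tournament `G`, count the induced
subtournaments of `G` that are isomorphic to `T`.  The parameter is the order of `T`, which is the
number of ones at the beginning of the word. -/
noncomputable def indSubTo (𝒯 : Set FinDigraph) : ParamProblem where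
  Inst := {x : FinDigraph × FinDigraph // x.1 ∈ 𝒯 ∧ IsTournament x.2.2}
  enc x := encodeDigraph x.1.1 ++ encodeDigraph x.1.2
  enc_injective := by
    rintro ⟨⟨T, G⟩, _⟩ ⟨⟨T', G'⟩, _⟩ h
    obtain ⟨rfl, h⟩ := encodeDigraph_append_inj h
    obtain ⟨rfl, -⟩ := encodeDigraph_append_inj (l := []) (l' := []) (by simpa using h)
    rfl
  val x := inducedCount x.1.1 x.1.2
  param := leadingOnes
  param_computable := leadingOnes_computable

/-- Given a finite undirected simple graph `G` and a number `k`, count the `k`-cliques of `G`.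
The parameter is `k`, which is the number of ones at the beginning of the word. -/
noncomputable def countClique : ParamProblem where
  Inst := ℕ × Σ n : ℕ, SimpleGraph (Fin n)
  enc x := unaryThen x.1 (encodeRel x.2.2.Adj)
  enc_injective := by
    rintro ⟨k, n, G⟩ ⟨k', n', G'⟩ h
    obtain ⟨rfl, h⟩ := unaryThen_inj h
    obtain ⟨rfl, h⟩ := unaryThen_inj h
    obtain ⟨h, -⟩ := adjBits_append_inj (l := []) (l' := []) (by simpa using h)
    obtain rfl : G = G' := SimpleGraph.ext h
    rfl
  val x := {A : Finset (Fin x.2.1) | x.2.2.IsNClique x.1 A}.ncard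
  param := leadingOnes
  param_computable := leadingOnes_computable

theorem indSubTo_param (𝒯 : Set FinDigraph) (x : (indSubTo 𝒯).Inst) :
    (indSubTo 𝒯).param ((indSubTo 𝒯).enc x) = x.1.1.1 := by
  simp only [indSubTo, encodeDigraph, encodeRel_append]
  exact leadingOnes_unaryThen _ _

theorem countClique_param (x : countClique.Inst) :
    countClique.param (countClique.enc x) = x.1 :=
  leadingOnes_unaryThen _ _

/-- `#W[1]`-hardness: there is a parameterized Turing reduction from counting `k`-cliques. -/
def ParamProblem.IsSharpW1Hard (P : ParamProblem) : Prop :=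
  countClique.FPTTuringReducible P

end TourCount

/-!
# Counting induced subtournaments

*Hardness.*  Let `T` be a tournament in the class with `m` vertices, where `m` is large in terms of
`k ≥ 2`.  To count the `k`-cliques of a graph on `{0, …, n-1}`, consider host tournaments on the
pairs `(a, u)` with `a < m` and `u < n`.  The first component is called the class.  Between classes
`a < b` with `b ≥ k` all edges have the direction prescribed by a table `Q`.  Between classes
`a < b < k` the edge from `(a, u)` to `(b, v)` points forward precisely if this is so in a table `W`
and `(u, v)` is in a relation `E`.  The diagonal of `W` says which classes are present.  Sum the
numbers of copies of `T` in the host tournaments over all tables `W`, with a sign that alternates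
in the diagonal entries and in the entries `a < b < k`.  A copy that misses a class, or has a pair
of elements in the first `k` classes outside of `E`, does not notice one of these entries, and such
copies cancel.  The remaining copies are transversals of the classes whose first `k` elements are
pairwise in `E`, and all of them have the same weight `hostCoeff T k Q` (`hostSum_eq`).  If `E` is
adjacency in increasing order, this sum is `hostCoeff T k Q * n ^ (m - k)` times the number of
cliques (`hostSum_upAdj`), and for the relation `E` that holds only at `(0, 0)` it is
`hostCoeff T k Q * n ^ (m - k)`.  So the number of cliques is a quotient of two sums, provided that
`Q` is chosen with `hostCoeff T k Q ≠ 0`.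

Such a table exists if `m ≥ 2 ^ (8 * k + 8)` (`exists_hostCoeff_ne_zero`).  Otherwise every labelled
copy of `T` could be changed to another one by reorienting pairs in any prescribed set of `k`
labels.  Applying this to about `(m / k²)²` sets of `k` labels which pairwise share at most one
label, one obtains at least `2 ^ ((m / k²)²)` labelled copies, which is more than `m!`.

The program does not know the table but tries all tables `Q`; their number depends on `m` only.
A suitable tournament is found by enumeration of the class, with the help of a primitive recursive
function (`exists_search`), which is compiled to a program together with a computable time bound
(`exists_compiles`).

*Tractability.*  If the class contains only finitely many tournaments, then the program compares the
pattern with each of them and in the case of success runs through all tuples of vertices in nested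
loops, of a fixed depth (`polyAddable_copies`).  A pattern that is not a tournament has no induced
copies in a tournament.

*The programs.*  Correctness and running time are proved with total-correctness assertions `wp`;
that untouched data survives follows from `Exec.frame`.  In the reduction, the registers `1` to `5` hold
`k`, `n`, `m`, the length of the code of `T`, and the number `2 ^ (m * m)` of tables.  The tables
`Q` and `W` are given by the binary digits of the registers `6` and `7`; the positive and the
negative parts of the two sums are in the registers `8` to `11`, and their absolute values in `12`
and `13`; `14` is the parity that determines the sign, `17` is `m * m`, and `18` is the number found
by the search.  The registers `20` to `56` are scratch, and compiled functions work from `100` on.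
The arrays hold the input (`0`), the query (`1`), the tables `Q` and `W` (`2`, `3`), the two
relations (`5`, `6`), and the multiples of the divisor for the final division (`7`).
-/

namespace TourCount

/-! ### A weakest-precondition calculus for the machine -/

/-- Started in `s` with the oracle `O`, the program `p` halts in a state and after a time that
satisfy `Q`. -/
def wp (O : List Bool → ℕ → Prop) (p : Prog) (Q : Mem → ℕ → Prop) (s : Mem) : Prop :=
  ∃ s' t, Exec O p s s' t ∧ Q s' t

theorem wp.mono {O : List Bool → ℕ → Prop} {p : Prog} {Q Q' : Mem → ℕ → Prop} {s : Mem}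
    (h : wp O p Q s) (hQ : ∀ s' t, Q s' t → Q' s' t) : wp O p Q' s := by
  obtain ⟨s', t, he, hq⟩ := h
  exact ⟨s', t, he, hQ _ _ hq⟩

section Rules

variable {O : List Bool → ℕ → Prop} {Q : Mem → ℕ → Prop} {s : Mem}

theorem wp_const {d n : ℕ} : wp O (.const d n) Q s ↔ Q (s.setReg d n) 1 := by
  refine ⟨?_, fun h => ⟨_, _, .const s d n, h⟩⟩
  rintro ⟨s', t, he, hq⟩; cases he; exact hq

theorem wp_add {d a b : ℕ} : wp O (.add d a b) Q s ↔ Q (s.setReg d (s.reg a + s.reg b)) 1 := by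
  refine ⟨?_, fun h => ⟨_, _, .add s d a b, h⟩⟩
  rintro ⟨s', t, he, hq⟩; cases he; exact hq

theorem wp_sub {d a b : ℕ} : wp O (.sub d a b) Q s ↔ Q (s.setReg d (s.reg a - s.reg b)) 1 := by
  refine ⟨?_, fun h => ⟨_, _, .sub s d a b, h⟩⟩
  rintro ⟨s', t, he, hq⟩; cases he; exact hq

theorem wp_half {d a : ℕ} : wp O (.half d a) Q s ↔ Q (s.setReg d (s.reg a / 2)) 1 := by
  refine ⟨?_, fun h => ⟨_, _, .half s d a, h⟩⟩
  rintro ⟨s', t, he, hq⟩; cases he; exact hq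

theorem wp_load {d A i : ℕ} :
    wp O (.load d A i) Q s ↔ Q (s.setReg d (s.arr A (s.reg i))) 1 := by
  refine ⟨?_, fun h => ⟨_, _, .load s d A i, h⟩⟩
  rintro ⟨s', t, he, hq⟩; cases he; exact hq

theorem wp_store {A i a : ℕ} :
    wp O (.store A i a) Q s ↔ Q (s.setArr A (s.reg i) (s.reg a)) 1 := by
  refine ⟨?_, fun h => ⟨_, _, .store s A i a, h⟩⟩
  rintro ⟨s', t, he, hq⟩; cases he; exact hq

theorem wp_query {d A l v : ℕ} (h : O (s.word A (s.reg l)) v)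
    (hQ : Q (s.setReg d v) (1 + s.reg l + Nat.size v)) : wp O (.query d A l) Q s :=
  ⟨_, _, .query s d A l v h, hQ⟩

theorem wp_seq {p q : Prog} :
    wp O (.seq p q) Q s ↔ wp O p (fun s₁ t₁ => wp O q (fun s₂ t₂ => Q s₂ (t₁ + t₂)) s₁) s := by
  constructor
  · rintro ⟨s', t, he, hq⟩
    cases he with
    | seq h₁ h₂ => exact ⟨_, _, h₁, _, _, h₂, hq⟩
  · rintro ⟨s₁, t₁, h₁, s₂, t₂, h₂, hq⟩
    exact ⟨_, _, .seq h₁ h₂, hq⟩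

theorem wp_ite {a : ℕ} {p q : Prog} :
    wp O (.ite a p q) Q s ↔
      (s.reg a ≠ 0 → wp O p (fun s' t => Q s' (1 + t)) s) ∧
      (s.reg a = 0 → wp O q (fun s' t => Q s' (1 + t)) s) := by
  constructor
  · rintro ⟨s', t, he, hq⟩
    cases he with
    | ite_true ha h => exact ⟨fun _ => ⟨_, _, h, hq⟩, fun h0 => absurd h0 ha⟩
    | ite_false ha h => exact ⟨fun h0 => absurd ha h0, fun _ => ⟨_, _, h, hq⟩⟩
  · rintro ⟨h1, h2⟩
    by_cases ha : s.reg a = 0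
    · obtain ⟨s', t, h, hq⟩ := h2 ha
      exact ⟨_, _, .ite_false ha h, hq⟩
    · obtain ⟨s', t, h, hq⟩ := h1 ha
      exact ⟨_, _, .ite_true ha h, hq⟩

/-- Total correctness of a loop that is left after exactly `N` rounds. -/
theorem wp_loop {a : ℕ} {p : Prog} (N : ℕ) (Inv : ℕ → Mem → Prop) (τ : ℕ → ℕ)
    (hstep : ∀ j < N, ∀ s, Inv j s →
      s.reg a ≠ 0 ∧ wp O p (fun s' t => t ≤ τ j ∧ Inv (j + 1) s') s)
    (hend : ∀ s, Inv N s → s.reg a = 0) (h0 : Inv 0 s) :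
    wp O (.loop a p) (fun s' t => t ≤ ∑ j ∈ Finset.range N, (τ j + 1) + 1 ∧ Inv N s') s := by
  induction N generalizing Inv τ s with
  | zero => exact ⟨s, 1, Exec.loop_stop (hend _ h0), by simp, h0⟩
  | succ N ih =>
    obtain ⟨ha, s₁, t₁, he₁, ht₁, hi₁⟩ := hstep 0 (by omega) s h0
    obtain ⟨s₂, t₂, he₂, ht₂, hi₂⟩ := ih (fun j => Inv (j + 1)) (fun j => τ (j + 1)) (s := s₁)
      (fun j hj s hs => hstep (j + 1) (by omega) s hs) hend hi₁
    refine ⟨s₂, _, .loop_step ha he₁ he₂, ?_, hi₂⟩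
    rw [Finset.sum_range_succ']
    omega

end Rules

@[simp] theorem Mem.setReg_reg (s : Mem) (d v r : ℕ) :
    (s.setReg d v).reg r = if r = d then v else s.reg r := by
  simp [Mem.setReg, Function.update_apply]

@[simp] theorem Mem.setReg_arr (s : Mem) (d v : ℕ) : (s.setReg d v).arr = s.arr := rfl

@[simp] theorem Mem.setArr_reg (s : Mem) (A i v : ℕ) : (s.setArr A i v).reg = s.reg := rfl

@[simp] theorem Mem.setArr_arr (s : Mem) (A i v B j : ℕ) :
    (s.setArr A i v).arr B j = if B = A ∧ j = i then v else s.arr B j := by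
  by_cases hB : B = A
  · subst hB; simp [Mem.setArr, Function.update_apply]
  · simp [Mem.setArr, hB]

theorem Mem.setArr_arr_of_ne (s : Mem) {A B : ℕ} (i v : ℕ) (h : B ≠ A) :
    (s.setArr A i v).arr B = s.arr B := by
  simp [Mem.setArr, h]

/-! ### Frames -/

/-- Whether the program `p` contains an instruction that writes to the register `r`. -/
def Prog.wr : Prog → ℕ → Bool
  | .const d _, r => r == d
  | .add d _ _, r => r == d
  | .sub d _ _, r => r == d
  | .half d _, r => r == d
  | .load d _ _, r => r == d
  | .store _ _ _, _ => false
  | .query d _ _, r => r == d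
  | .seq p q, r => p.wr r || q.wr r
  | .ite _ p q, r => p.wr r || q.wr r
  | .loop _ p, r => p.wr r

/-- Whether the program `p` contains an instruction that writes to the array `A`. -/
def Prog.wra : Prog → ℕ → Bool
  | .store A _ _, B => B == A
  | .seq p q, B => p.wra B || q.wra B
  | .ite _ p q, B => p.wra B || q.wra B
  | .loop _ p, B => p.wra B
  | _, _ => false

/-- The states `s` and `s'` agree on all registers and arrays that `p` does not write to. -/
def Prog.Frame (p : Prog) (s s' : Mem) : Prop :=
  (∀ r, p.wr r = false → s'.reg r = s.reg r) ∧ ∀ A, p.wra A = false → s'.arr A = s.arr A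

/-- A program changes only what its instructions write to.  As the written registers and arrays are
read off from the program text, that a piece of data survives a program is mostly a matter of
computation. -/
theorem Exec.frame {O : List Bool → ℕ → Prop} {p : Prog} {s s' : Mem} {t : ℕ}
    (h : Exec O p s s' t) : p.Frame s s' := by
  induction h with
  | const | add | sub | half | load | query =>
    refine ⟨fun r hr => ?_, fun A _ => rfl⟩
    simp only [Prog.wr, beq_eq_false_iff_ne] at hr
    simp [hr]
  | store =>
    refine ⟨fun r hr => rfl, fun B hB => ?_⟩
    simp only [Prog.wra, beq_eq_false_iff_ne] at hB
    simp [Mem.setArr, hB]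
  | seq _ _ ih₁ ih₂ =>
    refine ⟨fun r hr => ?_, fun A hA => ?_⟩
    · simp only [Prog.wr, Bool.or_eq_false_iff] at hr
      rw [ih₂.1 r hr.2, ih₁.1 r hr.1]
    · simp only [Prog.wra, Bool.or_eq_false_iff] at hA
      rw [ih₂.2 A hA.2, ih₁.2 A hA.1]
  | ite_true _ _ ih =>
    refine ⟨fun r hr => ?_, fun A hA => ?_⟩
    · simp only [Prog.wr, Bool.or_eq_false_iff] at hr
      exact ih.1 r hr.1
    · simp only [Prog.wra, Bool.or_eq_false_iff] at hA
      exact ih.2 A hA.1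
  | ite_false _ _ ih =>
    refine ⟨fun r hr => ?_, fun A hA => ?_⟩
    · simp only [Prog.wr, Bool.or_eq_false_iff] at hr
      exact ih.1 r hr.2
    · simp only [Prog.wra, Bool.or_eq_false_iff] at hA
      exact ih.2 A hA.2
  | loop_stop => exact ⟨fun _ _ => rfl, fun _ _ => rfl⟩
  | loop_step _ _ _ ih₁ ih₂ =>
    refine ⟨fun r hr => ?_, fun A hA => ?_⟩
    · rw [ih₂.1 r hr, ih₁.1 r hr]
    · rw [ih₂.2 A hA, ih₁.2 A hA]

theorem wp.frame {O : List Bool → ℕ → Prop} {p : Prog} {Q : Mem → ℕ → Prop} {s : Mem}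
    (h : wp O p Q s) : wp O p (fun s' t => Q s' t ∧ p.Frame s s') s := by
  obtain ⟨s', t, he, hq⟩ := h
  exact ⟨s', t, he, hq, he.frame⟩

/-! ### Counting loops, copying and multiplication -/

/-- `for i < b do p`, where `c` is a scratch register. -/
def forP (i b c : ℕ) (p : Prog) : Prog :=
  .seq (.const i 0) (.seq (.sub c b i)
    (.loop c (.seq p (.seq (.const c 1) (.seq (.add i i c) (.sub c b i))))))

/-- Total correctness of a counting loop whose round `j` takes time at most `τ j`.  The invariant
must not depend on the registers `i` and `c`, which change between the rounds; that `i` contains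
the number of the round is provided by the rule. -/
theorem wp_forP' {O : List Bool → ℕ → Prop} {i b c : ℕ} {p : Prog} {s₀ : Mem}
    (Inv : ℕ → Mem → Prop) (τ : ℕ → ℕ) (hic : i ≠ c) (hib : i ≠ b) (hbc : b ≠ c)
    (hi : p.wr i = false) (hb : p.wr b = false)
    (hst : ∀ j s s', (∀ r, r ≠ i → r ≠ c → s'.reg r = s.reg r) → s'.arr = s.arr →
      Inv j s → Inv j s')
    (h0 : Inv 0 s₀)
    (hstep : ∀ j < s₀.reg b, ∀ s, Inv j s → s.reg i = j → (forP i b c p).Frame s₀ s →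
      wp O p (fun s' t => t ≤ τ j ∧ Inv (j + 1) s') s) :
    wp O (forP i b c p)
      (fun s' t => t ≤ ∑ j ∈ Finset.range (s₀.reg b), (τ j + 4) + 3 ∧ Inv (s₀.reg b) s') s₀ := by
  have hbw : (forP i b c p).wr b = false := by
    simp [forP, Prog.wr, hb, Ne.symm hib, hbc]
  simp only [forP, wp_seq, wp_const, wp_sub]
  have key := wp_loop (O := O) (a := c)
    (p := .seq p (.seq (.const c 1) (.seq (.add i i c) (.sub c b i)))) (s₀.reg b)
    (fun j s => Inv j s ∧ s.reg i = j ∧ s.reg c = s₀.reg b - j ∧ (forP i b c p).Frame s₀ s)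
    (fun j => τ j + 3) (s := (s₀.setReg i 0).setReg c
      ((s₀.setReg i 0).reg b - (s₀.setReg i 0).reg i)) ?_ ?_ ?_
  · refine key.mono fun s' t h => ⟨?_, h.2.1⟩
    have h1 : t ≤ ∑ j ∈ Finset.range (s₀.reg b), (τ j + 4) + 1 := h.1
    omega
  · rintro j hj s ⟨hI, hij, hcj, hF⟩
    refine ⟨by omega, ?_⟩
    rw [wp_seq]
    refine (hstep j hj s hI hij hF).frame.mono ?_
    rintro s' t ⟨⟨ht, hI'⟩, hF'⟩
    have hsi : s'.reg i = j := by rw [hF'.1 i hi, hij]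
    have hsb : s'.reg b = s₀.reg b := by rw [hF'.1 b hb, hF.1 b hbw]
    simp only [wp_seq, wp_const, wp_add, wp_sub]
    refine ⟨by omega, ?_, ?_, ?_, ?_, ?_⟩
    · refine hst _ s' _ ?_ rfl hI'
      intro r hr hrc
      simp [hr, hrc]
    · simp [hic, hsi]
    · simp [Ne.symm hib, hbc, hic, hsb, hsi]
    · intro r hr
      have hr' := hr
      simp only [forP, Prog.wr, Bool.or_eq_false_iff, beq_eq_false_iff_ne] at hr'
      rw [← hF.1 r hr, ← hF'.1 r hr'.2.2.1]
      simp [hr'.1, hr'.2.1]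
    · intro A hA
      have hA' := hA
      simp only [forP, Prog.wra, Bool.false_or, Bool.or_false] at hA'
      rw [← hF.2 A hA, ← hF'.2 A hA']
      rfl
  · rintro s ⟨-, -, h, -⟩
    omega
  · refine ⟨hst _ s₀ _ ?_ rfl h0, ?_, ?_, ?_, ?_⟩
    · intro r hr hrc
      simp [hr, hrc]
    · simp [hic]
    · simp [Ne.symm hib]
    · intro r hr
      simp only [forP, Prog.wr, Bool.or_eq_false_iff, beq_eq_false_iff_ne] at hr
      simp [hr.1, hr.2.1]
    · intro A _
      rfl

/-- Total correctness of a counting loop, with a uniform bound on the time of a round. -/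
theorem wp_forP {O : List Bool → ℕ → Prop} {i b c : ℕ} {p : Prog} {s₀ : Mem}
    (Inv : ℕ → Mem → Prop) (τ N : ℕ) (hic : i ≠ c) (hib : i ≠ b) (hbc : b ≠ c)
    (hi : p.wr i = false) (hb : p.wr b = false)
    (hst : ∀ j s s', (∀ r, r ≠ i → r ≠ c → s'.reg r = s.reg r) → s'.arr = s.arr →
      Inv j s → Inv j s')
    (hN : s₀.reg b = N) (h0 : Inv 0 s₀)
    (hstep : ∀ j < N, ∀ s, Inv j s → s.reg i = j → (forP i b c p).Frame s₀ s →
      wp O p (fun s' t => t ≤ τ ∧ Inv (j + 1) s') s) :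
    wp O (forP i b c p) (fun s' t => t ≤ N * (τ + 4) + 3 ∧ Inv N s') s₀ := by
  subst hN
  have := wp_forP' (O := O) Inv (fun _ => τ) hic hib hbc hi hb hst h0 hstep
  simpa using this

/-- `d := a * b`, where `i` and `c` are scratch registers. -/
def mulP (d a b i c : ℕ) : Prog := .seq (.const d 0) (forP i b c (.add d d a))

theorem wp_mulP {O : List Bool → ℕ → Prop} {d a b i c : ℕ} {s : Mem}
    (h : [d, a, i, c].Nodup) (hd : d ≠ b) (hi : i ≠ b) (hc : b ≠ c) :
    wp O (mulP d a b i c)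
      (fun s' t => t ≤ 5 * s.reg b + 4 ∧ s'.reg d = s.reg a * s.reg b) s := by
  simp only [List.nodup_cons, List.mem_cons, List.not_mem_nil, or_false, not_or] at h
  obtain ⟨⟨hda, hdi, hdc⟩, ⟨hai, hac⟩, hic, -⟩ := h
  rw [mulP, wp_seq, wp_const]
  refine (wp_forP (fun j s' => s'.reg d = s.reg a * j) 1 (s.reg b) hic hi hc ?_ ?_ ?_ ?_ ?_
    ?_).mono ?_
  · simpa [Prog.wr] using Ne.symm hdi
  · simpa [Prog.wr] using Ne.symm hd
  · intro j s s' h _ hI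
    rw [h d hdi hdc]; exact hI
  · simp [Ne.symm hd]
  · simp
  · intro j hj s' hI hj' hF
    have : s'.reg a = s.reg a := by
      rw [hF.1 a (by simp [forP, Prog.wr, hai, hac, Ne.symm hda])]
      simp [Ne.symm hda]
    rw [wp_add]
    refine ⟨le_rfl, ?_⟩
    simp only [Mem.setReg_reg, if_true, hI, this]
    ring
  · rintro s' t ⟨ht, h⟩
    exact ⟨by omega, h⟩

theorem Prog.Frame.trans {p : Prog} {s s' s'' : Mem} (h : p.Frame s s') (h' : p.Frame s' s'') :
    p.Frame s s'' :=
  ⟨fun r hr => (h'.1 r hr).trans (h.1 r hr), fun A hA => (h'.2 A hA).trans (h.2 A hA)⟩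

theorem Prog.Frame.weaken {p q : Prog} {s s' : Mem} (h : p.Frame s s')
    (hr : ∀ r, q.wr r = false → p.wr r = false)
    (hA : ∀ A, q.wra A = false → p.wra A = false) : q.Frame s s' :=
  ⟨fun r h' => h.1 r (hr r h'), fun A h' => h.2 A (hA A h')⟩

/-- `d := a` -/
def copyP (d a : ℕ) : Prog := .seq (.const d 0) (.add d d a)

theorem wp_copyP {O : List Bool → ℕ → Prop} {Q : Mem → ℕ → Prop} {d a : ℕ} {s : Mem}
    (h : d ≠ a) : wp O (copyP d a) Q s ↔ Q ((s.setReg d 0).setReg d (s.reg a)) 2 := by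
  simp [copyP, wp_seq, wp_const, wp_add, Ne.symm h]

theorem Mem.word_congr {s s' : Mem} {A : ℕ} (h : s'.arr A = s.arr A) (l : ℕ) :
    s'.word A l = s.word A l := by
  simp [Mem.word, h]

theorem Mem.length_word (s : Mem) (A l : ℕ) : (s.word A l).length = l := by simp [Mem.word]

theorem Mem.word_setArr_succ (s : Mem) (A l v : ℕ) :
    (s.setArr A l v).word A (l + 1) = s.word A l ++ [v != 0] := by
  simp only [Mem.word, List.range_succ, List.map_append, List.map_cons, List.map_nil,
    Mem.setArr_arr]
  congr 1
  · refine List.map_congr_left fun i hi => ?_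
    have : i ≠ l := (List.mem_range.1 hi).ne
    simp [this]

theorem Mem.take_word (s : Mem) (A : ℕ) {j l : ℕ} (h : j ≤ l) :
    (s.word A l).take j = s.word A j := by
  rw [Mem.word, ← List.map_take, List.take_range, min_eq_left h]
  rfl

/-! ### Writing the host tournaments -/

/-- The `m × m` table of Booleans stored row by row in the cells of an array. -/
def tbl (m : ℕ) (f : ℕ → ℕ) (a b : ℕ) : Bool := f (a * m + b) != 0

/-- The orientation of the pair `(a, u)`, `(b, v)` for `a < b` in the host tournament: it is
given by the table `Q` unless `b < k`, in which case the pair points forward precisely if this is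
so in the table `W` and `(u, v)` is in the relation `E`. -/
def orient (k : ℕ) (Q W E : ℕ → ℕ → Bool) (a u b v : ℕ) : Bool :=
  if b < k then W a b && E u v else Q a b

/-- The adjacency relation of the host tournament, whose vertices are pairs of a class and an
element. -/
def hostRel (k : ℕ) (Q W E : ℕ → ℕ → Bool) (x y : ℕ × ℕ) : Bool :=
  if x.1 < y.1 then orient k Q W E x.1 x.2 y.1 y.2
  else if y.1 < x.1 then !orient k Q W E y.1 y.2 x.1 x.2
  else decide (x.2 < y.2)

/-- The vertices of the host tournament: the pairs `(a, u)` with `a < m` and `u < n` for which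
the class `a` is switched on in `d`. -/
def hostVerts (m n : ℕ) (d : ℕ → Bool) : List (ℕ × ℕ) :=
  (List.range m).flatMap fun a => if d a then (List.range n).map fun u => (a, u) else []

/-- Appends the truth value of the register `34` to the word in the array `1` of length given by
the register `20`. -/
def emitP : Prog := .seq (.store 1 20 34) (.seq (.const 29 1) (.add 20 20 29))

theorem wp_emitP {O : List Bool → ℕ → Prop} {s : Mem} :
    wp O emitP (fun s' t => t = 3 ∧ s'.reg 20 = s.reg 20 + 1 ∧
      s'.word 1 (s'.reg 20) = s.word 1 (s.reg 20) ++ [s.reg 34 != 0]) s := by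
  simp only [emitP, wp_seq, wp_store, wp_const, wp_add]
  refine ⟨trivial, by simp, ?_⟩
  rw [← Mem.word_setArr_succ]
  simp [Mem.word]

/-- The entry of the table in the array `A` at the registers `a` and `b`. -/
def entryP (A a b : ℕ) : Prog :=
  .seq (mulP 35 a 3 36 37) (.seq (.add 35 35 b) (.load 34 A 35))

theorem wp_entryP {O : List Bool → ℕ → Prop} {A a b : ℕ} {s : Mem}
    (ha : a ∉ [35, 36, 37]) (hb : b ∉ [35, 36, 37]) :
    wp O (entryP A a b) (fun s' t => t ≤ 5 * s.reg 3 + 6 ∧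
      (s'.reg 34 != 0) = tbl (s.reg 3) (s.arr A) (s.reg a) (s.reg b)) s := by
  simp only [List.mem_cons, List.not_mem_nil, or_false, not_or] at ha hb
  rw [entryP, wp_seq]
  refine (wp_mulP (by simp; omega) (by simp) (by simp) (by simp)).frame.mono ?_
  rintro s' t ⟨⟨ht, h⟩, hf⟩
  simp only [wp_seq, wp_add, wp_load]
  refine ⟨by omega, ?_⟩
  have e1 : s'.reg b = s.reg b := hf.1 b (by simp [mulP, forP, Prog.wr]; omega)
  have e2 : s'.arr A = s.arr A := hf.2 A rfl
  simp [tbl, h, e1, e2]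

/-- Computes `orient` at the registers `30`, `32`, `31`, `33`, with the relation in the
array `e`. -/
def orientP (e : ℕ) : Prog :=
  .seq (.sub 38 1 31) (.ite 38
    (.seq (entryP 3 30 31) (.ite 34
      (.seq (mulP 35 32 2 36 37) (.seq (.add 35 35 33) (.load 34 e 35))) (.const 34 0)))
    (entryP 2 30 31))

theorem wp_orientP {O : List Bool → ℕ → Prop} {e : ℕ} {s : Mem} :
    wp O (orientP e) (fun s' t => t ≤ 5 * s.reg 3 + 5 * s.reg 2 + 20 ∧
      (s'.reg 34 != 0) = orient (s.reg 1) (tbl (s.reg 3) (s.arr 2)) (tbl (s.reg 3) (s.arr 3))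
        (tbl (s.reg 2) (s.arr e)) (s.reg 30) (s.reg 32) (s.reg 31) (s.reg 33)) s := by
  rw [orientP, wp_seq, wp_sub, wp_ite]
  constructor
  · intro h
    have hk : s.reg 31 < s.reg 1 := by simpa [Nat.sub_eq_zero_iff_le] using h
    rw [wp_seq]
    refine (wp_entryP (by decide) (by decide)).frame.mono ?_
    rintro s₁ t₁ ⟨⟨ht₁, h₁⟩, hf₁⟩
    simp only [Mem.setReg_reg, Mem.setReg_arr, Nat.reduceEqDiff, if_false]
      at ht₁ h₁
    rw [wp_ite]
    constructor
    · intro hw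
      rw [wp_seq]
      refine (wp_mulP (by simp) (by simp) (by simp) (by simp)).frame.mono ?_
      rintro s₂ t₂ ⟨⟨ht₂, h₂⟩, hf₂⟩
      simp only [wp_seq, wp_add, wp_load]
      have e0 : s₁.reg 2 = s.reg 2 := by rw [hf₁.1 2 rfl]; simp
      have e1 : s₁.reg 32 = s.reg 32 := by rw [hf₁.1 32 rfl]; simp
      have e2 : s₂.reg 33 = s.reg 33 := by rw [hf₂.1 33 rfl, hf₁.1 33 rfl]; simp
      have e3 : s₂.arr e = s.arr e := by rw [hf₂.2 e rfl, hf₁.2 e rfl]; simp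
      rw [e0] at ht₂ h₂
      refine ⟨by omega, ?_⟩
      have hw' : tbl (s.reg 3) (s.arr 3) (s.reg 30) (s.reg 31) = true := by
        rw [← h₁]; simpa using hw
      simp only [orient, hk, hw', if_true, Bool.true_and]
      simp [tbl, h₂, e1, e2, e3]
    · intro hw
      rw [wp_const]
      refine ⟨by omega, ?_⟩
      have hw' : tbl (s.reg 3) (s.arr 3) (s.reg 30) (s.reg 31) = false := by
        rw [← h₁]; simpa using hw
      simp [orient, hk, hw']
  · intro h
    have hk : ¬ s.reg 31 < s.reg 1 := by simpa [Nat.sub_eq_zero_iff_le] using h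
    refine (wp_entryP (by decide) (by decide)).mono ?_
    rintro s₁ t₁ ⟨ht₁, h₁⟩
    simp only [Mem.setReg_reg, Mem.setReg_arr, Nat.reduceEqDiff, if_false]
      at ht₁ h₁
    refine ⟨by omega, ?_⟩
    rw [h₁]
    simp [orient, hk]

/-- Computes `hostRel` at the pairs in the registers `21`, `22` and `23`, `24`. -/
def edgeP (e : ℕ) : Prog :=
  .seq (.sub 38 23 21) (.ite 38
    (.seq (copyP 30 21) (.seq (copyP 31 23) (.seq (copyP 32 22) (.seq (copyP 33 24) (orientP e)))))
    (.seq (.sub 38 21 23) (.ite 38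
      (.seq (copyP 30 23) (.seq (copyP 31 21) (.seq (copyP 32 24) (.seq (copyP 33 22)
        (.seq (orientP e) (.seq (.const 39 1) (.sub 34 39 34)))))))
      (.sub 34 24 22))))

theorem wp_edgeP {O : List Bool → ℕ → Prop} {e : ℕ} {s : Mem} :
    wp O (edgeP e) (fun s' t => t ≤ 5 * s.reg 3 + 5 * s.reg 2 + 40 ∧
      (s'.reg 34 != 0) = hostRel (s.reg 1) (tbl (s.reg 3) (s.arr 2)) (tbl (s.reg 3) (s.arr 3))
        (tbl (s.reg 2) (s.arr e)) (s.reg 21, s.reg 22) (s.reg 23, s.reg 24)) s := by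
  rw [edgeP, wp_seq, wp_sub, wp_ite]
  constructor
  · intro h
    have hab : s.reg 21 < s.reg 23 := by simpa [Nat.sub_eq_zero_iff_le] using h
    rw [wp_seq, wp_copyP (by decide), wp_seq, wp_copyP (by decide), wp_seq, wp_copyP (by decide),
      wp_seq, wp_copyP (by decide)]
    refine wp_orientP.mono ?_
    rintro s₁ t₁ ⟨ht₁, h₁⟩
    simp only [Mem.setReg_reg, Mem.setReg_arr, Nat.reduceEqDiff, if_false,
      if_true, OfNat.one_ne_ofNat] at ht₁ h₁
    refine ⟨by omega, ?_⟩
    rw [h₁]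
    simp [hostRel, hab]
  · intro h
    have hab : ¬ s.reg 21 < s.reg 23 := by simpa [Nat.sub_eq_zero_iff_le] using h
    rw [wp_seq, wp_sub, wp_ite]
    constructor
    · intro h
      have hba : s.reg 23 < s.reg 21 := by simpa [Nat.sub_eq_zero_iff_le] using h
      rw [wp_seq, wp_copyP (by decide), wp_seq, wp_copyP (by decide), wp_seq,
        wp_copyP (by decide), wp_seq, wp_copyP (by decide), wp_seq]
      refine wp_orientP.mono ?_
      rintro s₁ t₁ ⟨ht₁, h₁⟩
      simp only [Mem.setReg_reg, Mem.setReg_arr, Nat.reduceEqDiff, if_false,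
        if_true, OfNat.one_ne_ofNat] at ht₁ h₁
      simp only [wp_seq, wp_const, wp_sub]
      refine ⟨by omega, ?_⟩
      simp only [Mem.setReg_reg, Nat.reduceEqDiff, if_false, if_true, hostRel,
        hab, hba, ← h₁]
      by_cases h0 : s₁.reg 34 = 0
      · simp [h0]
      · have : 1 - s₁.reg 34 = 0 := by omega
        simp [h0, this]
    · intro h
      have hba : ¬ s.reg 23 < s.reg 21 := by simpa [Nat.sub_eq_zero_iff_le] using h
      rw [wp_sub]
      refine ⟨by omega, ?_⟩
      simp only [Mem.setReg_reg, Nat.reduceEqDiff, if_false, if_true, hostRel,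
        hab, hba]
      rw [Bool.eq_iff_iff]
      simp [Nat.sub_eq_zero_iff_le]

/-- Runs `p` with the registers `a`, `u` going through the vertices of the host tournament in
lexicographic order. -/
def forV (a u ca cu : ℕ) (p : Prog) : Prog :=
  forP a 3 ca (.seq (entryP 3 a a) (.ite 34 (forP u 2 cu p) (.const 34 0)))

/-- If `p` appends the word `out x` in the round for the vertex `x`, then the loop appends these
words for all vertices of the host tournament.  The loop over the elements of a class is skipped if
the class is switched off. -/
theorem wp_forV {O : List Bool → ℕ → Prop} {a u ca cu : ℕ} {p : Prog} {s₀ : Mem} {m n : ℕ}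
    (out : ℕ × ℕ → List Bool) (τ : ℕ)
    (hd : [a, u, ca, cu, 2, 3, 20, 34, 35, 36, 37].Nodup)
    (hp : ∀ r ∈ [a, u, 2, 3], p.wr r = false) (hp3 : p.wra 3 = false)
    (hm : s₀.reg 3 = m) (hn : s₀.reg 2 = n)
    (h : ∀ x y s, x < m → y < n → s.reg a = x → s.reg u = y → (forV a u ca cu p).Frame s₀ s →
      wp O p (fun s' t => t ≤ τ ∧
        s'.word 1 (s'.reg 20) = s.word 1 (s.reg 20) ++ out (x, y)) s) :
    wp O (forV a u ca cu p) (fun s' t => t ≤ m * (n * (τ + 4) + 5 * m + 16) + 3 ∧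
      s'.word 1 (s'.reg 20) = s₀.word 1 (s₀.reg 20) ++
        (hostVerts m n fun a => tbl m (s₀.arr 3) a a).flatMap out) s₀ := by
  simp only [List.nodup_cons, List.mem_cons, List.not_mem_nil, or_false, not_or] at hd
  obtain ⟨⟨hau, hac, hacu, ha2, ha3, ha20, ha34, ha35, ha36, ha37⟩,
    ⟨huc, hucu, hu2, hu3, hu20, hu34, hu35, hu36, hu37⟩,
    ⟨hccu, hc2, hc3, hc20, hc34, hc35, hc36, hc37⟩,
    ⟨hcu2, hcu3, hcu20, hcu34, hcu35, hcu36, hcu37⟩, -⟩ := hd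
  simp only [List.forall_mem_cons] at hp
  obtain ⟨hpa, hpu, hp2, hp3', -⟩ := hp
  set q : Prog := .seq (entryP 3 a a) (.ite 34 (forP u 2 cu p) (.const 34 0)) with hq
  have hqw : ∀ r, q.wr r = (r == 35 || r == 36 || r == 37 || r == 34 || r == u || r == cu ||
      p.wr r) := by
    intro r
    simp only [hq, entryP, mulP, forP, Prog.wr]
    rw [Bool.eq_iff_iff]
    simp only [Bool.or_eq_true, beq_iff_eq]
    tauto
  have hqa : ∀ A, q.wra A = p.wra A := by
    intro A
    simp [hq, entryP, mulP, forP, Prog.wra]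
  set d : ℕ → Bool := fun a => tbl m (s₀.arr 3) a a with hdd
  have hFw : ∀ r, (forV a u ca cu p).wr r = false → q.wr r = false ∧ r ≠ a ∧ r ≠ ca := by
    intro r hr
    rw [forV, ← hq] at hr
    simp only [forP, Prog.wr, Bool.or_eq_false_iff, beq_eq_false_iff_ne] at hr
    tauto
  have hFa : ∀ A, (forV a u ca cu p).wra A = q.wra A := by
    intro A
    rw [forV, ← hq]
    simp [forP, Prog.wra]
  change wp O (forP a 3 ca q) _ _
  refine (wp_forP (fun j s => s.word 1 (s.reg 20) = s₀.word 1 (s₀.reg 20) ++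
    ((List.range j).flatMap fun a =>
      if d a then (List.range n).map fun u => (a, u) else []).flatMap out)
    (n * (τ + 4) + 5 * m + 12) m hac ha3 (Ne.symm hc3) ?_ ?_ ?_ hm (by simp) ?_).mono ?_
  · rw [hqw]; simp [*]
  · rw [hqw]; simp [hp3', Ne.symm hu3, Ne.symm hcu3]
  · intro j s s' hr ha hI
    rw [hr 20 (Ne.symm ha20) (Ne.symm hc20), Mem.word_congr (s := s) (by rw [ha]), hI]
  · intro j hj s hI haj hF
    have hF' : (forV a u ca cu p).Frame s₀ s := by rw [forV, ← hq]; exact hF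
    clear hF
    have h3 : s.reg 3 = m := by
      rw [hF'.1 3 ?_, hm]
      rw [forV, ← hq]
      simp [forP, Prog.wr, hqw, hp3', Ne.symm ha3, Ne.symm hu3, Ne.symm hc3, Ne.symm hcu3]
    have h2 : s.reg 2 = n := by
      rw [hF'.1 2 ?_, hn]
      rw [forV, ← hq]
      simp [forP, Prog.wr, hqw, hp2, Ne.symm ha2, Ne.symm hu2, Ne.symm hc2, Ne.symm hcu2]
    have hA3 : s.arr 3 = s₀.arr 3 := hF'.2 3 (by rw [hFa, hqa, hp3])
    rw [hq, wp_seq]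
    refine (wp_entryP (by simp [*]) (by simp [*])).frame.mono ?_
    rintro s₁ t₁ ⟨⟨ht₁, h₁⟩, hf₁⟩
    have hf₁' : (forV a u ca cu p).Frame s s₁ := by
      refine hf₁.weaken (fun r hr => ?_) fun A _ => rfl
      have := (hFw r hr).1
      rw [hq, Prog.wr, Bool.or_eq_false_iff] at this
      exact this.1
    rw [h3, hA3, haj] at h₁
    rw [h3] at ht₁
    have hw₁ : s₁.word 1 (s₁.reg 20) = s.word 1 (s.reg 20) := by
      rw [hf₁.1 20 rfl, Mem.word_congr (hf₁.2 1 rfl)]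
    rw [wp_ite]
    constructor
    · intro hne
      have hdj : d j = true := by rw [hdd]; simp only; rw [← h₁]; simpa using hne
      refine (wp_forP (fun i s' => s'.word 1 (s'.reg 20) = s.word 1 (s.reg 20) ++
        ((List.range i).map fun u => (j, u)).flatMap out) τ n hucu hu2 (Ne.symm hcu2)
        hpu hp2 ?_ ?_ (by simpa using hw₁) ?_).mono ?_
      · intro j s s' hr ha hI
        rw [hr 20 (Ne.symm hu20) (Ne.symm hcu20), Mem.word_congr (s := s) (by rw [ha]), hI]
      · rw [hf₁.1 2 rfl, h2]
      · intro i hi s₂ hI₂ hi₂ hF₂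
        have hF₂' : (forV a u ca cu p).Frame s₁ s₂ := by
          refine hF₂.weaken (fun r hr => ?_) fun A hA => ?_
          · have := (hFw r hr).1
            simp only [hq, Prog.wr, Bool.or_eq_false_iff] at this
            exact this.2.1
          · rw [hFa, hqa] at hA
            simp [forP, Prog.wra, hA]
        have ha₂ : s₂.reg a = j := by
          rw [hF₂.1 a (by simp [forP, Prog.wr, *]),
            hf₁.1 a (by simp [entryP, mulP, forP, Prog.wr, *]), haj]
        refine (h j i s₂ hj hi ha₂ hi₂ ((hF'.trans hf₁').trans hF₂')).mono ?_
        rintro s' t ⟨ht, h'⟩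
        refine ⟨ht, ?_⟩
        rw [h', hI₂, List.range_succ]
        simp
      · rintro s' t ⟨ht, h'⟩
        refine ⟨by omega, ?_⟩
        rw [h', hI, List.range_succ]
        simp [hdj]
    · intro h0
      have hdj : d j = false := by rw [hdd]; simp only; rw [← h₁]; simpa using h0
      rw [wp_const]
      refine ⟨by omega, ?_⟩
      rw [List.range_succ]
      simp only [Mem.setReg_reg, show (20 : ℕ) ≠ 34 by decide, if_false]
      change s₁.word 1 (s₁.reg 20) = _
      rw [hw₁, hI]
      simp [hdj]
  · rintro s' t ⟨ht, h'⟩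
    refine ⟨by linarith, ?_⟩
    rw [h']
    rfl

/-- The word in the array `1`, of length given by the register `4`, is extended by the encoding of
the host tournament with the relation in the array `e`. -/
def buildP (e : ℕ) : Prog :=
  .seq (copyP 20 4) (.seq (forV 21 22 25 26 (.seq (.const 34 1) emitP))
    (.seq (.const 34 0) (.seq emitP
      (forV 21 22 25 26 (forV 23 24 27 28 (.seq (edgeP e) emitP))))))

theorem wp_buildP {O : List Bool → ℕ → Prop} {e : ℕ} {s : Mem} {m n L : ℕ} (he : e ≠ 1)
    (hm : s.reg 3 = m) (hn : s.reg 2 = n) (hmL : m ≤ L) (hnL : n ≤ L) (hL : 1 ≤ L) :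
    wp O (buildP e) (fun s' t => t ≤ 300 * L ^ 5 ∧
      s'.word 1 (s'.reg 20) = s.word 1 (s.reg 4) ++
        unaryThen (hostVerts m n fun a => tbl m (s.arr 3) a a).length
          ((hostVerts m n fun a => tbl m (s.arr 3) a a).flatMap fun x =>
            (hostVerts m n fun a => tbl m (s.arr 3) a a).map fun y =>
              hostRel (s.reg 1) (tbl m (s.arr 2)) (tbl m (s.arr 3)) (tbl n (s.arr e)) x y)) s := by
  set vs := hostVerts m n fun a => tbl m (s.arr 3) a a with hvs
  rw [buildP, wp_seq, wp_copyP (by decide), wp_seq]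
  refine (wp_forV (m := m) (n := n) (fun _ => [true]) 4 (by decide) (by decide) rfl
    (by simpa using hm) (by simpa using hn) ?_).frame.mono ?_
  · intro x y s₁ _ _ _ _ _
    rw [wp_seq, wp_const]
    refine wp_emitP.mono ?_
    rintro s' t ⟨ht, -, h⟩
    exact ⟨by omega, by rw [h]; simp [Mem.word]⟩
  rintro s₁ t₁ ⟨⟨ht₁, h₁⟩, hf₁⟩
  change _ = s.word 1 (s.reg 4) ++ vs.flatMap _ at h₁
  rw [wp_seq, wp_const, wp_seq]
  refine wp_emitP.frame.mono ?_
  rintro s₂ t₂ ⟨⟨ht₂, -, h₂⟩, hf₂⟩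
  have hf : ∀ r, r ∉ [20, 21, 22, 25, 26, 34, 35, 36, 37, 29] → s₂.reg r = s.reg r := by
    intro r hr
    simp only [List.mem_cons, List.not_mem_nil, or_false, not_or] at hr
    rw [hf₂.1 r (by simp [emitP, Prog.wr, hr])]
    simp only [Mem.setReg_reg, hr, if_false]
    rw [hf₁.1 r (by simp [forV, entryP, mulP, emitP, forP, Prog.wr, hr])]
    simp [hr]
  have hfa : ∀ A, A ≠ 1 → s₂.arr A = s.arr A := by
    intro A hA
    rw [hf₂.2 A (by simp [emitP, Prog.wra, hA])]
    simp only [Mem.setReg_arr]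
    rw [hf₁.2 A (by simp [forV, entryP, mulP, emitP, forP, Prog.wra, hA])]
    simp
  have hm₂ : s₂.reg 3 = m := by rw [hf 3 (by decide), hm]
  have hn₂ : s₂.reg 2 = n := by rw [hf 2 (by decide), hn]
  have hd₂ : (hostVerts m n fun a => tbl m (s₂.arr 3) a a) = vs := by rw [hfa 3 (by decide)]
  set τ₀ := 5 * m + 5 * n + 43 with hτ₀
  refine (wp_forV (m := m) (n := n) (fun x => vs.map fun y =>
    hostRel (s.reg 1) (tbl m (s.arr 2)) (tbl m (s.arr 3)) (tbl n (s.arr e)) x y)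
    (m * (n * (τ₀ + 4) + 5 * m + 16) + 3) (by decide)
    (by simp only [List.forall_mem_cons]; exact ⟨rfl, rfl, rfl, rfl, by simp⟩) rfl hm₂ hn₂
    ?_).mono ?_
  · intro x y s₃ _ _ hx hy hF₃
    have hm₃ : s₃.reg 3 = m := by rw [hF₃.1 3 rfl, hm₂]
    have hn₃ : s₃.reg 2 = n := by rw [hF₃.1 2 rfl, hn₂]
    have hA₃ : ∀ A, A ≠ 1 → s₃.arr A = s.arr A := by
      intro A hA
      rw [hF₃.2 A (by simp [forV, entryP, mulP, edgeP, orientP, copyP, emitP, forP, Prog.wra, hA]),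
        hfa A hA]
    refine (wp_forV (m := m) (n := n) (fun z =>
      [hostRel (s.reg 1) (tbl m (s.arr 2)) (tbl m (s.arr 3)) (tbl n (s.arr e)) (x, y) z])
      τ₀ (by decide)
      (by simp only [List.forall_mem_cons]; exact ⟨rfl, rfl, rfl, rfl, by simp⟩) rfl hm₃ hn₃
      ?_).mono ?_
    · intro x' y' s₄ _ _ hx' hy' hF₄
      have hA₄ : ∀ A, A ≠ 1 → s₄.arr A = s.arr A := by
        intro A hA
        rw [hF₄.2 A (by
          simp [forV, entryP, mulP, edgeP, orientP, copyP, emitP, forP, Prog.wra, hA]), hA₃ A hA]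
      rw [wp_seq]
      refine wp_edgeP.frame.mono ?_
      rintro s₅ t₅ ⟨⟨ht₅, h₅⟩, hf₅⟩
      refine wp_emitP.mono ?_
      rintro s₆ t₆ ⟨ht₆, -, h₆⟩
      rw [hF₄.1 2 rfl, hF₄.1 3 rfl, hn₃, hm₃] at ht₅ h₅
      rw [hA₄ 2 (by decide), hA₄ 3 (by decide), hA₄ e he, hx', hy', hF₄.1 21 rfl, hF₄.1 22 rfl,
        hx, hy, hF₄.1 1 rfl, hF₃.1 1 rfl, hf 1 (by decide)] at h₅
      refine ⟨by omega, ?_⟩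
      rw [h₆, h₅, hf₅.1 20 rfl, Mem.word_congr (hf₅.2 1 rfl)]
    · rintro s' t ⟨ht, h⟩
      refine ⟨ht, ?_⟩
      rw [h, hA₃ 3 (by decide), ← hvs, List.map_eq_flatMap]
  · rintro s' t ⟨ht, h⟩
    constructor
    · have hτ : τ₀ + 4 ≤ 57 * L := by omega
      have h1 : n * (τ₀ + 4) ≤ 57 * L ^ 2 := by
        calc n * (τ₀ + 4) ≤ L * (57 * L) := Nat.mul_le_mul hnL hτ
          _ = _ := by ring
      have l1 : L ≤ L ^ 2 := Nat.le_self_pow (by decide) L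
      have h2 : m * (n * (τ₀ + 4) + 5 * m + 16) ≤ 78 * L ^ 3 := by
        calc m * (n * (τ₀ + 4) + 5 * m + 16) ≤ L * (78 * L ^ 2) :=
              Nat.mul_le_mul hmL (by omega)
          _ = _ := by ring
      have l2 : 1 ≤ L ^ 3 := Nat.one_le_pow _ _ hL
      have h3 : n * (m * (n * (τ₀ + 4) + 5 * m + 16) + 3 + 4) ≤ 85 * L ^ 4 := by
        calc n * (m * (n * (τ₀ + 4) + 5 * m + 16) + 3 + 4) ≤ L * (85 * L ^ 3) :=
              Nat.mul_le_mul hnL (by omega)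
          _ = _ := by ring
      have l3 : L ≤ L ^ 4 := Nat.le_self_pow (by decide) L
      have h4 : m * (n * (m * (n * (τ₀ + 4) + 5 * m + 16) + 3 + 4) + 5 * m + 16) ≤
          106 * L ^ 5 := by
        calc m * (n * (m * (n * (τ₀ + 4) + 5 * m + 16) + 3 + 4) + 5 * m + 16) ≤
              L * (106 * L ^ 4) := Nat.mul_le_mul hmL (by omega)
          _ = _ := by ring
      have h5 : m * (n * (4 + 4) + 5 * m + 16) ≤ 29 * L ^ 2 := by
        calc m * (n * (4 + 4) + 5 * m + 16) ≤ L * (29 * L) := Nat.mul_le_mul hmL (by omega)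
          _ = _ := by ring
      have l4 : L ^ 2 ≤ L ^ 5 := Nat.pow_le_pow_right hL (by decide)
      have l5 : 1 ≤ L ^ 5 := Nat.one_le_pow _ _ hL
      omega
    · rw [h, h₂, hd₂]
      change s₁.word 1 (s₁.reg 20) ++ _ ++ _ = _
      rw [h₁]
      have h6 : vs.flatMap (fun _ => [true]) = List.replicate vs.length true := by
        rw [← List.map_eq_flatMap, List.map_const']
      simp [unaryThen, h6]

/-! ### Inclusion–exclusion over the host tournaments -/

/-- The table whose entries are the binary digits of `w`. -/
def bitT (m w a b : ℕ) : Bool := w.testBit (a * m + b)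

/-- The pairs of classes over which the signs alternate: the diagonal pairs and the pairs `a < b`
of classes below `k`. -/
def SignPair (k a b : ℕ) : Prop := a = b ∨ (a < b ∧ b < k)

instance (k a b : ℕ) : Decidable (SignPair k a b) := by unfold SignPair; infer_instance

/-- The number of sign pairs at which the table given by `w` is true. -/
def signCount (k m w : ℕ) : ℕ :=
  ∑ a ∈ Finset.range m, ∑ b ∈ Finset.range m,
    if SignPair k a b ∧ bitT m w a b = true then 1 else 0

/-- The sign of the table given by `w`. -/
def sgn (k m w : ℕ) : ℤ := (-1) ^ signCount k m w

/-- The adjacency relation of the host tournament on pairs of bounded numbers. -/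
def hostR (k : ℕ) {m n : ℕ} (Q W E : ℕ → ℕ → Bool) (x y : Fin m × Fin n) : Prop :=
  hostRel k Q W E (x.1, x.2) (y.1, y.2) = true

open Classical in
/-- The sum over `w` of the signed numbers of copies of `T` in the host tournaments. -/
noncomputable def hostSum {m : ℕ} (T : Digraph (Fin m)) (k n : ℕ) (Q E : ℕ → ℕ → Bool) : ℤ :=
  ∑ w ∈ Finset.range (2 ^ (m * m)), sgn k m w *
    (Finset.univ.filter fun X : Finset (Fin m × Fin n) => (∀ x ∈ X, bitT m w x.1 x.1 = true) ∧
      Nonempty (T.Adj ≃r Subrel (hostR k Q (bitT m w) E) (· ∈ X))).card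

/-- The relation on the classes induced by the tables, when all pairs of elements are in `E`. -/
def tourR (k : ℕ) {m : ℕ} (Q W : ℕ → ℕ → Bool) (a b : Fin m) : Prop :=
  hostRel k Q W (fun _ _ => true) (a, 0) (b, 0) = true

open Classical in
/-- The signed number of tables `w` for which the tournament on the classes is a copy of `T`. -/
noncomputable def hostCoeff {m : ℕ} (T : Digraph (Fin m)) (k : ℕ) (Q : ℕ → ℕ → Bool) : ℤ :=
  ∑ w ∈ Finset.range (2 ^ (m * m)), sgn k m w *
    if (∀ a : Fin m, bitT m w a a = true) ∧ Nonempty (T.Adj ≃r tourR (m := m) k Q (bitT m w))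
      then 1 else 0

theorem pos_injective {m a b a' b' : ℕ} (hb : b < m) (hb' : b' < m)
    (h : a * m + b = a' * m + b') : a = a' ∧ b = b' := by
  have h1 : a = a' := by
    have := congrArg (· / m) h
    simpa [Nat.mul_comm _ m, Nat.mul_add_div (by omega : 0 < m), Nat.div_eq_of_lt hb,
      Nat.div_eq_of_lt hb'] using this
  subst h1
  exact ⟨rfl, by omega⟩

theorem pos_lt {m a b : ℕ} (ha : a < m) (hb : b < m) : a * m + b < m * m := by
  calc a * m + b < a * m + m := by omega
    _ = (a + 1) * m := by ring
    _ ≤ m * m := Nat.mul_le_mul_right _ ha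

theorem bitT_flip {m w a b a' b' : ℕ} (hb : b < m) (hb' : b' < m) :
    bitT m (w ^^^ 2 ^ (a * m + b)) a' b' =
      if a' = a ∧ b' = b then !bitT m w a' b' else bitT m w a' b' := by
  unfold bitT
  rw [Nat.testBit_xor, Nat.testBit_two_pow]
  split_ifs with h
  · simp [h.1, h.2]
  · have : ¬ a * m + b = a' * m + b' := fun h' => h (by
      have := pos_injective hb hb' h'; omega)
    simp [this]

/-- Changing the entry at a sign pair changes the sign. -/
theorem sgn_flip {k m w a b : ℕ} (ha : a < m) (hb : b < m) (h : SignPair k a b) :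
    sgn k m (w ^^^ 2 ^ (a * m + b)) = -sgn k m w := by
  have key : ∀ w, sgn k m w = ∏ a ∈ Finset.range m, ∏ b ∈ Finset.range m,
      (if SignPair k a b ∧ bitT m w a b = true then (-1 : ℤ) else 1) := by
    intro w
    rw [sgn, signCount, ← Finset.prod_pow_eq_pow_sum]
    refine Finset.prod_congr rfl fun a _ => ?_
    rw [← Finset.prod_pow_eq_pow_sum]
    refine Finset.prod_congr rfl fun b _ => ?_
    split_ifs <;> simp
  rw [key, key, ← Finset.prod_product', ← Finset.prod_product',
    ← Finset.mul_prod_erase _ _ (a := (a, b)) (by simp [ha, hb]),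
    ← Finset.mul_prod_erase (Finset.range m ×ˢ Finset.range m) _ (a := (a, b)) (by simp [ha, hb]),
    ← neg_mul]
  congr 1
  · rw [bitT_flip hb hb]
    simp only [h, true_and, and_self, if_true]
    cases bitT m w a b <;> simp
  · refine Finset.prod_congr rfl fun p hp => ?_
    simp only [Finset.mem_erase, Finset.mem_product, Finset.mem_range, ne_eq, Prod.ext_iff] at hp
    rw [bitT_flip hb hp.2.2, if_neg hp.1]

/-- The signed sum of a function that does not depend on one of the sign pairs vanishes. -/
theorem sum_sgn_eq_zero {k m a b : ℕ} (ha : a < m) (hb : b < m) (h : SignPair k a b)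
    (f : ℕ → ℤ) (hf : ∀ w, f (w ^^^ 2 ^ (a * m + b)) = f w) :
    ∑ w ∈ Finset.range (2 ^ (m * m)), sgn k m w * f w = 0 := by
  set i := a * m + b with hi
  have hmem : ∀ w ∈ Finset.range (2 ^ (m * m)), w ^^^ 2 ^ i ∈ Finset.range (2 ^ (m * m)) := by
    intro w hw
    rw [Finset.mem_range] at hw ⊢
    exact Nat.xor_lt_two_pow hw (Nat.pow_lt_pow_right (by decide) (pos_lt ha hb))
  have hinv : ∀ w, w ^^^ 2 ^ i ^^^ 2 ^ i = w := fun w => by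
    rw [Nat.xor_assoc, Nat.xor_self, Nat.xor_zero]
  have : ∑ w ∈ Finset.range (2 ^ (m * m)), sgn k m w * f w =
      ∑ w ∈ Finset.range (2 ^ (m * m)), -(sgn k m w * f w) := by
    refine Finset.sum_nbij' (· ^^^ 2 ^ i) (· ^^^ 2 ^ i) hmem hmem (fun w _ => hinv w)
      (fun w _ => hinv w) fun w _ => ?_
    rw [hf, sgn_flip ha hb h]
    ring
  rw [Finset.sum_neg_distrib] at this
  omega

theorem hostRel_congr {k : ℕ} {Q Q' W W' E E' : ℕ → ℕ → Bool} {m n : ℕ} {x y : ℕ × ℕ}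
    (hx : x.1 < m) (hy : y.1 < m) (hx' : x.2 < n) (hy' : y.2 < n)
    (hQ : ∀ a b, a < b → b < m → Q a b = Q' a b)
    (hW : ∀ a b, a < b → b < m → W a b = W' a b)
    (hE : ∀ u v, u < n → v < n → E u v = E' u v) :
    hostRel k Q W E x y = hostRel k Q' W' E' x y := by
  unfold hostRel orient
  split_ifs with h1 h2 h3 h4
  · rw [hW _ _ h1 hy, hE _ _ hx' hy']
  · rw [hQ _ _ h1 hy]
  · rw [hW _ _ h3 hx, hE _ _ hy' hx']
  · rw [hQ _ _ h3 hx]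
  · rfl

theorem hostR_congr_W {k m n : ℕ} {Q W W' E : ℕ → ℕ → Bool}
    (hW : ∀ a b, a < b → b < m → W a b = W' a b) :
    (hostR k Q W E : Fin m × Fin n → _ → Prop) = hostR k Q W' E := by
  funext x y
  unfold hostR
  rw [hostRel_congr x.1.2 y.1.2 x.2.2 y.2.2 (fun _ _ _ _ => rfl) hW fun _ _ _ _ => rfl]

/-- Isomorphism to the subgraph induced by a transversal of the classes. -/
theorem nonempty_relIso_graph {m n k : ℕ} {T : Digraph (Fin m)} {Q W E : ℕ → ℕ → Bool}
    (v : Fin m → Fin n) :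
    Nonempty (T.Adj ≃r Subrel (hostR k Q W E)
      (· ∈ (Finset.univ.image fun a : Fin m => (a, v a)))) ↔
    Nonempty (T.Adj ≃r fun a b : Fin m => hostR k Q W E (a, v a) (b, v b)) := by
  let e : Fin m ≃ {x : Fin m × Fin n // x ∈ Finset.univ.image fun a : Fin m => (a, v a)} :=
    { toFun := fun a => ⟨(a, v a), Finset.mem_image_of_mem _ (Finset.mem_univ a)⟩
      invFun := fun x => x.1.1
      left_inv := fun a => rfl
      right_inv := by
        rintro ⟨x, hx⟩
        obtain ⟨a, -, rfl⟩ := Finset.mem_image.1 hx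
        rfl }
  let f : (fun a b : Fin m => hostR k Q W E (a, v a) (b, v b)) ≃r Subrel (hostR k Q W E)
      (· ∈ (Finset.univ.image fun a : Fin m => (a, v a))) := ⟨e, Iff.rfl⟩
  exact ⟨fun ⟨g⟩ => ⟨g.trans f.symm⟩, fun ⟨g⟩ => ⟨g.trans f⟩⟩

open Classical in
/-- Only the transversals of the classes survive the alternating sum, and among them only those
whose first `k` elements are pairwise in the relation `E`; each of these contributes the same
coefficient. -/
theorem hostSum_eq {m : ℕ} (T : Digraph (Fin m)) {k n : ℕ} (Q E : ℕ → ℕ → Bool) :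
    hostSum T k n Q E = hostCoeff T k Q *
      (Finset.univ.filter fun v : Fin m → Fin n =>
        ∀ a b : Fin m, a < b → (b : ℕ) < k → E (v a) (v b) = true).card := by
  have h1 : hostSum T k n Q E = ∑ X : Finset (Fin m × Fin n),
      ∑ w ∈ Finset.range (2 ^ (m * m)), sgn k m w *
        if (∀ x ∈ X, bitT m w x.1 x.1 = true) ∧
          Nonempty (T.Adj ≃r Subrel (hostR k Q (bitT m w) E) (· ∈ X)) then 1 else 0 := by
    rw [Finset.sum_comm]
    unfold hostSum
    refine Finset.sum_congr rfl fun w _ => ?_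
    rw [← Finset.mul_sum, Finset.sum_boole]
  -- A set that avoids the class `a` does not depend on the entry `(a, a)`; a set of size `m` that
  -- meets all classes is a transversal.
  have h2 : ∀ X : Finset (Fin m × Fin n),
      X ∉ (fun v : Fin m → Fin n => Finset.univ.image fun a => (a, v a)) ''
        (Finset.univ : Finset (Fin m → Fin n)) →
      (∑ w ∈ Finset.range (2 ^ (m * m)), sgn k m w *
        if (∀ x ∈ X, bitT m w x.1 x.1 = true) ∧
          Nonempty (T.Adj ≃r Subrel (hostR k Q (bitT m w) E) (· ∈ X)) then 1 else 0) = 0 := by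
    intro X hX
    by_cases hall : ∀ a : Fin m, ∃ x ∈ X, x.1 = a
    · refine Finset.sum_eq_zero fun w _ => ?_
      rw [if_neg, mul_zero]
      rintro ⟨-, ⟨g⟩⟩
      apply hX
      choose x hx hx1 using hall
      refine ⟨fun a => (x a).2, by simp, ?_⟩
      refine Finset.eq_of_subset_of_card_le ?_ ?_
      · intro y hy
        obtain ⟨a, -, rfl⟩ := Finset.mem_image.1 hy
        have : (a, (x a).2) = x a := Prod.ext (hx1 a).symm rfl
        rw [this]
        exact hx a
      · have hc := Fintype.card_congr g.toEquiv
        rw [Finset.card_image_of_injective _ fun a b h => (Prod.ext_iff.1 h).1]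
        simp only [Fintype.card_fin] at hc
        simp only [Finset.card_univ, Fintype.card_fin]
        rw [Fintype.card_coe] at hc
        exact hc.ge
    · push Not at hall
      obtain ⟨a, ha⟩ := hall
      refine sum_sgn_eq_zero a.2 a.2 (Or.inl rfl) _ fun w => ?_
      congr 1
      have e1 : (∀ x ∈ X, bitT m (w ^^^ 2 ^ (a * m + a : ℕ)) x.1 x.1 = true) ↔
          ∀ x ∈ X, bitT m w x.1 x.1 = true := by
        refine forall₂_congr fun x hx => ?_
        rw [bitT_flip a.2 x.1.2, if_neg]
        exact fun h => ha x hx (Fin.ext h.1)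
      have e2 : (hostR k Q (bitT m (w ^^^ 2 ^ (a * m + a : ℕ))) E :
          Fin m × Fin n → _ → Prop) = hostR k Q (bitT m w) E := by
        refine hostR_congr_W fun b c hbc hc => ?_
        rw [bitT_flip a.2 hc, if_neg]
        omega
      rw [e1, e2]
  rw [h1, ← Finset.sum_of_injOn (s := Finset.univ)
    (fun v : Fin m → Fin n => Finset.univ.image fun a => (a, v a)) ?_ ?_ (fun X _ hX => h2 X hX)
    (fun v _ => rfl)]
  · rw [Finset.card_filter, Nat.cast_sum, Finset.mul_sum]
    refine Finset.sum_congr rfl fun v _ => ?_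
    simp only [nonempty_relIso_graph]
    by_cases hv : ∀ a b : Fin m, a < b → (b : ℕ) < k → E (v a) (v b) = true
    · rw [if_pos hv]
      simp only [Nat.cast_one, mul_one]
      unfold hostCoeff
      refine Finset.sum_congr rfl fun w _ => ?_
      congr 1
      have e1 : (∀ x ∈ Finset.univ.image (fun a : Fin m => (a, v a)),
          bitT m w x.1 x.1 = true) ↔ ∀ a : Fin m, bitT m w a a = true := by
        simp
      have e2 : (fun a b : Fin m => hostR k Q (bitT m w) E (a, v a) (b, v b)) =
          tourR k Q (bitT m w) := by
        funext a b
        unfold hostR tourR hostRel orient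
        by_cases hab : a < b
        · by_cases hb : (b : ℕ) < k
          · simp [hab, hb, hv a b hab hb]
          · simp [hab, hb]
        · by_cases hba : b < a
          · by_cases hb : (a : ℕ) < k
            · simp [hab, hba, hb, hv b a hba hb]
            · simp [hab, hba, hb]
          · have : a = b := by omega
            subst this
            simp
      simp only [e1, e2]
    · rw [if_neg hv]
      simp only [Nat.cast_zero, mul_zero]
      push Not at hv
      obtain ⟨a, b, hab, hb, hE⟩ := hv
      -- As `E` fails at this pair, the entry `(a, b)` has no effect on the induced tournament.
      refine sum_sgn_eq_zero a.2 b.2 (Or.inr ⟨hab, hb⟩) _ fun w => ?_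
      congr 1
      have e1 : (∀ x ∈ Finset.univ.image (fun a : Fin m => (a, v a)),
          bitT m (w ^^^ 2 ^ (a * m + b : ℕ)) x.1 x.1 = true) ↔
          ∀ x ∈ Finset.univ.image (fun a : Fin m => (a, v a)), bitT m w x.1 x.1 = true := by
        refine forall₂_congr fun x hx => ?_
        rw [bitT_flip b.2 x.1.2, if_neg]
        rintro ⟨h, h'⟩
        have : (a : ℕ) < b := hab
        omega
      have e2 : (fun c d : Fin m =>
          hostR k Q (bitT m (w ^^^ 2 ^ (a * m + b : ℕ))) E (c, v c) (d, v d)) =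
          fun c d : Fin m => hostR k Q (bitT m w) E (c, v c) (d, v d) := by
        have horient : ∀ c d : Fin m, orient k Q (bitT m (w ^^^ 2 ^ (a * m + b : ℕ))) E
            c (v c) d (v d) = orient k Q (bitT m w) E c (v c) d (v d) := by
          intro c d
          unfold orient
          rw [bitT_flip b.2 d.2]
          split_ifs with h1 h2
          · obtain ⟨h3, h4⟩ := h2
            rw [Fin.ext h3, Fin.ext h4]
            simp only [Bool.not_eq_true] at hE
            simp [hE]
          · rfl
          · rfl
        funext c d
        simp only [hostR, hostRel, horient]
      simp only [e1, e2]
  · intro v _ v' _ h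
    funext a
    have h' : (Finset.univ.image fun a => (a, v a)) = Finset.univ.image fun a => (a, v' a) := h
    have : (a, v a) ∈ Finset.univ.image fun a => (a, v' a) := by
      rw [← h']
      exact Finset.mem_image_of_mem _ (Finset.mem_univ a)
    obtain ⟨b, -, hb⟩ := Finset.mem_image.1 this
    rw [Prod.ext_iff] at hb
    obtain ⟨rfl, h2⟩ := hb
    exact h2.symm
  · intro v _
    simp

/-! ### A table with nonvanishing coefficient -/

/-- If every element of a nonempty set of functions can be changed within each of `r` disjoint
sets of coordinates without leaving the set, then the set has at least `2 ^ r` elements. -/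
theorem two_pow_length_le_ncard {ι β : Type*} (bs : List (Set ι)) (hbs : bs.Pairwise Disjoint)
    (𝒢 : Set (ι → β)) (hfin : 𝒢.Finite) (hne : 𝒢.Nonempty)
    (hex : ∀ x ∈ 𝒢, ∀ B ∈ bs, ∃ y ∈ 𝒢, y ≠ x ∧ ∀ i ∉ B, y i = x i) :
    2 ^ bs.length ≤ 𝒢.ncard := by
  induction bs generalizing 𝒢 with
  | nil => simpa [Nat.one_le_iff_ne_zero, Set.ncard_eq_zero hfin, ← Set.nonempty_iff_ne_empty]
  | cons B bs ih =>
    rw [List.pairwise_cons] at hbs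
    obtain ⟨x, hx⟩ := hne
    obtain ⟨y, hy, hyx, hy'⟩ := hex x hx B (by simp)
    -- The elements with a prescribed restriction to the first set of coordinates.
    have main : ∀ z ∈ 𝒢, 2 ^ bs.length ≤ {z' ∈ 𝒢 | ∀ i ∈ B, z' i = z i}.ncard := by
      intro z hz
      refine ih hbs.2 _ (hfin.subset fun _ h => h.1) ⟨z, hz, fun _ _ => rfl⟩ ?_
      rintro z' ⟨hz', hzz'⟩ B' hB'
      obtain ⟨y', hy', hne, hag⟩ := hex z' hz' B' (by simp [hB'])
      refine ⟨y', ⟨hy', fun i hi => ?_⟩, hne, hag⟩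
      rw [hag i fun hi' => Set.disjoint_left.1 (hbs.1 B' hB') hi hi', hzz' i hi]
    have hdisj : Disjoint {z' ∈ 𝒢 | ∀ i ∈ B, z' i = x i} {z' ∈ 𝒢 | ∀ i ∈ B, z' i = y i} := by
      rw [Set.disjoint_left]
      rintro z ⟨-, h1⟩ ⟨-, h2⟩
      apply hyx
      funext i
      by_cases hi : i ∈ B
      · rw [← h1 i hi, h2 i hi]
      · exact hy' i hi
    have hle := Set.ncard_le_ncard (s := {z' ∈ 𝒢 | ∀ i ∈ B, z' i = x i} ∪
      {z' ∈ 𝒢 | ∀ i ∈ B, z' i = y i}) (t := 𝒢)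
      (Set.union_subset (fun _ h => h.1) fun _ h => h.1) hfin
    rw [Set.ncard_union_eq hdisj (hfin.subset fun _ h => h.1) (hfin.subset fun _ h => h.1)] at hle
    have h1 := main x hx
    have h2 := main y hy
    rw [List.length_cons, pow_succ]
    omega

/-- Every table is given by the binary digits of a number. -/
theorem exists_bitT_eq (m : ℕ) (R : ℕ → ℕ → Bool) :
    ∃ w < 2 ^ (m * m), ∀ a b, a < m → b < m → bitT m w a b = R a b := by
  refine ⟨Nat.ofBits fun i : Fin (m * m) => R (i / m) (i % m), Nat.ofBits_lt_two_pow _, ?_⟩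
  intro a b ha hb
  have hm : 0 < m := by omega
  rw [bitT, Nat.testBit_ofBits_lt _ _ (pos_lt ha hb)]
  simp only
  rw [Nat.mul_comm a m, Nat.mul_add_div hm, Nat.div_eq_of_lt hb, Nat.mul_add_mod,
    Nat.mod_eq_of_lt hb, add_zero]

theorem isTournament_of_relIso {V W : Type*} {T : Digraph V} (hT : IsTournament T)
    {r : W → W → Prop} (e : T.Adj ≃r r) : (∀ u, ¬ r u u) ∧ ∀ u v, u ≠ v → Xor (r u v) (r v u) := by
  have h : ∀ u v, r u v ↔ T.Adj (e.symm u) (e.symm v) := fun u v => (e.symm.map_rel_iff).symm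
  refine ⟨fun u => ?_, fun u v huv => ?_⟩
  · rw [h]; exact hT.1 _
  · rw [h, h]; exact hT.2 _ _ fun h' => huv (e.symm.injective h')

/-- If all coefficients vanish, then every labelled copy of `T` can be changed to another one by
changing the orientations of pairs of labels below `k` only: the terms of an alternating sum that
is zero cannot all have the same sign. -/
theorem exists_copy_of_hostCoeff_eq_zero {m k : ℕ} {T : Digraph (Fin m)} (hT : IsTournament T)
    (h0 : ∀ c < 2 ^ (m * m), hostCoeff T k (bitT m c) = 0) (x : Fin m → Fin m → Prop)
    (hx : Nonempty (T.Adj ≃r x)) :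
    ∃ y : Fin m → Fin m → Prop, Nonempty (T.Adj ≃r y) ∧ y ≠ x ∧
      ∀ a b : Fin m, ¬ ((a : ℕ) < k ∧ (b : ℕ) < k) → y a b = x a b := by
  classical
  by_contra! hcon
  obtain ⟨hirr, hxor⟩ := isTournament_of_relIso hT hx.some
  -- The relation `x` as a table.  The tables `Q` and `W` are obtained from it, with all classes
  -- present in `W`.
  let X : ℕ → ℕ → Bool := fun a b =>
    if h : a < m ∧ b < m then decide (x ⟨a, h.1⟩ ⟨b, h.2⟩) else false
  have hX : ∀ a b : Fin m, X a b = decide (x a b) := fun a b => by simp [X]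
  obtain ⟨c, hc, hcX⟩ := exists_bitT_eq m X
  obtain ⟨w₀, hw₀, hwX⟩ := exists_bitT_eq m fun a b => decide (a = b) || X a b
  have hrev : ∀ a b : Fin m, b < a → (x a b ↔ ¬ x b a) := by
    intro a b hab
    have := hxor a b hab.ne'
    rw [xor_iff_iff_not] at this
    exact this
  -- Any tournament from the sum agrees with `x` on the pairs that are not both below `k`.
  have hag : ∀ w, ∀ a b : Fin m, ¬ ((a : ℕ) < k ∧ (b : ℕ) < k) →
      tourR k (bitT m c) (bitT m w) a b = x a b := by
    intro w a b hab
    unfold tourR hostRel orient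
    simp only [hcX _ _ a.2 b.2, hcX _ _ b.2 a.2, hX]
    rcases lt_trichotomy (a : ℕ) b with h | h | h
    · have : ¬ (b : ℕ) < k := by omega
      simp [h, this]
    · have : a = b := Fin.ext h
      subst this
      simp [hirr]
    · have h1 : ¬ (a : ℕ) < k := by omega
      have h2 : ¬ (a : ℕ) < b := by omega
      simp only [h1, h2, h, if_true, if_false, Bool.not_eq_true', decide_eq_false_iff_not]
      exact propext (hrev a b h).symm
  have hw₀x : (tourR k (bitT m c) (bitT m w₀) : Fin m → Fin m → Prop) = x := by
    funext a b
    by_cases hab : (a : ℕ) < k ∧ (b : ℕ) < k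
    · unfold tourR hostRel orient
      simp only [hwX _ _ a.2 b.2, hwX _ _ b.2 a.2, hX, hab.1, hab.2, if_true, Bool.and_true]
      rcases lt_trichotomy (a : ℕ) b with h | h | h
      · simp [h, h.ne]
      · have : a = b := Fin.ext h
        subst this
        simp [hirr]
      · have h2 : ¬ (a : ℕ) < b := by omega
        simp only [h2, h, if_true, if_false, h.ne, decide_false, Bool.false_or,
          Bool.not_eq_true', decide_eq_false_iff_not]
        exact propext (hrev a b h).symm
    · exact hag w₀ a b hab
  have hsgn : ∀ w, (∀ a : Fin m, bitT m w a a = true) →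
      Nonempty (T.Adj ≃r tourR (m := m) k (bitT m c) (bitT m w)) →
      sgn k m w = sgn k m w₀ := by
    intro w hd hiso
    have hwx : (tourR k (bitT m c) (bitT m w) : Fin m → Fin m → Prop) = x := by
      by_contra hne
      obtain ⟨a, b, hab, hne'⟩ := hcon _ hiso hne
      exact hne' (hag w a b fun h => absurd h.2 (not_lt.2 (hab h.1)))
    unfold sgn signCount
    congr 1
    refine Finset.sum_congr rfl fun a ha => Finset.sum_congr rfl fun b hb => ?_
    rw [Finset.mem_range] at ha hb
    refine if_congr (and_congr_right fun hs => ?_) rfl rfl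
    rcases hs with rfl | ⟨hab, hbk⟩
    · simp [hd ⟨a, ha⟩, hwX a a ha ha]
    · have h1 := congrFun (congrFun hwx ⟨a, ha⟩) ⟨b, hb⟩
      have h2 := congrFun (congrFun hw₀x ⟨a, ha⟩) ⟨b, hb⟩
      rw [← h2] at h1
      simpa [tourR, hostRel, orient, hab, hbk] using h1
  have hsum : hostCoeff T k (bitT m c) = sgn k m w₀ * ∑ w ∈ Finset.range (2 ^ (m * m)),
      if (∀ a : Fin m, bitT m w a a = true) ∧
        Nonempty (T.Adj ≃r tourR (m := m) k (bitT m c) (bitT m w)) then 1 else 0 := by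
    rw [hostCoeff, Finset.mul_sum]
    refine Finset.sum_congr rfl fun w _ => ?_
    split_ifs with h
    · rw [hsgn w h.1 h.2]
    · simp
  rw [h0 c hc] at hsum
  have hs0 : sgn k m w₀ ≠ 0 := pow_ne_zero _ (by decide)
  have hpos := (mul_eq_zero.1 hsum.symm).resolve_left hs0
  rw [Finset.sum_boole, Nat.cast_eq_zero, Finset.card_eq_zero, Finset.filter_eq_empty_iff] at hpos
  apply hpos (Finset.mem_range.2 hw₀)
  refine ⟨fun a => by simp [hwX _ _ a.2 a.2], ?_⟩
  rw [hw₀x]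
  exact hx

/-- The same for an arbitrary set of `k` labels, by relabelling. -/
theorem exists_copy_of_hostCoeff_eq_zero' {m k : ℕ} {T : Digraph (Fin m)} (hT : IsTournament T)
    (h0 : ∀ c < 2 ^ (m * m), hostCoeff T k (bitT m c) = 0) (x : Fin m → Fin m → Prop)
    (hx : Nonempty (T.Adj ≃r x)) (S : Finset (Fin m)) (hS : S.card = k) :
    ∃ y : Fin m → Fin m → Prop, Nonempty (T.Adj ≃r y) ∧ y ≠ x ∧
      ∀ a b : Fin m, ¬ (a ∈ S ∧ b ∈ S) → y a b = x a b := by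
  classical
  have hkm : k ≤ m := by
    rw [← hS]; simpa using Finset.card_le_univ S
  have hcard : Fintype.card {a : Fin m // (a : ℕ) < k} = Fintype.card {a : Fin m // a ∈ S} := by
    rw [Fintype.card_coe, hS, Fintype.card_subtype, Fin.card_filter_val_lt]
    exact min_eq_right hkm
  let e := Fintype.equivOfCardEq hcard
  let σ : Equiv.Perm (Fin m) := e.extendSubtype
  have hσ : ∀ a : Fin m, (a : ℕ) < k ↔ σ a ∈ S := by
    intro a
    refine ⟨fun h => e.extendSubtype_mem a h, fun h => ?_⟩
    by_contra h'
    exact e.extendSubtype_not_mem a h' h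
  obtain ⟨y, ⟨f⟩, hyx, hag⟩ := exists_copy_of_hostCoeff_eq_zero hT h0
    (fun a b => x (σ a) (σ b)) (hx.map fun f => f.trans ⟨σ.symm, by simp⟩)
  refine ⟨fun a b => y (σ.symm a) (σ.symm b), ⟨f.trans ⟨σ, by simp⟩⟩, ?_, ?_⟩
  · intro h
    apply hyx
    funext a b
    rw [← h]
    simp
  · intro a b hab
    have := hag (σ.symm a) (σ.symm b) (by rw [hσ, hσ]; simpa using hab)
    simpa using this

/-- The blocks of a partial linear space: for `a, b < p`, the points with coordinates `i` and
`a + i * b`, where `i < k`. -/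
def block (m k p a b : ℕ) : Finset (Fin m) :=
  Finset.univ.filter fun u => ∃ i < k, (u : ℕ) = i * (k * p) + (a + i * b)

theorem block_coord_lt {k p a b i : ℕ} (ha : a < p) (hb : b < p) (hi : i < k) :
    a + i * b < k * p := by
  calc a + i * b < p + i * b := by omega
    _ ≤ p + i * p := by gcongr
    _ = (i + 1) * p := by ring
    _ ≤ k * p := Nat.mul_le_mul_right _ hi

theorem card_block {m k p a b : ℕ} (hm : k * (k * p) ≤ m) (ha : a < p) (hb : b < p) :
    (block m k p a b).card = k := by
  have hlt : ∀ i < k, i * (k * p) + (a + i * b) < m := by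
    intro i hi
    have := block_coord_lt ha hb hi
    calc i * (k * p) + (a + i * b) < i * (k * p) + k * p := by omega
      _ = (i + 1) * (k * p) := by ring
      _ ≤ k * (k * p) := Nat.mul_le_mul_right _ hi
      _ ≤ m := hm
  have : block m k p a b = Finset.univ.image fun i : Fin k =>
      (⟨i * (k * p) + (a + i * b), hlt i i.2⟩ : Fin m) := by
    ext u
    simp only [block, Finset.mem_filter, Finset.mem_univ, true_and, Finset.mem_image, Fin.ext_iff]
    exact ⟨fun ⟨i, hi, h⟩ => ⟨⟨i, hi⟩, h.symm⟩, fun ⟨i, h⟩ => ⟨i, i.2, h.symm⟩⟩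
  rw [this, Finset.card_image_of_injective, Finset.card_univ, Fintype.card_fin]
  intro i j hij
  simp only [Fin.mk.injEq] at hij
  exact Fin.ext (pos_injective (block_coord_lt ha hb i.2) (block_coord_lt ha hb j.2) hij).1

/-- Two distinct points lie in at most one block. -/
theorem block_inj {m k p a b a' b' : ℕ} (ha : a < p) (hb : b < p) (ha' : a' < p) (hb' : b' < p)
    {u v : Fin m} (huv : u ≠ v) (hu : u ∈ block m k p a b) (hv : v ∈ block m k p a b)
    (hu' : u ∈ block m k p a' b') (hv' : v ∈ block m k p a' b') : a = a' ∧ b = b' := by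
  simp only [block, Finset.mem_filter, Finset.mem_univ, true_and] at hu hv hu' hv'
  obtain ⟨i, hi, hui⟩ := hu
  obtain ⟨j, hj, hvj⟩ := hv
  obtain ⟨i', hi', hui'⟩ := hu'
  obtain ⟨j', hj', hvj'⟩ := hv'
  obtain ⟨rfl, h1⟩ := pos_injective (block_coord_lt ha hb hi) (block_coord_lt ha' hb' hi')
    (hui.symm.trans hui')
  obtain ⟨rfl, h2⟩ := pos_injective (block_coord_lt ha hb hj) (block_coord_lt ha' hb' hj')
    (hvj.symm.trans hvj')
  have hij : i ≠ j := by
    rintro rfl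
    exact huv (Fin.ext (hui.trans hvj.symm))
  have hbb : b = b' := by
    zify at h1 h2 hij ⊢
    have : ((i : ℤ) - j) * (b - b') = 0 := by linear_combination h1 - h2
    rcases mul_eq_zero.1 this with h | h
    · exact absurd (sub_eq_zero.1 h) hij
    · exact sub_eq_zero.1 h
  subst hbb
  exact ⟨by omega, rfl⟩

/-- With `p = ⌊m / k²⌋`, the number `p²` of blocks exceeds `log₂ (m!)` as soon as `m` is
exponential in `k`, since `p²` is quadratic in `m`. -/
theorem factorial_lt_two_pow {m k : ℕ} (hk : 1 ≤ k) (hm : 2 ^ (8 * k + 8) ≤ m) :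
    m.factorial < 2 ^ ((m / k ^ 2) ^ 2) := by
  have hm1 : 1 ≤ m := le_trans Nat.one_le_two_pow hm
  set j := Nat.log 2 m with hj
  have hjk : 8 * k + 8 ≤ j := (Nat.le_log_iff_pow_le (by decide) (by omega)).2 hm
  have hjm : 2 ^ j ≤ m := Nat.pow_log_le_self 2 (by omega)
  have hmj : m < 2 ^ (j + 1) := Nat.lt_pow_succ_log_self (by decide) m
  set p := m / k ^ 2 with hp
  have hkk : k < 2 ^ k := Nat.lt_two_pow_self
  have key : ∀ i, 8 * k + 8 ≤ i → (i + 1) * 2 ^ (4 * k + 1) ≤ 2 ^ i := by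
    intro i hi
    induction i, hi using Nat.le_induction with
    | base =>
      have h1 : 8 * k + 9 ≤ 2 ^ (4 * k + 7) := by
        have : 2 ^ k ≤ 2 ^ (4 * k) := Nat.pow_le_pow_right (by decide) (by omega)
        rw [pow_add]
        omega
      calc (8 * k + 8 + 1) * 2 ^ (4 * k + 1) ≤ 2 ^ (4 * k + 7) * 2 ^ (4 * k + 1) :=
            Nat.mul_le_mul_right _ h1
        _ = 2 ^ (8 * k + 8) := by rw [← pow_add]; congr 1; omega
    | succ i _ ih =>
      calc (i + 1 + 1) * 2 ^ (4 * k + 1) ≤ (2 * (i + 1)) * 2 ^ (4 * k + 1) :=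
            Nat.mul_le_mul_right _ (by omega)
        _ = 2 * ((i + 1) * 2 ^ (4 * k + 1)) := by ring
        _ ≤ 2 * 2 ^ i := Nat.mul_le_mul_left _ ih
        _ = 2 ^ (i + 1) := by ring
  have hk4 : k ^ 4 ≤ 2 ^ (4 * k) := by
    calc k ^ 4 ≤ (2 ^ k) ^ 4 := Nat.pow_le_pow_left hkk.le 4
      _ = 2 ^ (4 * k) := by rw [← pow_mul]; congr 1; ring
  have hpp : (j + 1) * (2 * k ^ 2) ≤ p := by
    rw [hp, Nat.le_div_iff_mul_le (by positivity)]
    calc (j + 1) * (2 * k ^ 2) * k ^ 2 = (j + 1) * (2 * k ^ 4) := by ring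
      _ ≤ (j + 1) * (2 * 2 ^ (4 * k)) := by gcongr
      _ = (j + 1) * 2 ^ (4 * k + 1) := by ring
      _ ≤ 2 ^ j := key j hjk
      _ ≤ m := hjm
  have hp1 : 1 ≤ p := by
    have : 0 < (j + 1) * (2 * k ^ 2) := by positivity
    omega
  have hmp : m ≤ 2 * k ^ 2 * p := by
    have h1 : m < k ^ 2 * (p + 1) := by
      have := Nat.lt_mul_div_succ m (b := k ^ 2) (by positivity)
      rwa [← hp] at this
    have h2 : k ^ 2 * (p + 1) ≤ k ^ 2 * (p + p) := Nat.mul_le_mul_left _ (by omega)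
    have h3 : k ^ 2 * (p + p) = 2 * k ^ 2 * p := by ring
    omega
  calc m.factorial ≤ m ^ m := Nat.factorial_le_pow m
    _ < (2 ^ (j + 1)) ^ m := Nat.pow_lt_pow_left hmj (by omega)
    _ = 2 ^ ((j + 1) * m) := by rw [← pow_mul]
    _ ≤ 2 ^ (p ^ 2) := by
      refine Nat.pow_le_pow_right (by decide) ?_
      calc (j + 1) * m ≤ (j + 1) * (2 * k ^ 2 * p) := Nat.mul_le_mul_left _ hmp
        _ = (j + 1) * (2 * k ^ 2) * p := by ring
        _ ≤ p * p := Nat.mul_le_mul_right _ hpp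
        _ = p ^ 2 := by ring

/-- For a large tournament some coefficient does not vanish.  Otherwise the labelled copies of the
tournament could be changed independently within more than `log₂ (m!)` sets of `k` labels that
pairwise share at most one label, and there would be more than `m!` labelled copies. -/
theorem exists_hostCoeff_ne_zero {m k : ℕ} {T : Digraph (Fin m)} (hT : IsTournament T)
    (hk : 1 ≤ k) (hm : 2 ^ (8 * k + 8) ≤ m) :
    ∃ c < 2 ^ (m * m), hostCoeff T k (bitT m c) ≠ 0 := by
  classical
  by_contra! h0
  set p := m / k ^ 2 with hp
  have hkp : k * (k * p) ≤ m := by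
    calc k * (k * p) = k ^ 2 * p := by ring
      _ ≤ m := Nat.mul_div_le m (k ^ 2)
  let 𝒢 : Set (Fin m × Fin m → Prop) :=
    {x | Nonempty (T.Adj ≃r fun a b => x (a, b))}
  have h𝒢 : 𝒢 ⊆ Set.range fun (σ : Equiv.Perm (Fin m)) (q : Fin m × Fin m) =>
      T.Adj (σ q.1) (σ q.2) := by
    rintro x ⟨f⟩
    refine ⟨f.symm.toEquiv, ?_⟩
    funext q
    exact propext (f.symm.map_rel_iff)
  -- A copy of the tournament is determined by a permutation of the labels.
  have hle : 𝒢.ncard ≤ m.factorial := by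
    refine (Set.ncard_le_ncard h𝒢 (Set.toFinite _)).trans ?_
    rw [← Set.image_univ]
    refine (Set.ncard_image_le (Set.toFinite _)).trans ?_
    rw [Set.ncard_univ, Nat.card_eq_fintype_card, Fintype.card_perm, Fintype.card_fin]
  -- The pairs of distinct labels within a block; these sets are disjoint for distinct blocks.
  let B : ℕ × ℕ → Set (Fin m × Fin m) := fun q =>
    {z | z.1 ≠ z.2 ∧ z.1 ∈ block m k p q.1 q.2 ∧ z.2 ∈ block m k p q.1 q.2}
  have hge : 2 ^ (((List.range p ×ˢ List.range p).map B).length) ≤ 𝒢.ncard := by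
    refine two_pow_length_le_ncard _ ?_ 𝒢 (Set.toFinite _)
      ⟨fun q => T.Adj q.1 q.2, ⟨RelIso.refl _⟩⟩ ?_
    · rw [List.pairwise_map]
      have hnd : (List.range p ×ˢ List.range p).Nodup := List.nodup_range.product List.nodup_range
      refine hnd.pairwise_of_forall_ne fun q hq q' hq' hqq' => ?_
      obtain ⟨a, b⟩ := q
      obtain ⟨a', b'⟩ := q'
      simp only [List.mem_product, List.mem_range] at hq hq'
      rw [Set.disjoint_left]
      rintro z ⟨hz, h1, h2⟩ ⟨-, h1', h2'⟩
      exact hqq' (Prod.ext_iff.2 (block_inj hq.1 hq.2 hq'.1 hq'.2 hz h1 h2 h1' h2'))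
    · rintro x hx _ hB
      obtain ⟨⟨a, b⟩, hq, rfl⟩ := List.mem_map.1 hB
      simp only [List.mem_product, List.mem_range] at hq
      obtain ⟨y, hy, hyx, hag⟩ := exists_copy_of_hostCoeff_eq_zero' hT h0 (fun a b => x (a, b)) hx
        (block m k p a b) (card_block hkp hq.1 hq.2)
      refine ⟨fun q => y q.1 q.2, hy, ?_, ?_⟩
      · intro h
        exact hyx (by rw [← h])
      · rintro ⟨u, v⟩ huv
        by_cases hne : u = v
        · subst hne
          exact propext (iff_of_false ((isTournament_of_relIso hT hy.some).1 u)
            ((isTournament_of_relIso hT (Nonempty.some hx)).1 u))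
        · exact hag u v fun h => huv ⟨hne, h⟩
  have hlen : ((List.range p ×ˢ List.range p).map B).length = p ^ 2 := by
    rw [List.length_map, List.length_product, List.length_range, sq]
  rw [hlen] at hge
  have := factorial_lt_two_pow hk hm
  rw [← hp] at this
  omega

/-! ### Host tournaments as instances, and cliques -/

theorem mem_hostVerts {m n : ℕ} {d : ℕ → Bool} {x : ℕ × ℕ} :
    x ∈ hostVerts m n d ↔ x.1 < m ∧ x.2 < n ∧ d x.1 = true := by
  obtain ⟨a, u⟩ := x
  simp only [hostVerts, List.mem_flatMap, List.mem_range]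
  constructor
  · rintro ⟨a', ha', h⟩
    split_ifs at h with hd
    · simp only [List.mem_map, List.mem_range, Prod.mk.injEq] at h
      obtain ⟨u', hu', rfl, rfl⟩ := h
      exact ⟨ha', hu', hd⟩
    · simp at h
  · rintro ⟨ha, hu, hd⟩
    exact ⟨a, ha, by rw [if_pos hd]; exact List.mem_map.2 ⟨u, List.mem_range.2 hu, rfl⟩⟩

theorem nodup_hostVerts (m n : ℕ) (d : ℕ → Bool) : (hostVerts m n d).Nodup := by
  rw [hostVerts, List.nodup_flatMap]
  constructor
  · intro a _
    split_ifs
    · exact List.nodup_range.map fun u v h => by simpa using h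
    · exact List.nodup_nil
  · refine List.nodup_range.imp fun {a b} hab => ?_
    intro x hx hy
    beta_reduce at hx hy
    split_ifs at hx hy
    · simp only [List.mem_map] at hx hy
      obtain ⟨_, _, rfl⟩ := hx
      obtain ⟨_, _, h⟩ := hy
      exact hab (by simpa using (congrArg Prod.fst h).symm)
    all_goals simp at hx hy

/-- The host tournament on the vertices `0, 1, …`. -/
def hostDigraph (m n k : ℕ) (Q W E : ℕ → ℕ → Bool) : FinDigraph :=
  ⟨(hostVerts m n fun a => W a a).length,
    ⟨fun i j => hostRel k Q W E ((hostVerts m n fun a => W a a).get i)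
      ((hostVerts m n fun a => W a a).get j) = true⟩⟩

theorem map_finRange_product {α : Type*} (l : List α) (r : α → α → Bool) :
    ((List.finRange l.length ×ˢ List.finRange l.length).map fun p => r (l.get p.1) (l.get p.2)) =
      l.flatMap fun x => l.map fun y => r x y := by
  have h : (List.finRange l.length).map l.get = l := by
    simp
  conv_rhs => rw [← h]
  simp only [SProd.sprod, List.product, List.map_flatMap, List.flatMap_map, List.map_map]
  rfl

theorem encodeDigraph_hostDigraph (m n k : ℕ) (Q W E : ℕ → ℕ → Bool) :
    encodeDigraph (hostDigraph m n k Q W E) =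
      unaryThen (hostVerts m n fun a => W a a).length
        ((hostVerts m n fun a => W a a).flatMap fun x =>
          (hostVerts m n fun a => W a a).map fun y => hostRel k Q W E x y) := by
  rw [← map_finRange_product]
  unfold encodeDigraph encodeRel adjBits hostDigraph
  simp

theorem isTournament_hostDigraph (m n k : ℕ) (Q W E : ℕ → ℕ → Bool) :
    IsTournament (hostDigraph m n k Q W E).2 := by
  constructor
  · intro i
    simp [hostDigraph, hostRel]
  · intro i j hij
    have hne := (nodup_hostVerts m n fun a => W a a).injective_get.ne hij
    simp only [hostDigraph]
    generalize (hostVerts m n fun a => W a a).get i = x at hne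
    generalize (hostVerts m n fun a => W a a).get j = y at hne
    obtain ⟨a, u⟩ := x
    obtain ⟨b, v⟩ := y
    rw [xor_iff_iff_not]
    unfold hostRel
    simp only
    rcases lt_trichotomy a b with h | h | h
    · simp [h, h.not_gt]
    · subst h
      have : u ≠ v := fun h => hne (by rw [h])
      simp only [lt_irrefl, if_false, decide_eq_true_eq]
      omega
    · simp [h, h.not_gt]

open Classical in
/-- Counting induced copies along an embedding of the vertex set. -/
theorem inducedCount_eq_card {V : Type*} [Fintype V] (T : FinDigraph) {N : ℕ}
    (G : Digraph (Fin N)) (r : V → V → Prop) (e : Fin N ↪ V)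
    (h : ∀ i j, G.Adj i j ↔ r (e i) (e j)) :
    inducedCount T ⟨N, G⟩ = (Finset.univ.filter fun X : Finset V => (∀ x ∈ X, x ∈ Set.range e) ∧
      Nonempty (T.2.Adj ≃r Subrel r (· ∈ X))).card := by
  unfold inducedCount
  rw [← Set.ncard_coe_finset]
  refine Set.ncard_congr (fun A _ => A.map e) ?_ ?_ ?_
  · intro A hA
    simp only [Finset.coe_filter, Finset.mem_univ, true_and, Set.mem_ofPred_eq]
    refine ⟨?_, hA.map fun f => f.trans ?_⟩
    · intro x hx
      obtain ⟨i, -, rfl⟩ := Finset.mem_map.1 hx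
      exact ⟨i, rfl⟩
    · refine ⟨(Equiv.ofBijective (fun i : {i // i ∈ A} =>
        (⟨e i, Finset.mem_map_of_mem e i.2⟩ : {x // x ∈ A.map e})) ⟨?_, ?_⟩), ?_⟩
      · intro i j hij
        exact Subtype.ext (e.injective (congrArg Subtype.val hij))
      · rintro ⟨x, hx⟩
        obtain ⟨i, hi, rfl⟩ := Finset.mem_map.1 hx
        exact ⟨⟨i, hi⟩, rfl⟩
      · intro i j
        exact (h i j).symm
  · intro A B _ _ hAB
    exact Finset.map_injective e hAB
  · intro X hX
    simp only [Finset.coe_filter, Finset.mem_univ, true_and, Set.mem_ofPred_eq] at hX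
    obtain ⟨hr, hiso⟩ := hX
    have hXe : (X.preimage e e.injective.injOn).map e = X := by
      ext x
      simp only [Finset.mem_map, Finset.mem_preimage]
      constructor
      · rintro ⟨i, hi, rfl⟩
        exact hi
      · intro hx
        obtain ⟨i, rfl⟩ := hr x hx
        exact ⟨i, hx, rfl⟩
    refine ⟨X.preimage e e.injective.injOn, hiso.map fun f => f.trans (RelIso.symm ?_), hXe⟩
    refine ⟨(Equiv.ofBijective (fun i : {i // i ∈ X.preimage e e.injective.injOn} =>
        (⟨e i, Finset.mem_preimage.1 i.2⟩ : {x // x ∈ X})) ⟨?_, ?_⟩), ?_⟩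
    · intro i j hij
      exact Subtype.ext (e.injective (congrArg Subtype.val hij))
    · rintro ⟨x, hx⟩
      obtain ⟨i, rfl⟩ := hr x hx
      exact ⟨⟨i, by simpa using hx⟩, rfl⟩
    · intro i j
      exact (h i j).symm

open Classical in
theorem inducedCount_hostDigraph (T : FinDigraph) {m n k w : ℕ} (Q E : ℕ → ℕ → Bool) :
    inducedCount T (hostDigraph m n k Q (bitT m w) E) =
      (Finset.univ.filter fun X : Finset (Fin m × Fin n) =>
        (∀ x ∈ X, bitT m w x.1 x.1 = true) ∧
          Nonempty (T.2.Adj ≃r Subrel (hostR k Q (bitT m w) E) (· ∈ X))).card := by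
  set l := hostVerts m n fun a => bitT m w a a with hl
  have hmem : ∀ i : Fin l.length, (l.get i).1 < m ∧ (l.get i).2 < n ∧
      bitT m w (l.get i).1 (l.get i).1 = true := fun i =>
      (mem_hostVerts (d := fun a => bitT m w a a)).1 (l.get_mem i)
  let e : Fin l.length ↪ Fin m × Fin n :=
    ⟨fun i => (⟨(l.get i).1, (hmem i).1⟩, ⟨(l.get i).2, (hmem i).2.1⟩), fun i j hij => by
      simp only [Prod.mk.injEq, Fin.mk.injEq] at hij
      exact (nodup_hostVerts m n _).injective_get (Prod.ext hij.1 hij.2)⟩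
  have hrange : ∀ x, x ∈ Set.range e ↔ bitT m w x.1 x.1 = true := by
    intro x
    constructor
    · rintro ⟨i, rfl⟩
      exact (hmem i).2.2
    · intro hx
      have : ((x.1 : ℕ), (x.2 : ℕ)) ∈ l :=
        (mem_hostVerts (d := fun a => bitT m w a a)).2 ⟨x.1.2, x.2.2, hx⟩
      obtain ⟨i, hi⟩ := List.get_of_mem this
      exact ⟨i, Prod.ext (Fin.ext (congrArg Prod.fst hi)) (Fin.ext (congrArg Prod.snd hi))⟩
  unfold hostDigraph
  rw [inducedCount_eq_card T _ (hostR k Q (bitT m w) E : Fin m × Fin n → _ → Prop) e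
    fun i j => Iff.rfl]
  simp only [hrange]

/-- The alternating sum can be computed from answers of the oracle. -/
theorem hostSum_eq_sum_inducedCount {m : ℕ} (T : Digraph (Fin m)) (k n : ℕ)
    (Q E : ℕ → ℕ → Bool) :
    hostSum T k n Q E = ∑ w ∈ Finset.range (2 ^ (m * m)),
      sgn k m w * inducedCount ⟨m, T⟩ (hostDigraph m n k Q (bitT m w) E) := by
  unfold hostSum
  refine Finset.sum_congr rfl fun w _ => ?_
  rw [inducedCount_hostDigraph]

open Classical in
/-- If only the first `k` values of a function are restricted, the others contribute a power of
`n`. -/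
theorem card_filter_initial {k m n : ℕ} (hkm : k ≤ m) (E : ℕ → ℕ → Bool) :
    (Finset.univ.filter fun v : Fin m → Fin n =>
      ∀ a b : Fin m, a < b → (b : ℕ) < k → E (v a) (v b) = true).card =
    (Finset.univ.filter fun v : Fin k → Fin n =>
      ∀ a b : Fin k, a < b → E (v a) (v b) = true).card * n ^ (m - k) := by
  obtain ⟨r, rfl⟩ := Nat.exists_eq_add_of_le hkm
  rw [Nat.add_sub_cancel_left]
  have hc : n ^ r = (Finset.univ : Finset (Fin r → Fin n)).card := by simp
  rw [hc, ← Finset.card_product]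
  refine Finset.card_equiv (Fin.appendEquiv k r).symm fun v => ?_
  obtain ⟨⟨v, v'⟩, rfl⟩ := (Fin.appendEquiv k r).surjective v
  simp only [Finset.mem_filter, Finset.mem_univ, true_and, Finset.mem_product, and_true,
    Equiv.symm_apply_apply]
  constructor
  · intro h a b hab
    simpa using h (Fin.castAdd r a) (Fin.castAdd r b) hab b.2
  · intro h a b hab hb
    have ha : (a : ℕ) < k := lt_trans hab hb
    have := h ⟨a, ha⟩ ⟨b, hb⟩ hab
    rw [← Fin.append_left v v', ← Fin.append_left v v'] at this
    exact this

/-- The relation on numbers that counts each clique once: adjacency in increasing order. -/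
noncomputable def upAdj {n : ℕ} (G : SimpleGraph (Fin n)) (u v : ℕ) : Bool := by
  classical
  exact decide (∃ (hu : u < n) (hv : v < n), u < v ∧ G.Adj ⟨u, hu⟩ ⟨v, hv⟩)

theorem upAdj_eq_true {n : ℕ} {G : SimpleGraph (Fin n)} {u v : Fin n} :
    upAdj G u v = true ↔ u < v ∧ G.Adj u v := by
  simp [upAdj]

open Classical in
/-- Cliques correspond to their increasing enumerations. -/
theorem card_filter_upAdj {n k : ℕ} (G : SimpleGraph (Fin n)) :
    (Finset.univ.filter fun v : Fin k → Fin n =>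
      ∀ a b : Fin k, a < b → upAdj G (v a) (v b) = true).card =
    {A : Finset (Fin n) | G.IsNClique k A}.ncard := by
  rw [← Set.ncard_coe_finset]
  simp only [upAdj_eq_true, Finset.coe_filter, Finset.mem_univ, true_and]
  have hmono : ∀ v : Fin k → Fin n, (∀ a b : Fin k, a < b → v a < v b ∧ G.Adj (v a) (v b)) →
      StrictMono v := fun v hv a b hab => (hv a b hab).1
  refine Set.ncard_congr (fun v _ => Finset.univ.image v) ?_ ?_ ?_
  · intro v hv
    have hv' := hmono v hv
    rw [Set.mem_ofPred_eq, SimpleGraph.isNClique_iff,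
      Finset.card_image_of_injective _ hv'.injective, SimpleGraph.isClique_iff]
    refine ⟨?_, by simp⟩
    intro x hx y hy hxy
    simp only [Finset.coe_image, Finset.coe_univ, Set.image_univ, Set.mem_range] at hx hy
    obtain ⟨a, rfl⟩ := hx
    obtain ⟨b, rfl⟩ := hy
    rcases lt_trichotomy a b with h | h | h
    · exact (hv a b h).2
    · exact absurd (congrArg v h) hxy
    · exact (hv b a h).2.symm
  · intro v v' hv hv' h
    refine (hmono v hv).range_inj (hmono v' hv') |>.1 ?_
    have := congrArg (fun s : Finset (Fin n) => (s : Set (Fin n))) h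
    simpa using this
  · intro A hA
    rw [Set.mem_ofPred_eq, SimpleGraph.isNClique_iff, SimpleGraph.isClique_iff] at hA
    refine ⟨A.orderEmbOfFin hA.2, fun a b hab => ?_, ?_⟩
    · refine ⟨(A.orderEmbOfFin hA.2).strictMono hab, ?_⟩
      exact hA.1 (Finset.orderEmbOfFin_mem A hA.2 a) (Finset.orderEmbOfFin_mem A hA.2 b)
        ((A.orderEmbOfFin hA.2).injective.ne hab.ne)
    · exact Finset.image_orderEmbOfFin_univ A hA.2

/-- The relation that holds only for the pair `(0, 0)`. -/
def zeroRel (u v : ℕ) : Bool := decide (u = 0 ∧ v = 0)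

open Classical in
/-- Only the constant function zero is counted, so that the sum for this relation gives the
coefficient up to a power of the order of the graph. -/
theorem card_filter_zeroRel {n k : ℕ} (hk : 2 ≤ k) :
    (Finset.univ.filter fun v : Fin k → Fin (n + 1) =>
      ∀ a b : Fin k, a < b → zeroRel (v a) (v b) = true).card = 1 := by
  rw [Finset.card_eq_one]
  refine ⟨fun _ => 0, ?_⟩
  ext v
  simp only [zeroRel, decide_eq_true_eq, Finset.mem_filter, Finset.mem_univ, true_and,
    Finset.mem_singleton]
  constructor
  · intro h
    funext a
    by_cases ha : (a : ℕ) = 0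
    · exact Fin.ext (h a ⟨1, hk⟩ (by rw [Fin.lt_def, ha]; simp)).1
    · exact Fin.ext (h ⟨0, by omega⟩ a (by rw [Fin.lt_def]; simp; omega)).2
  · rintro rfl a b _
    simp

/-- The number of cliques is the quotient of two sums over host tournaments. -/
theorem hostSum_upAdj {m n k : ℕ} (T : Digraph (Fin m)) (Q : ℕ → ℕ → Bool)
    (G : SimpleGraph (Fin n)) (hk : 2 ≤ k) (hkm : k ≤ m) :
    hostSum T k n Q (upAdj G) =
      hostSum T k n Q zeroRel * {A : Finset (Fin n) | G.IsNClique k A}.ncard := by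
  rw [hostSum_eq, hostSum_eq, card_filter_initial hkm, card_filter_initial hkm, card_filter_upAdj]
  cases n with
  | zero =>
    have : {A : Finset (Fin 0) | G.IsNClique k A}.ncard = 0 := by
      rw [Set.ncard_eq_zero (Set.toFinite _), Set.eq_empty_iff_forall_notMem]
      intro A hA
      rw [Set.mem_ofPred_eq, SimpleGraph.isNClique_iff, Finset.eq_empty_of_isEmpty A] at hA
      simp at hA
      omega
    simp [this]
  | succ n =>
    rw [card_filter_zeroRel hk]
    push_cast
    ring

theorem hostSum_zeroRel_ne_zero {m n k : ℕ} (T : Digraph (Fin m)) (Q : ℕ → ℕ → Bool)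
    (hn : n ≠ 0) (hk : 2 ≤ k) (hkm : k ≤ m) (h : hostCoeff T k Q ≠ 0) :
    hostSum T k n Q zeroRel ≠ 0 := by
  obtain ⟨n, rfl⟩ := Nat.exists_eq_succ_of_ne_zero hn
  rw [hostSum_eq, card_filter_initial hkm, card_filter_zeroRel hk]
  simp [h]
  omega

/-! ### Compiling primitive recursive functions -/

/-- The function `f` can be computed by a program in time `τ`, whatever the argument registers,
the destination register and the range of scratch registers. -/
def Compiles {n : ℕ} (f τ : List.Vector ℕ n → ℕ) : Prop :=
  ∀ (args : Fin n → ℕ) (d base : ℕ), (∀ i, args i < base ∧ args i ≠ d) → d < base →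
    ∃ p : Prog, (∀ r < base, r ≠ d → p.wr r = false) ∧ (∀ A, p.wra A = false) ∧
      ∀ O s v, (∀ i, s.reg (args i) = v.get i) →
        wp O p (fun s' t => t ≤ τ v ∧ s'.reg d = f v) s

/-- Computing several functions into consecutive registers. -/
theorem compiles_list {n m : ℕ} {g τ : Fin n → List.Vector ℕ m → ℕ}
    (h : ∀ i, Compiles (g i) (τ i)) (args : Fin m → ℕ) (base : ℕ) (hargs : ∀ i, args i < base)
    (l : List (Fin n)) :
    ∃ p : Prog, (∀ r < base + n, (∀ i ∈ l, r ≠ base + i) → p.wr r = false) ∧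
      (∀ A, p.wra A = false) ∧
      ∀ O s v, (∀ i, s.reg (args i) = v.get i) →
        wp O p (fun s' t => t ≤ (l.map (τ · v)).sum + 1 ∧
          ∀ i ∈ l, s'.reg (base + i) = g i v) s := by
  induction l with
  | nil =>
    refine ⟨.const (base + n) 0, fun r hr _ => ?_, fun _ => rfl, fun O s v _ => ?_⟩
    · simp [Prog.wr, hr.ne]
    · rw [wp_const]; simp
  | cons i l ih =>
    obtain ⟨p, hp, hpa, hps⟩ := ih
    obtain ⟨q, hq, hqa, hqs⟩ := h i args (base + i) (base + n)
      (fun j => ⟨by have := hargs j; omega, by have := hargs j; omega⟩) (by omega)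
    refine ⟨.seq q p, fun r hr hr' => ?_, fun A => by simp [Prog.wra, hpa, hqa],
      fun O s v hv => ?_⟩
    · simp only [List.mem_cons, forall_eq_or_imp] at hr'
      simp [Prog.wr, hp r hr hr'.2, hq r hr hr'.1]
    · rw [wp_seq]
      refine (hqs O s v hv).frame.mono ?_
      rintro s₁ t₁ ⟨⟨ht₁, h₁⟩, hf₁⟩
      have hv₁ : ∀ j, s₁.reg (args j) = v.get j := fun j => by
        rw [hf₁.1 _ (hq _ (by have := hargs j; omega) (by have := hargs j; omega)), hv j]
      refine (hps O s₁ v hv₁).frame.mono ?_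
      rintro s₂ t₂ ⟨⟨ht₂, h₂⟩, hf₂⟩
      refine ⟨by simp only [List.map_cons, List.sum_cons]; omega, ?_⟩
      intro j hj
      by_cases hjl : j ∈ l
      · exact h₂ j hjl
      · obtain rfl : j = i := by simpa [hjl] using hj
        rw [hf₂.1 (base + j) (hp _ (by omega) fun j' hj' h' => hjl ?_), h₁]
        obtain rfl : j = j' := Fin.ext (by omega)
        exact hj'

/-- Primitive recursive functions are computed by programs whose running time has a primitive
recursive bound.  Primitive recursion becomes a counting loop. -/
theorem exists_compiles {n : ℕ} {f : List.Vector ℕ n → ℕ} (hf : Nat.Primrec' f) :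
    ∃ τ, Primrec τ ∧ Compiles f τ := by
  induction hf with
  | zero =>
    refine ⟨fun _ => 1, Primrec.const 1, fun args d base _ _ => ⟨.const d 0, fun r _ hrd => ?_,
      fun _ => rfl, fun O s v _ => ?_⟩⟩
    · simp [Prog.wr, hrd]
    · rw [wp_const]; simp
  | succ =>
    refine ⟨fun _ => 2, Primrec.const 2, fun args d base ha _ =>
      ⟨.seq (.const d 1) (.add d (args 0) d), fun r _ hrd => ?_, fun _ => rfl,
        fun O s v hv => ?_⟩⟩
    · simp [Prog.wr, hrd]
    · rw [wp_seq, wp_const, wp_add]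
      simp [(ha 0).2, hv 0]
  | get i =>
    refine ⟨fun _ => 2, Primrec.const 2, fun args d base ha _ =>
      ⟨copyP d (args i), fun r _ hrd => ?_, fun _ => rfl, fun O s v hv => ?_⟩⟩
    · simp [copyP, Prog.wr, hrd]
    · rw [wp_copyP (ha i).2.symm]
      simp [hv i]
  | @comp m n f g hf hg ihf ihg =>
    obtain ⟨τf, hτf, hcf⟩ := ihf
    choose τg hτg hcg using ihg
    have hl : ∀ l : List (Fin n), Primrec fun v => (l.map (τg · v)).sum := by
      intro l
      induction l with
      | nil => exact Primrec.const 0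
      | cons i l ih => exact Primrec.nat_add.comp (hτg i) ih
    refine ⟨fun v => ((List.finRange n).map (τg · v)).sum + 1 +
      τf (List.Vector.ofFn fun i => g i v), ?_, ?_⟩
    · exact Primrec.nat_add.comp (Primrec.succ.comp (hl _))
        (hτf.comp (Primrec.vector_ofFn fun i => (hg i).to_prim))
    · intro args d base ha hd
      obtain ⟨p, hp, hpa, hps⟩ := compiles_list hcg args base (fun i => (ha i).1)
        (List.finRange n)
      obtain ⟨q, hq, hqa, hqs⟩ := hcf (fun i => base + i) d (base + n)
        (fun i => ⟨by omega, by omega⟩) (by omega)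
      refine ⟨.seq p q, fun r hr hrd => ?_, fun A => by simp [Prog.wra, hpa, hqa],
        fun O s v hv => ?_⟩
      · simp [Prog.wr, hp r (by omega) fun i _ => by omega, hq r (by omega) hrd]
      · rw [wp_seq]
        refine (hps O s v hv).mono ?_
        rintro s₁ t₁ ⟨ht₁, h₁⟩
        refine (hqs O s₁ (List.Vector.ofFn fun i => g i v) fun i => ?_).mono ?_
        · rw [h₁ i (List.mem_finRange i), List.Vector.get_ofFn]
        · rintro s₂ t₂ ⟨ht₂, h₂⟩
          exact ⟨by beta_reduce; omega, h₂⟩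
  | @prec n f g hf hg ihf ihg =>
    obtain ⟨τf, hτf, hcf⟩ := ihf
    obtain ⟨τg, hτg, hcg⟩ := ihg
    set H : List.Vector ℕ n → ℕ → ℕ := fun v y =>
      Nat.rec (f v) (fun y IH => g (y ::ᵥ IH ::ᵥ v)) y with hH
    have hHp : Primrec₂ H := by
      refine Primrec.nat_rec' (f := fun p : List.Vector ℕ n × ℕ => p.2)
        (g := fun p => f p.1) (h := fun p q => g (q.1 ::ᵥ q.2 ::ᵥ p.1)) Primrec.snd
        (hf.to_prim.comp Primrec.fst) ?_
      exact hg.to_prim.comp (Primrec.vector_cons.comp (Primrec.fst.comp Primrec.snd)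
        (Primrec.vector_cons.comp (Primrec.snd.comp Primrec.snd)
          (Primrec.fst.comp Primrec.fst)))
    refine ⟨fun v => τf v.tail + (∑ j ∈ Finset.range v.head,
      (τg (j ::ᵥ H v.tail j ::ᵥ v.tail) + 6)) + 5, ?_, ?_⟩
    · have hs : Primrec fun v : List.Vector ℕ (n + 1) => (Nat.rec 0 (fun j S =>
          S + (τg (j ::ᵥ H v.tail j ::ᵥ v.tail) + 6)) v.head : ℕ) := by
        refine Primrec.nat_rec' (f := fun v : List.Vector ℕ (n + 1) => v.head)
          (g := fun _ => 0) (h := fun v q => q.2 + (τg (q.1 ::ᵥ H v.tail q.1 ::ᵥ v.tail) + 6))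
          Primrec.vector_head (Primrec.const 0) ?_
        have ht : Primrec fun x : List.Vector ℕ (n + 1) × ℕ × ℕ => x.1.tail :=
          Primrec.vector_tail.comp Primrec.fst
        have hj : Primrec fun x : List.Vector ℕ (n + 1) × ℕ × ℕ => x.2.1 :=
          Primrec.fst.comp Primrec.snd
        exact Primrec.nat_add.comp (Primrec.snd.comp Primrec.snd) (Primrec.nat_add.comp
          (hτg.comp (Primrec.vector_cons.comp hj (Primrec.vector_cons.comp (hHp.comp ht hj) ht)))
          (Primrec.const 6))
      refine Primrec.nat_add.comp (Primrec.nat_add.comp (hτf.comp Primrec.vector_tail)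
        (hs.of_eq fun v => ?_)) (Primrec.const 5)
      induction v.head with
      | zero => rfl
      | succ y ih => rw [Finset.sum_range_succ, ← ih]
    · intro args d base ha hd
      obtain ⟨p, hp, hpa, hps⟩ := hcf (fun i => args i.succ) base (base + 4)
        (fun i => ⟨by have := (ha i.succ).1; omega, by have := (ha i.succ).1; omega⟩) (by omega)
      let args' : Fin (n + 2) → ℕ := Fin.cons (base + 1) (Fin.cons base fun i => args i.succ)
      have hargs' : ∀ i, args' i < base + 3 := by
        intro i
        refine Fin.cases ?_ (fun i => Fin.cases ?_ (fun i => ?_) i) i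
        · simp [args']
        · simp [args']
        · have := (ha i.succ).1
          simp only [args', Fin.cons_succ]
          omega
      obtain ⟨q, hq, hqa, hqs⟩ := hcg args' (base + 3) (base + 4)
        (fun i => ⟨by have := hargs' i; omega, by have := hargs' i; omega⟩) (by omega)
      have h0 := (ha 0).1
      refine ⟨.seq p (.seq (forP (base + 1) (args 0) (base + 2) (.seq q (copyP base (base + 3))))
        (copyP d base)), fun r hr hrd => ?_, fun A => ?_, fun O s v hv => ?_⟩
      · simp only [Prog.wr, forP, copyP, hp r (by omega) (by omega), hq r (by omega) (by omega),
          Bool.or_eq_false_iff, beq_eq_false_iff_ne, true_and]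
        omega
      · simp [Prog.wra, forP, copyP, hpa, hqa]
      · have htail : ∀ i, s.reg (args i.succ) = v.tail.get i := fun i => by
          rw [hv, List.Vector.get_tail_succ]
        rw [wp_seq]
        refine (hps O s v.tail htail).frame.mono ?_
        rintro s₁ t₁ ⟨⟨ht₁, h₁⟩, hf₁⟩
        have hargs₁ : ∀ i, s₁.reg (args i) = v.get i := fun i => by
          have := (ha i).1
          rw [hf₁.1 _ (hp _ (by omega) (by omega)), hv i]
        have hhead : s₁.reg (args 0) = v.head := by rw [hargs₁, List.Vector.get_zero]
        rw [wp_seq]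
        refine (wp_forP' (fun j s => s.reg base = H v.tail j)
          (fun j => τg (j ::ᵥ H v.tail j ::ᵥ v.tail) + 2) (by omega) (by omega) (by omega)
          ?_ ?_ ?_ h₁ ?_).mono ?_
        · simp [Prog.wr, copyP, hq (base + 1) (by omega) (by omega)]
        · simp only [Prog.wr, copyP, hq (args 0) (by omega) (by omega),
            Bool.or_eq_false_iff, beq_eq_false_iff_ne, true_and]
          omega
        · intro j s s' hr _ hI
          rw [hr base (by omega) (by omega)]; exact hI
        · intro j hj s' hI hj' hF
          have hrest : ∀ i : Fin n, s'.reg (args i.succ) = v.tail.get i := by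
            intro i
            have := (ha i.succ).1
            rw [hF.1 _ ?_, hargs₁, List.Vector.get_tail_succ]
            simp only [Prog.wr, forP, copyP, hq (args i.succ) (by omega) (by omega),
              Bool.or_eq_false_iff, beq_eq_false_iff_ne, true_and]
            omega
          rw [wp_seq]
          refine (hqs O s' (j ::ᵥ H v.tail j ::ᵥ v.tail) ?_).mono ?_
          · intro i
            refine Fin.cases ?_ (fun i => Fin.cases ?_ (fun i => ?_) i) i
            · simpa [args'] using hj'
            · exact hI
            · simpa [args'] using hrest i
          · rintro s'' t ⟨ht, h⟩
            rw [wp_copyP (by omega)]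
            exact ⟨by omega, by simp [h, hH]⟩
        · rintro s' t ⟨ht, h⟩
          rw [wp_copyP (by omega)]
          rw [hhead] at ht h
          refine ⟨?_, by simp [h, hH]⟩
          have : ∑ j ∈ Finset.range v.head, (τg (j ::ᵥ H v.tail j ::ᵥ v.tail) + 2 + 4) =
            ∑ j ∈ Finset.range v.head, (τg (j ::ᵥ H v.tail j ::ᵥ v.tail) + 6) := rfl
          beta_reduce
          omega

/-- A binary primitive recursive function of the registers `1` and `18`, computed into the
register `d`. -/
theorem exists_prog_of_primrec {F : ℕ → ℕ → ℕ} (hF : Primrec₂ F) {d : ℕ} (hd : d < 100)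
    (hd1 : d ≠ 1) (hd18 : d ≠ 18) :
    ∃ (τ : ℕ → ℕ → ℕ) (p : Prog), Primrec₂ τ ∧ (∀ r < 100, r ≠ d → p.wr r = false) ∧
      (∀ A, p.wra A = false) ∧
      ∀ O s, wp O p (fun s' t => t ≤ τ (s.reg 1) (s.reg 18) ∧
        s'.reg d = F (s.reg 1) (s.reg 18)) s := by
  obtain ⟨τ, hτ, hc⟩ := exists_compiles (f := fun v : List.Vector ℕ 2 => F v.head v.tail.head)
    (Nat.Primrec'.prim_iff₂.2 hF)
  obtain ⟨p, hp, hpa, hps⟩ := hc ![1, 18] d 100 (by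
    intro i
    fin_cases i
    · exact ⟨by simp, by simpa using hd1.symm⟩
    · exact ⟨by simp, by simpa using hd18.symm⟩) hd
  refine ⟨fun a b => τ (a ::ᵥ b ::ᵥ List.Vector.nil), p, ?_, hp, hpa, fun O s => ?_⟩
  · exact hτ.comp (Primrec.vector_cons.comp Primrec.fst
      (Primrec.vector_cons.comp Primrec.snd (Primrec.const _)))
  · refine (hps O s (s.reg 1 ::ᵥ s.reg 18 ::ᵥ List.Vector.nil) ?_).mono fun s' t h => h
    intro i
    fin_cases i <;> rfl

open Nat.Partrec (Code)

/-! ### Reading encodings -/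

theorem adjBits_eq_ofFn {n : ℕ} (r : Fin n → Fin n → Prop) [∀ u v, Decidable (r u v)] :
    adjBits r = List.ofFn fun i : Fin (n * n) => decide (r i.divNat i.modNat) := by
  rw [List.ofFn_mul]
  unfold adjBits
  simp only [SProd.sprod, List.product, List.map_flatten, List.map_map, List.flatMap,
    List.ofFn_eq_map]
  congr 1
  refine List.map_congr_left fun u _ => ?_
  simp only [Function.comp_apply, List.map_map]
  refine List.map_congr_left fun v _ => ?_
  simp only [Function.comp_apply]
  have hn : 0 < n := u.pos
  have e1 : Fin.divNat (⟨u * n + v, by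
      calc (u : ℕ) * n + v < (u + 1) * n := by rw [Nat.add_mul]; omega
        _ ≤ n * n := Nat.mul_le_mul_right _ u.2⟩ : Fin (n * n)) = u := by
    apply Fin.ext
    simp only [Fin.coe_divNat]
    rw [Nat.mul_comm, Nat.mul_add_div hn, Nat.div_eq_of_lt v.2, add_zero]
  have e2 : Fin.modNat (⟨u * n + v, by
      calc (u : ℕ) * n + v < (u + 1) * n := by rw [Nat.add_mul]; omega
        _ ≤ n * n := Nat.mul_le_mul_right _ u.2⟩ : Fin (n * n)) = v := by
    apply Fin.ext
    simp only [Fin.coe_modNat]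
    rw [Nat.mul_comm, Nat.mul_add_mod, Nat.mod_eq_of_lt v.2]
  rw [decide_eq_decide, e1, e2]

theorem length_adjBits {n : ℕ} (r : Fin n → Fin n → Prop) : (adjBits r).length = n * n := by
  classical
  rw [adjBits_eq_ofFn, List.length_ofFn]

open Classical in
theorem getD_adjBits {n : ℕ} (r : Fin n → Fin n → Prop) (l : List Bool) {u v : ℕ} (hu : u < n)
    (hv : v < n) :
    (adjBits r ++ l).getD (u * n + v) false = decide (r ⟨u, hu⟩ ⟨v, hv⟩) := by
  have hlt := pos_lt hu hv
  rw [List.getD_append _ _ _ _ (by rw [length_adjBits]; exact hlt), adjBits_eq_ofFn,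
    List.getD_eq_getElem _ _ (by simpa using hlt), List.getElem_ofFn, decide_eq_decide]
  have e1 : Fin.divNat (⟨u * n + v, hlt⟩ : Fin (n * n)) = ⟨u, hu⟩ := by
    apply Fin.ext
    simp only [Fin.coe_divNat]
    rw [Nat.mul_comm, Nat.mul_add_div (by omega), Nat.div_eq_of_lt hv, add_zero]
  have e2 : Fin.modNat (⟨u * n + v, hlt⟩ : Fin (n * n)) = ⟨v, hv⟩ := by
    apply Fin.ext
    simp only [Fin.coe_modNat]
    rw [Nat.mul_comm, Nat.mul_add_mod, Nat.mod_eq_of_lt hv]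
  rw [e1, e2]

theorem length_unaryThen (n : ℕ) (l : List Bool) : (unaryThen n l).length = n + 1 + l.length := by
  simp [unaryThen]; omega

theorem getD_unaryThen_lt {n i : ℕ} (l : List Bool) (h : i < n) :
    (unaryThen n l).getD i false = true := by
  rw [unaryThen, List.getD_append _ _ _ _ (by simpa using h), List.getD_eq_getElem _ _ (by simpa)]
  simp

theorem getD_unaryThen_self (n : ℕ) (l : List Bool) : (unaryThen n l).getD n false = false := by
  rw [unaryThen, List.getD_append_right _ _ _ _ (by simp)]
  simp

theorem getD_unaryThen_add (n i : ℕ) (l : List Bool) :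
    (unaryThen n l).getD (n + 1 + i) false = l.getD i false := by
  rw [unaryThen, List.getD_append_right _ _ _ _ (by simp; omega)]
  simp only [List.length_replicate]
  rw [show n + 1 + i - n = i + 1 by omega, List.getD_cons_succ]

theorem length_encodeDigraph (T : FinDigraph) :
    (encodeDigraph T).length = T.1 + 1 + T.1 * T.1 := by
  rw [encodeDigraph, encodeRel, length_unaryThen, length_adjBits]

open Classical in
theorem getD_encodeDigraph {n : ℕ} (T : Digraph (Fin n)) (l : List Bool) {u v : ℕ} (hu : u < n)
    (hv : v < n) :
    (encodeDigraph ⟨n, T⟩ ++ l).getD (n + 1 + (u * n + v)) false =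
      decide (T.Adj ⟨u, hu⟩ ⟨v, hv⟩) := by
  rw [encodeDigraph, encodeRel_append, getD_unaryThen_add, getD_adjBits _ _ hu hv]

/-! ### Finding a large tournament in the class -/

/-- Whether the word `w`, assumed to encode a directed graph, encodes a tournament. -/
def TournamentWord (w : List Bool) : Prop :=
  ∀ u ∈ List.range (leadingOnes w), ∀ v ∈ List.range (leadingOnes w),
    w.getD (leadingOnes w + 1 + (u * leadingOnes w + v)) false =
      if u = v then false else !(w.getD (leadingOnes w + 1 + (v * leadingOnes w + u)) false)

theorem tournamentWord_encodeDigraph (T : FinDigraph) :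
    TournamentWord (encodeDigraph T) ↔ IsTournament T.2 := by
  classical
  obtain ⟨n, T⟩ := T
  have hl : leadingOnes (encodeDigraph ⟨n, T⟩) = n := leadingOnes_unaryThen _ _
  have hb : ∀ u v (hu : u < n) (hv : v < n),
      (encodeDigraph ⟨n, T⟩).getD (n + 1 + (u * n + v)) false =
        decide (T.Adj ⟨u, hu⟩ ⟨v, hv⟩) := by
    intro u v hu hv
    have := getD_encodeDigraph T [] hu hv
    rwa [List.append_nil] at this
  unfold TournamentWord IsTournament
  rw [hl]
  simp only [List.mem_range]
  constructor
  · intro h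
    refine ⟨fun u => ?_, fun u v huv => ?_⟩
    · have := h u u.2 u u.2
      rw [hb u u u.2 u.2] at this
      simpa using this
    · have := h u u.2 v v.2
      rw [hb u v u.2 v.2, hb v u v.2 u.2, if_neg (fun h => huv (Fin.ext h))] at this
      rw [xor_iff_iff_not]
      by_cases h1 : T.Adj u v <;> by_cases h2 : T.Adj v u <;> simp_all
  · rintro ⟨h1, h2⟩ u hu v hv
    rw [hb u v hu hv, hb v u hv hu]
    by_cases huv : u = v
    · subst huv
      simpa using h1 ⟨u, hu⟩
    · have := h2 ⟨u, hu⟩ ⟨v, hv⟩ (by simpa using huv)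
      rw [xor_iff_iff_not] at this
      simp [huv, this]

theorem primrec_leadingOnes : Primrec leadingOnes :=
  Primrec.list_findIdx Primrec.id (Primrec.not.comp Primrec.snd).to₂

theorem primrecPred_tournamentWord : PrimrecPred TournamentWord := by
  have hbit : Primrec fun x : (List Bool × ℕ) × ℕ =>
      x.1.1.getD (leadingOnes x.1.1 + 1 + (x.1.2 * leadingOnes x.1.1 + x.2)) false := by
    have hl : Primrec fun x : (List Bool × ℕ) × ℕ => leadingOnes x.1.1 :=
      primrec_leadingOnes.comp (Primrec.fst.comp Primrec.fst)
    exact (Primrec.list_getD false).comp (Primrec.fst.comp Primrec.fst)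
      (Primrec.nat_add.comp (Primrec.succ.comp hl) (Primrec.nat_add.comp
        (Primrec.nat_mul.comp (Primrec.snd.comp Primrec.fst) hl) Primrec.snd))
  have hcore : PrimrecPred fun x : (List Bool × ℕ) × ℕ =>
      x.1.1.getD (leadingOnes x.1.1 + 1 + (x.1.2 * leadingOnes x.1.1 + x.2)) false =
        if x.1.2 = x.2 then false else
          !(x.1.1.getD (leadingOnes x.1.1 + 1 + (x.2 * leadingOnes x.1.1 + x.1.2)) false) := by
    refine Primrec.eq.comp hbit (Primrec.ite (Primrec.eq.comp (Primrec.snd.comp Primrec.fst)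
      Primrec.snd) (Primrec.const false) (Primrec.not.comp ?_))
    exact hbit.comp (Primrec.pair (Primrec.pair (Primrec.fst.comp Primrec.fst) Primrec.snd)
      (Primrec.snd.comp Primrec.fst))
  have hrange : Primrec fun w : List Bool => List.range (leadingOnes w) :=
    Primrec.list_range.comp primrec_leadingOnes
  have h1 : PrimrecPred fun y : List Bool × ℕ => ∀ v ∈ List.range (leadingOnes y.1),
      y.1.getD (leadingOnes y.1 + 1 + (y.2 * leadingOnes y.1 + v)) false =
        if y.2 = v then false else
          !(y.1.getD (leadingOnes y.1 + 1 + (v * leadingOnes y.1 + y.2)) false) := by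
    have : PrimrecRel fun (v : ℕ) (y : List Bool × ℕ) =>
        y.1.getD (leadingOnes y.1 + 1 + (y.2 * leadingOnes y.1 + v)) false =
        if y.2 = v then false else
          !(y.1.getD (leadingOnes y.1 + 1 + (v * leadingOnes y.1 + y.2)) false) :=
      hcore.comp (Primrec.pair Primrec.snd Primrec.fst)
    exact (PrimrecRel.forall_mem_list this).comp (hrange.comp Primrec.fst) Primrec.id
  have h2 : PrimrecRel fun (u : ℕ) (w : List Bool) => ∀ v ∈ List.range (leadingOnes w),
      w.getD (leadingOnes w + 1 + (u * leadingOnes w + v)) false =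
        if u = v then false else
          !(w.getD (leadingOnes w + 1 + (v * leadingOnes w + u)) false) :=
    h1.comp (Primrec.pair Primrec.snd Primrec.fst)
  exact (PrimrecRel.forall_mem_list h2).comp hrange Primrec.id

/-- A recursively enumerable predicate is the projection of a primitive recursive one. -/
theorem exists_primrecPred_of_rePred {p : List Bool → Prop} (hp : REPred p) :
    ∃ R : ℕ → List Bool → Prop, PrimrecRel R ∧ ∀ w, p w ↔ ∃ y, R y w := by
  obtain ⟨c, hc⟩ := Code.exists_code.1 hp
  refine ⟨fun y w => (Code.evaln y c (Encodable.encode w)).isSome = true, ?_, fun w => ?_⟩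
  · refine Primrec.eq.comp (Primrec.option_isSome.comp (Code.primrec_evaln.comp
      (Primrec.pair (Primrec.pair Primrec.fst (Primrec.const c))
        (Primrec.encode.comp Primrec.snd)))) (Primrec.const true)
  · have h1 : p w ↔ (Code.eval c (Encodable.encode w)).Dom := by
      rw [hc]
      simp [Part.assert]
    rw [h1, Part.dom_iff_mem]
    simp only [Code.evaln_complete, Option.isSome_iff_exists]
    exact exists_comm

/-- The number whose binary digits are the letters of a word. -/
def wordNum (w : List Bool) : ℕ := w.foldr (fun b z => b.toNat + 2 * z) 0

theorem testBit_wordNum (w : List Bool) (i : ℕ) : (wordNum w).testBit i = w.getD i false := by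
  induction w generalizing i with
  | nil => simp [wordNum]
  | cons b w ih =>
    have : wordNum (b :: w) = Nat.bit b (wordNum w) := by
      cases b <;> simp [wordNum, Nat.bit, Nat.add_comm]
    rw [this]
    cases i with
    | zero => simp
    | succ i => rw [Nat.testBit_bit_succ, ih, List.getD_cons_succ]

theorem primrec_wordNum : Primrec wordNum := by
  refine Primrec.list_foldr (f := fun w : List Bool => w) (g := fun _ => 0)
    (h := fun _ x => x.1.toNat + 2 * x.2) Primrec.id (Primrec.const 0) ?_
  exact Primrec.nat_add.comp ((Primrec.dom_bool Bool.toNat).comp (Primrec.fst.comp Primrec.snd))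
    (Primrec.nat_mul.comp (Primrec.const 2) (Primrec.snd.comp Primrec.snd))

/-- Primitive recursive functions through which a program finds, for every `k`, a tournament in
the class that is large in terms of `k`: the program searches for `s` with `χ k s = 0`, and then
`m s`, `l s`, `z s` are the order of the tournament, the length of its code, and the number whose
binary digits are the letters of its code. -/
theorem exists_search {𝒯 : Set FinDigraph} (h𝒯 : RecursivelyEnumerable 𝒯)
    (hinf : {T ∈ 𝒯 | IsTournament T.2}.Infinite) :
    ∃ (χ : ℕ → ℕ → ℕ) (m l z : ℕ → ℕ), Primrec₂ χ ∧ Primrec m ∧ Primrec l ∧ Primrec z ∧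
      (∀ k, ∃ s, χ k s = 0) ∧
      ∀ k s, χ k s = 0 → ∃ T ∈ 𝒯, IsTournament T.2 ∧ 2 ^ (8 * k + 8) ≤ T.1 ∧ m s = T.1 ∧
        l s = (encodeDigraph T).length ∧
        ∀ i, (z s).testBit i = (encodeDigraph T).getD i false := by
  classical
  obtain ⟨R, hR, hRp⟩ := exists_primrecPred_of_rePred h𝒯
  -- A number `s` stands for a pair of a word and a witness of its membership in the class.
  set W : ℕ → List Bool := fun s => ((Encodable.decode s.unpair.1 : Option (List Bool))).getD []
    with hW
  have hWp : Primrec W := Primrec.option_getD.comp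
    (Primrec.decode.comp (Primrec.fst.comp Primrec.unpair)) (Primrec.const [])
  set P : ℕ → ℕ → Prop := fun k s => 2 ^ (8 * k + 8) ≤ leadingOnes (W s) ∧
    TournamentWord (W s) ∧ R s.unpair.2 (W s) with hP
  have hpow : Primrec₂ ((· ^ ·) : ℕ → ℕ → ℕ) := Primrec₂.unpaired'.1 Nat.Primrec.pow
  have hPp : PrimrecRel P := by
    refine PrimrecPred.and ?_ (PrimrecPred.and ?_ ?_)
    · refine Primrec.nat_le.comp (hpow.comp (Primrec.const 2) (Primrec.nat_add.comp
        (Primrec.nat_mul.comp (Primrec.const 8) Primrec.fst) (Primrec.const 8)))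
        (primrec_leadingOnes.comp (hWp.comp Primrec.snd))
    · exact primrecPred_tournamentWord.comp (hWp.comp Primrec.snd)
    · exact hR.comp (Primrec.snd.comp (Primrec.unpair.comp Primrec.snd)) (hWp.comp Primrec.snd)
  refine ⟨fun k s => if P k s then 0 else 1, fun s => leadingOnes (W s), fun s => (W s).length,
    fun s => wordNum (W s), ?_, primrec_leadingOnes.comp hWp, Primrec.list_length.comp hWp,
    primrec_wordNum.comp hWp, fun k => ?_, fun k s h => ?_⟩
  · exact Primrec.ite hPp (Primrec.const 0) (Primrec.const 1)
  · -- There are only finitely many digraphs of bounded order.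
    have : ∃ T ∈ {T ∈ 𝒯 | IsTournament T.2}, 2 ^ (8 * k + 8) ≤ T.1 := by
      by_contra! hcon
      refine hinf (Set.Finite.subset (s := ⋃ n ∈ Finset.range (2 ^ (8 * k + 8)),
        Set.range fun T : Digraph (Fin n) => (⟨n, T⟩ : FinDigraph)) ?_ ?_)
      · refine Set.Finite.biUnion (Finset.finite_toSet _) fun n _ => ?_
        have : Finite (Digraph (Fin n)) :=
          Finite.of_injective (fun T : Digraph (Fin n) => T.Adj) fun T T' h => Digraph.ext h
        exact Set.finite_range _
      · intro T hT
        simp only [Set.mem_iUnion]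
        exact ⟨T.1, by simpa using hcon T hT, T.2, rfl⟩
    obtain ⟨T, ⟨hT, hT'⟩, hTn⟩ := this
    obtain ⟨y, hy⟩ := (hRp (encodeDigraph T)).1 ⟨T, hT, rfl⟩
    refine ⟨Nat.pair (Encodable.encode (encodeDigraph T)) y, if_pos ?_⟩
    have hWT : W (Nat.pair (Encodable.encode (encodeDigraph T)) y) = encodeDigraph T := by
      simp [hW]
    refine ⟨?_, ?_, ?_⟩
    · rw [hWT]
      exact hTn.trans (leadingOnes_unaryThen _ _).ge
    · rw [hWT]
      exact (tournamentWord_encodeDigraph T).2 hT'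
    · rw [hWT]
      simpa using hy
  · have hPs : P k s := by
      by_contra hn
      simp [hn] at h
    obtain ⟨h1, h2, h3⟩ := hPs
    obtain ⟨T, hT, hTw⟩ := (hRp (W s)).2 ⟨_, h3⟩
    have hl : leadingOnes (W s) = T.1 := by
      rw [← hTw]; exact leadingOnes_unaryThen _ _
    refine ⟨T, hT, ?_, ?_, hl, ?_, fun i => ?_⟩
    · rw [← hTw] at h2
      exact (tournamentWord_encodeDigraph T).1 h2
    · rw [← hl]; exact h1
    · rw [hTw]
    · rw [testBit_wordNum, hTw]

/-! ### Tables, signs and queries -/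

/-- Stores the first binary digits of the register `x` in the array `A`; the number of digits is in
the register `l`. -/
def decodeP (A x l : ℕ) : Prog :=
  .seq (copyP 40 x) (forP 41 l 42 (.seq (.half 43 40) (.seq (.add 44 43 43)
    (.seq (.sub 44 40 44) (.seq (.store A 41 44) (copyP 40 43))))))

theorem wp_decodeP {O : List Bool → ℕ → Prop} {A x l : ℕ} {s : Mem} (hx : x ≠ 40) (hl : l < 40) :
    wp O (decodeP A x l) (fun s' t => t ≤ 10 * s.reg l + 5 ∧
      ∀ i < s.reg l, s'.arr A i = ((s.reg x).testBit i).toNat) s := by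
  rw [decodeP, wp_seq, wp_copyP (Ne.symm hx)]
  refine (wp_forP (fun j s' => s'.reg 40 = s.reg x / 2 ^ j ∧
    ∀ i < j, s'.arr A i = ((s.reg x).testBit i).toNat) 6 (s.reg l) (by omega) (by omega) (by omega)
    rfl ?_ ?_ ?_ ?_ ?_).mono ?_
  · simp [Prog.wr, copyP]; omega
  · rintro j s₁ s₂ hr ha ⟨h1, h2⟩
    exact ⟨by rw [hr 40 (by decide) (by decide), h1], by rw [ha]; exact h2⟩
  · have : l ≠ 40 := by omega
    simp [this]
  · simp
  · rintro j hj s₁ ⟨h1, h2⟩ hj' -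
    simp only [wp_seq, wp_half, wp_add, wp_sub, wp_store]
    rw [wp_copyP (by decide)]
    refine ⟨by omega, ?_, ?_⟩
    · simp [h1, Nat.div_div_eq_div_mul, pow_succ]
    · intro i hi
      simp only [Mem.setReg_arr, Mem.setArr_arr, Mem.setReg_reg, true_and, Nat.reduceEqDiff,
        if_false, if_true, hj', h1]
      by_cases hij : i = j
      · subst hij
        rw [if_pos rfl, Nat.toNat_testBit]
        omega
      · rw [if_neg hij]
        exact h2 i (by omega)
  · rintro s' t ⟨ht, -, h⟩
    exact ⟨by omega, h⟩

/-- The parity of the number of sign pairs at which the table in the array `3` is true, into the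
register `14`. -/
def signP : Prog :=
  .seq (.const 45 0) (.seq (forP 21 3 25 (forP 22 3 26
    (.seq (.sub 38 21 22) (.seq (.sub 39 22 21) (.seq (.add 38 38 39)
      (.seq (.ite 38 (.ite 39 (.sub 38 1 22) (.const 38 0)) (.const 38 1))
        (.ite 38 (.seq (entryP 3 21 22)
          (.ite 34 (.seq (.const 34 1) (.add 45 45 34)) (.const 34 0))) (.const 34 0))))))))
    (.seq (.half 14 45) (.seq (.add 14 14 14) (.sub 14 45 14))))

theorem wp_signP {O : List Bool → ℕ → Prop} {s : Mem} {k m L : ℕ} (hk : s.reg 1 = k)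
    (hm : s.reg 3 = m) (hmL : m ≤ L) (hL : 1 ≤ L) :
    wp O signP (fun s' t => t ≤ 100 * L ^ 3 ∧
      s'.reg 14 = (∑ a ∈ Finset.range m, ∑ b ∈ Finset.range m,
        if SignPair k a b ∧ tbl m (s.arr 3) a b = true then 1 else 0) % 2) s := by
  set f : ℕ → ℕ → ℕ := fun a b =>
    if SignPair k a b ∧ tbl m (s.arr 3) a b = true then 1 else 0 with hf
  rw [signP, wp_seq, wp_const, wp_seq]
  refine (wp_forP (fun j s' => s'.reg 45 = ∑ a ∈ Finset.range j, ∑ b ∈ Finset.range m, f a b)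
    (m * (5 * m + 22) + 3) m (by decide) (by decide) (by decide) rfl rfl ?_ ?_ ?_ ?_).mono ?_
  · intro j s₁ s₂ hr _ h
    rw [hr 45 (by decide) (by decide), h]
  · simpa using hm
  · simp
  · intro a ha s₁ hI ha' hF
    have h3 : s₁.reg 3 = m := by rw [hF.1 3 rfl]; simpa using hm
    refine (wp_forP (fun j s' => s'.reg 45 = (∑ a ∈ Finset.range a, ∑ b ∈ Finset.range m, f a b) +
      ∑ b ∈ Finset.range j, f a b) (5 * m + 18) m (by decide) (by decide) (by decide) rfl rfl
      ?_ h3 (by simpa using hI) ?_).mono ?_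
    · intro j s₁ s₂ hr _ h
      rw [hr 45 (by decide) (by decide), h]
    · intro b hb s₂ hI₂ hb' hF₂
      have h3' : s₂.reg 3 = m := by rw [hF₂.1 3 rfl, h3]
      have hk' : s₂.reg 1 = k := by rw [hF₂.1 1 rfl, hF.1 1 rfl]; simpa using hk
      have ha₂ : s₂.reg 21 = a := by rw [hF₂.1 21 rfl, ha']
      have hA : s₂.arr 3 = s.arr 3 := by rw [hF₂.2 3 rfl, hF.2 3 rfl]; rfl
      rw [Finset.sum_range_succ, ← add_assoc, ← hI₂]
      -- The final branch, given that the register `38` decides whether `(a, b)` is a sign pair.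
      have main : ∀ s₃ : Mem, (∀ r, r ≠ 38 → r ≠ 39 → s₃.reg r = s₂.reg r) → s₃.arr = s₂.arr →
          (s₃.reg 38 ≠ 0 ↔ SignPair k a b) →
          wp O (.ite 38 (.seq (entryP 3 21 22)
            (.ite 34 (.seq (.const 34 1) (.add 45 45 34)) (.const 34 0))) (.const 34 0))
            (fun s' t => t ≤ 5 * m + 11 ∧ s'.reg 45 = s₂.reg 45 + f a b) s₃ := by
        intro s₃ hr hra h38
        rw [wp_ite]
        constructor
        · intro hne
          rw [wp_seq]
          refine (wp_entryP (by decide) (by decide)).frame.mono ?_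
          rintro s₄ t₄ ⟨⟨ht₄, h₄⟩, hf₄⟩
          rw [hr 3 (by decide) (by decide), h3'] at ht₄ h₄
          rw [hra, hA, hr 21 (by decide) (by decide), hr 22 (by decide) (by decide), ha₂, hb']
            at h₄
          have h45 : s₄.reg 45 = s₂.reg 45 := by
            rw [hf₄.1 45 rfl, hr 45 (by decide) (by decide)]
          rw [wp_ite]
          constructor
          · intro h34
            rw [wp_seq, wp_const, wp_add]
            refine ⟨by omega, ?_⟩
            have : tbl m (s.arr 3) a b = true := by rw [← h₄]; simpa using h34
            simp [hf, this, h38.1 hne, h45]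
          · intro h34
            rw [wp_const]
            refine ⟨by omega, ?_⟩
            have : tbl m (s.arr 3) a b = false := by rw [← h₄]; simpa using h34
            simp [hf, this, h45]
        · intro h0
          rw [wp_const]
          refine ⟨by omega, ?_⟩
          have : ¬ SignPair k a b := fun h => h38.2 h h0
          simp [hf, this, hr 45 (by decide) (by decide)]
      simp only [wp_seq, wp_sub, wp_add]
      rw [wp_ite]
      simp only [Mem.setReg_reg, Nat.reduceEqDiff, if_false, if_true, ha₂, hb']
      constructor
      · intro hne
        rw [wp_ite]
        simp only [Mem.setReg_reg, Nat.reduceEqDiff, if_false, if_true]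
        constructor
        · intro hab
          rw [wp_sub]
          refine (main _ ?_ ?_ ?_).mono ?_
          · intro r h1 h2
            simp [h1, h2]
          · rfl
          · simp only [Mem.setReg_reg, Nat.reduceEqDiff, if_false, if_true, hb', hk',
              OfNat.one_ne_ofNat]
            unfold SignPair
            omega
          · rintro s' t ⟨ht, h⟩
            exact ⟨by omega, h⟩
        · intro hab
          rw [wp_const]
          refine (main _ ?_ ?_ ?_).mono ?_
          · intro r h1 h2
            simp [h1, h2]
          · rfl
          · simp only [Mem.setReg_reg, if_true]
            unfold SignPair
            omega
          · rintro s' t ⟨ht, h⟩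
            exact ⟨by omega, h⟩
      · intro h0
        rw [wp_const]
        refine (main _ ?_ ?_ ?_).mono ?_
        · intro r h1 h2
          simp [h1, h2]
        · rfl
        · simp only [Mem.setReg_reg, if_true]
          unfold SignPair
          omega
        · rintro s' t ⟨ht, h⟩
          exact ⟨by omega, h⟩
    · rintro s' t ⟨ht, h⟩
      exact ⟨by omega, by rw [h, Finset.sum_range_succ]⟩
  · rintro s' t ⟨ht, h⟩
    simp only [wp_seq, wp_half, wp_add, wp_sub]
    refine ⟨?_, ?_⟩
    · have h1 : m * (5 * m + 22) ≤ 27 * L ^ 2 := by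
        calc m * (5 * m + 22) ≤ L * (27 * L) := Nat.mul_le_mul hmL (by omega)
          _ = _ := by ring
      have l1 : 1 ≤ L ^ 2 := Nat.one_le_pow _ _ hL
      have h2 : m * (m * (5 * m + 22) + 3 + 4) ≤ 34 * L ^ 3 := by
        calc m * (m * (5 * m + 22) + 3 + 4) ≤ L * (34 * L ^ 2) := Nat.mul_le_mul hmL (by omega)
          _ = _ := by ring
      have l2 : 1 ≤ L ^ 3 := Nat.one_le_pow _ _ hL
      omega
    · change _ = (∑ a ∈ Finset.range m, ∑ b ∈ Finset.range m, f a b) % 2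
      simp only [Mem.setReg_reg, Nat.reduceEqDiff, if_false, if_true, h]
      omega

theorem inducedCount_le (T G : FinDigraph) : inducedCount T G ≤ 2 ^ G.1 := by
  unfold inducedCount
  refine (Set.ncard_le_ncard (Set.subset_univ _) (Set.toFinite _)).trans ?_
  rw [Set.ncard_univ, Nat.card_eq_fintype_card]
  simp

theorem length_hostVerts_le (m n : ℕ) (d : ℕ → Bool) : (hostVerts m n d).length ≤ m * n := by
  have h : (hostVerts m n d).length ≤ ((List.range m).map fun _ => n).sum := by
    rw [hostVerts, List.length_flatMap]
    refine List.sum_le_sum fun a _ => ?_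
    split_ifs <;> simp
  simpa using h

theorem hostDigraph_congr {m n k : ℕ} {Q Q' W W' E E' : ℕ → ℕ → Bool}
    (hQ : ∀ a b, a < m → b < m → Q a b = Q' a b) (hW : ∀ a b, a < m → b < m → W a b = W' a b)
    (hE : ∀ u v, u < n → v < n → E u v = E' u v) :
    hostDigraph m n k Q W E = hostDigraph m n k Q' W' E' := by
  have h1 : (hostVerts m n fun a => W a a) = hostVerts m n fun a => W' a a := by
    unfold hostVerts
    refine List.flatMap_congr fun a ha => ?_
    rw [List.mem_range] at ha
    beta_reduce
    rw [hW a a ha ha]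
  unfold hostDigraph
  rw [h1]
  congr 2
  funext i j
  have hi := mem_hostVerts.1 ((hostVerts m n fun a => W' a a).get_mem i)
  have hj := mem_hostVerts.1 ((hostVerts m n fun a => W' a a).get_mem j)
  rw [hostRel_congr hi.1 hj.1 hi.2.1 hj.2.1
    (fun a b hab hb => hQ a b (hab.trans hb) hb) (fun a b hab hb => hW a b (hab.trans hb) hb) hE]

/-- Builds the host tournament with the relation in the array `e`, asks for the number of induced
copies of the pattern in it, and adds the answer to the register `p` or `q`, according to the
sign. -/
def askP (e p q : ℕ) : Prog :=
  .seq (buildP e) (.seq (.query 15 1 20) (.ite 14 (.add q q 15) (.add p p 15)))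

theorem wp_askP {𝒯 : Set FinDigraph} {T : FinDigraph} (hT : T ∈ 𝒯) {e p q k n w b L : ℕ}
    (hb : T.1 ≤ b) {Q E : ℕ → ℕ → Bool} {s : Mem} (he : e ≠ 1) (hp : p ∈ [8, 10])
    (hq : q ∈ [9, 11]) (hk : s.reg 1 = k) (hn : s.reg 2 = n) (hm : s.reg 3 = T.1)
    (hw : s.word 1 (s.reg 4) = encodeDigraph T)
    (hQ : ∀ a b, a < T.1 → b < T.1 → tbl T.1 (s.arr 2) a b = Q a b)
    (hW : ∀ a b, a < T.1 → b < T.1 → tbl T.1 (s.arr 3) a b = bitT T.1 w a b)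
    (hE : ∀ u v, u < n → v < n → tbl n (s.arr e) u v = E u v)
    (h14 : s.reg 14 = signCount k T.1 w % 2) (hmL : T.1 ≤ L) (hnL : n ≤ L) (hL : 1 ≤ L) :
    wp ((indSubTo 𝒯).oracle b) (askP e p q) (fun s' t => t ≤ 330 * L ^ 5 ∧
      s'.word 1 (s'.reg 4) = encodeDigraph T ∧
      (s'.reg p : ℤ) - s'.reg q = (s.reg p : ℤ) - s.reg q +
        sgn k T.1 w * inducedCount T (hostDigraph T.1 n k Q (bitT T.1 w) E)) s := by
  set H := hostDigraph T.1 n k Q (bitT T.1 w) E with hH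
  have hpq : p ≠ q ∧ p < 20 ∧ q < 20 ∧ p ≠ 15 ∧ q ≠ 15 ∧ p ≠ 4 ∧ q ≠ 4 := by
    simp only [List.mem_cons, List.not_mem_nil, or_false] at hp hq
    omega
  rw [askP, wp_seq]
  refine (wp_buildP he hm hn hmL hnL hL).frame.mono ?_
  rintro s₁ t₁ ⟨⟨ht₁, h₁⟩, hf₁⟩
  rw [hk, hw, ← encodeDigraph_hostDigraph,
    hostDigraph_congr (k := k) (n := n) hQ hW hE, ← hH] at h₁
  have hlen : s₁.reg 20 = T.1 + 1 + T.1 * T.1 + (H.1 + 1 + H.1 * H.1) := by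
    rw [← s₁.length_word 1 (s₁.reg 20), h₁, List.length_append, length_encodeDigraph,
      length_encodeDigraph]
  have hHN : H.1 ≤ L * L := (length_hostVerts_le _ _ _).trans (Nat.mul_le_mul hmL hnL)
  rw [wp_seq]
  refine wp_query (v := inducedCount T H) ?_ ?_
  · refine ⟨⟨(T, H), hT, isTournament_hostDigraph _ _ _ _ _ _⟩, h₁.symm, ?_, rfl⟩
    rw [h₁]
    have := indSubTo_param 𝒯 ⟨(T, H), hT, isTournament_hostDigraph _ _ _ _ _ _⟩
    exact this.trans_le hb
  -- The oracle charges for the binary digits of the answer, which is at most `2 ^ H.1`.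
  have hsz : Nat.size (inducedCount T H) ≤ H.1 + 1 := by
    rw [Nat.size_le]
    exact (inducedCount_le T H).trans_lt (Nat.pow_lt_pow_right (by decide) (by omega))
  have htime : t₁ + (1 + s₁.reg 20 + Nat.size (inducedCount T H) + (1 + 1)) ≤ 330 * L ^ 5 := by
    have h1 : T.1 * T.1 ≤ L ^ 2 := by rw [sq]; exact Nat.mul_le_mul hmL hmL
    have h2 : H.1 * H.1 ≤ L ^ 4 := by
      calc H.1 * H.1 ≤ (L * L) * (L * L) := Nat.mul_le_mul hHN hHN
        _ = _ := by ring
    have l1 : 1 ≤ L ^ 5 := Nat.one_le_pow _ _ hL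
    have l2 : L ^ 4 ≤ L ^ 5 := Nat.pow_le_pow_right hL (by decide)
    have l3 : L ^ 2 ≤ L ^ 5 := Nat.pow_le_pow_right hL (by decide)
    have l4 : L ≤ L ^ 5 := Nat.le_self_pow (by decide) L
    have l5 : L * L = L ^ 2 := (sq L).symm
    omega
  have hword : s₁.word 1 (s₁.reg 4) = encodeDigraph T := by
    have h4 : s₁.reg 4 = s.reg 4 := hf₁.1 4 rfl
    have hl : s.reg 4 = (encodeDigraph T).length := by rw [← hw, Mem.length_word]
    rw [← s₁.take_word 1 (j := s₁.reg 4) (l := s₁.reg 20), h₁, h4, hl, List.take_left]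
    rw [h4, hl, length_encodeDigraph, hlen]
    omega
  have hpr : s₁.reg p = s.reg p := by
    refine hf₁.1 p ?_
    simp only [List.mem_cons, List.not_mem_nil, or_false] at hp
    rcases hp with rfl | rfl <;> rfl
  have hqr : s₁.reg q = s.reg q := by
    refine hf₁.1 q ?_
    simp only [List.mem_cons, List.not_mem_nil, or_false] at hq
    rcases hq with rfl | rfl <;> rfl
  have h14' : s₁.reg 14 = signCount k T.1 w % 2 := by rw [hf₁.1 14 rfl, h14]
  rw [wp_ite]
  have e14 : (s₁.setReg 15 (inducedCount T H)).reg 14 = s₁.reg 14 := by simp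
  rw [e14]
  constructor
  · intro hne
    rw [wp_add]
    refine ⟨htime, ?_, ?_⟩
    · rw [← hword]
      simp only [Mem.setReg_reg, hpq.2.2.2.2.2.2.symm, if_false]
      rfl
    · have hodd : Odd (signCount k T.1 w) := Nat.odd_iff.2 (by omega)
      simp only [Mem.setReg_reg, if_true, hpq.1, hpq.2.2.2.1, hpq.2.2.2.2.1, if_false, hpr, hqr,
        sgn, hodd.neg_one_pow]
      push_cast
      ring
  · intro h0
    rw [wp_add]
    refine ⟨htime, ?_, ?_⟩
    · rw [← hword]
      simp only [Mem.setReg_reg, hpq.2.2.2.2.2.1.symm, if_false]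
      rfl
    · have heven : Even (signCount k T.1 w) := Nat.even_iff.2 (by omega)
      simp only [Mem.setReg_reg, if_true, hpq.1.symm, hpq.2.2.2.1, hpq.2.2.2.2.1, if_false, hpr,
        hqr, sgn, heven.neg_one_pow]
      push_cast
      ring

/-! ### The main loops of the reduction -/

/-- The state holds the numbers `k`, `n`, the pattern `T` and the relation `E`, together with the
auxiliary data on which the main loops rely. -/
structure Ready (T : FinDigraph) (k n : ℕ) (E : ℕ → ℕ → Bool) (s : Mem) : Prop where
  reg_one : s.reg 1 = k
  reg_two : s.reg 2 = n
  reg_three : s.reg 3 = T.1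
  reg_five : s.reg 5 = 2 ^ (T.1 * T.1)
  reg_seventeen : s.reg 17 = T.1 * T.1
  arr_five : ∀ u v, u < n → v < n → tbl n (s.arr 5) u v = E u v
  arr_six : ∀ u v, u < n → v < n → tbl n (s.arr 6) u v = zeroRel u v
  word_one : s.word 1 (s.reg 4) = encodeDigraph T

theorem Ready.congr {T : FinDigraph} {k n : ℕ} {E : ℕ → ℕ → Bool} {s s' : Mem}
    (h : Ready T k n E s) (hr : ∀ r ∈ [1, 2, 3, 5, 17], s'.reg r = s.reg r)
    (ha : ∀ A ∈ [5, 6], s'.arr A = s.arr A) (hw : s'.word 1 (s'.reg 4) = encodeDigraph T) :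
    Ready T k n E s' := by
  simp only [List.forall_mem_cons] at hr ha
  obtain ⟨h1, h2, h3, h5, h17, -⟩ := hr
  obtain ⟨a5, a6, -⟩ := ha
  exact ⟨h1.trans h.1, h2.trans h.2, h3.trans h.3, h5.trans h.4, h17.trans h.5,
    by rw [a5]; exact h.6, by rw [a6]; exact h.7, hw⟩

theorem Ready.congr' {T : FinDigraph} {k n : ℕ} {E : ℕ → ℕ → Bool} {s s' : Mem}
    (h : Ready T k n E s) (hr : ∀ r ∈ [1, 2, 3, 4, 5, 17], s'.reg r = s.reg r)
    (ha : ∀ A ∈ [1, 5, 6], s'.arr A = s.arr A) : Ready T k n E s' := by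
  refine h.congr (fun r hr' => hr r ?_) (fun A hA => ha A ?_) ?_
  · simp only [List.mem_cons, List.not_mem_nil, or_false] at hr' ⊢; omega
  · simp only [List.mem_cons, List.not_mem_nil, or_false] at hA ⊢; omega
  · rw [Mem.word_congr (ha 1 (by simp)), hr 4 (by simp), h.word_one]

/-- One round for the table `w` in the register `7`: the signed numbers of copies of the pattern
in the two host tournaments are added to the differences of registers `8`, `9` and `10`, `11`. -/
def roundP : Prog :=
  .seq (decodeP 3 7 17) (.seq signP (.seq (askP 5 8 9) (askP 6 10 11)))

theorem tbl_of_decode {m w : ℕ} {f : ℕ → ℕ}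
    (h : ∀ i < m * m, f i = (w.testBit i).toNat) (a b : ℕ) (ha : a < m) (hb : b < m) :
    tbl m f a b = bitT m w a b := by
  unfold tbl bitT
  rw [h _ (pos_lt ha hb)]
  cases w.testBit (a * m + b) <;> rfl

theorem wp_roundP {𝒯 : Set FinDigraph} {T : FinDigraph} (hT : T ∈ 𝒯) {k n b L : ℕ}
    (hb : T.1 ≤ b) {Q E : ℕ → ℕ → Bool} {s : Mem} (hs : Ready T k n E s)
    (hQ : ∀ x y, x < T.1 → y < T.1 → tbl T.1 (s.arr 2) x y = Q x y)
    (hmL : T.1 ≤ L) (hnL : n ≤ L) (hL : 1 ≤ L) :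
    wp ((indSubTo 𝒯).oracle b) roundP (fun s' t => t ≤ 800 * L ^ 5 ∧ Ready T k n E s' ∧
      (s'.reg 8 : ℤ) - s'.reg 9 = (s.reg 8 : ℤ) - s.reg 9 + sgn k T.1 (s.reg 7) *
        inducedCount T (hostDigraph T.1 n k Q (bitT T.1 (s.reg 7)) E) ∧
      (s'.reg 10 : ℤ) - s'.reg 11 = (s.reg 10 : ℤ) - s.reg 11 + sgn k T.1 (s.reg 7) *
        inducedCount T (hostDigraph T.1 n k Q (bitT T.1 (s.reg 7)) zeroRel)) s := by
  rw [roundP, wp_seq]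
  refine (wp_decodeP (by decide) (by decide)).frame.mono ?_
  rintro s₁ t₁ ⟨⟨ht₁, h₁⟩, hf₁⟩
  rw [hs.reg_seventeen] at h₁ ht₁
  have hs₁ : Ready T k n E s₁ := by
    refine hs.congr' ?_ ?_
    · simp only [List.forall_mem_cons]
      exact ⟨hf₁.1 _ rfl, hf₁.1 _ rfl, hf₁.1 _ rfl, hf₁.1 _ rfl, hf₁.1 _ rfl, hf₁.1 _ rfl, by simp⟩
    · simp only [List.forall_mem_cons]
      exact ⟨hf₁.2 _ rfl, hf₁.2 _ rfl, hf₁.2 _ rfl, by simp⟩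
  rw [wp_seq]
  refine (wp_signP hs₁.reg_one hs₁.reg_three hmL hL).frame.mono ?_
  rintro s₂ t₂ ⟨⟨ht₂, h₂⟩, hf₂⟩
  have hW := tbl_of_decode h₁
  have h14 : s₂.reg 14 = signCount k T.1 (s.reg 7) % 2 := by
    rw [h₂, signCount]
    congr 1
    refine Finset.sum_congr rfl fun x hx => Finset.sum_congr rfl fun y hy => ?_
    rw [hW x y (Finset.mem_range.1 hx) (Finset.mem_range.1 hy)]
  have hs₂ : Ready T k n E s₂ := by
    refine hs₁.congr' ?_ ?_
    · simp only [List.forall_mem_cons]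
      exact ⟨hf₂.1 _ rfl, hf₂.1 _ rfl, hf₂.1 _ rfl, hf₂.1 _ rfl, hf₂.1 _ rfl, hf₂.1 _ rfl, by simp⟩
    · simp only [List.forall_mem_cons]
      exact ⟨hf₂.2 _ rfl, hf₂.2 _ rfl, hf₂.2 _ rfl, by simp⟩
  have hQ₂ : ∀ x y, x < T.1 → y < T.1 → tbl T.1 (s₂.arr 2) x y = Q x y := by
    rw [hf₂.2 2 rfl, hf₁.2 2 rfl]; exact hQ
  have hW₂ : ∀ x y, x < T.1 → y < T.1 → tbl T.1 (s₂.arr 3) x y = bitT T.1 (s.reg 7) x y := by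
    rw [hf₂.2 3 rfl]; exact hW
  rw [wp_seq]
  refine (wp_askP hT hb (by decide) (by simp) (by simp) hs₂.reg_one hs₂.reg_two hs₂.reg_three
    hs₂.word_one hQ₂ hW₂ hs₂.arr_five h14 hmL hnL hL).frame.mono ?_
  rintro s₃ t₃ ⟨⟨ht₃, hw₃, h₃⟩, hf₃⟩
  have hs₃ : Ready T k n E s₃ := by
    refine hs₂.congr ?_ ?_ hw₃
    · simp only [List.forall_mem_cons]
      exact ⟨hf₃.1 _ rfl, hf₃.1 _ rfl, hf₃.1 _ rfl, hf₃.1 _ rfl, hf₃.1 _ rfl, by simp⟩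
    · simp only [List.forall_mem_cons]
      exact ⟨hf₃.2 _ rfl, hf₃.2 _ rfl, by simp⟩
  refine (wp_askP hT hb (by decide) (by simp) (by simp) hs₃.reg_one hs₃.reg_two hs₃.reg_three
    hs₃.word_one (by rw [hf₃.2 2 rfl]; exact hQ₂) (by rw [hf₃.2 3 rfl]; exact hW₂) hs₃.arr_six
    (by rw [hf₃.1 14 rfl]; exact h14) hmL hnL hL).frame.mono ?_
  rintro s₄ t₄ ⟨⟨ht₄, hw₄, h₄⟩, hf₄⟩
  refine ⟨?_, ?_, ?_, ?_⟩
  · have h1 : T.1 * T.1 ≤ L ^ 2 := by rw [sq]; exact Nat.mul_le_mul hmL hmL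
    have l1 : 1 ≤ L ^ 5 := Nat.one_le_pow _ _ hL
    have l2 : L ^ 3 ≤ L ^ 5 := Nat.pow_le_pow_right hL (by decide)
    have l3 : L ^ 2 ≤ L ^ 5 := Nat.pow_le_pow_right hL (by decide)
    omega
  · refine hs₃.congr ?_ ?_ hw₄
    · simp only [List.forall_mem_cons]
      exact ⟨hf₄.1 _ rfl, hf₄.1 _ rfl, hf₄.1 _ rfl, hf₄.1 _ rfl, hf₄.1 _ rfl, by simp⟩
    · simp only [List.forall_mem_cons]
      exact ⟨hf₄.2 _ rfl, hf₄.2 _ rfl, by simp⟩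
  · rw [hf₄.1 8 rfl, hf₄.1 9 rfl, h₃, hf₂.1 8 rfl, hf₂.1 9 rfl, hf₁.1 8 rfl, hf₁.1 9 rfl]
  · rw [h₄, hf₃.1 10 rfl, hf₃.1 11 rfl, hf₂.1 10 rfl, hf₂.1 11 rfl, hf₁.1 10 rfl, hf₁.1 11 rfl]

/-- `d := |a - b|`, with a scratch register `c`. -/
def distP (d a b c : ℕ) : Prog := .seq (.sub d a b) (.seq (.sub c b a) (.add d d c))

/-- The round for the table `c` in the register `6`: if the sum for the trivial relation is
nonzero, then the absolute values of the two sums are stored in the registers `12` and `13`. -/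
def innerP : Prog :=
  .seq (decodeP 2 6 17) (.seq (.const 8 0) (.seq (.const 9 0) (.seq (.const 10 0)
    (.seq (.const 11 0) (.seq (forP 7 5 46 roundP) (.seq (distP 47 8 9 49)
      (.seq (distP 48 10 11 49) (.ite 48 (.seq (copyP 12 47) (copyP 13 48)) (.const 47 0)))))))))

theorem wp_innerP {𝒯 : Set FinDigraph} {T : FinDigraph} (hT : T ∈ 𝒯) {k n b L : ℕ}
    (hb : T.1 ≤ b) {E : ℕ → ℕ → Bool} {s : Mem} (hs : Ready T k n E s)
    (hBL : 2 ^ (T.1 * T.1) ≤ L) (hmL : T.1 * T.1 ≤ L) (hnL : n ≤ L) (hL : 1 ≤ L) :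
    wp ((indSubTo 𝒯).oracle b) innerP (fun s' t => t ≤ 900 * L ^ 6 ∧ Ready T k n E s' ∧
      (hostSum T.2 k n (bitT T.1 (s.reg 6)) zeroRel = 0 →
        s'.reg 12 = s.reg 12 ∧ s'.reg 13 = s.reg 13) ∧
      (hostSum T.2 k n (bitT T.1 (s.reg 6)) zeroRel ≠ 0 →
        s'.reg 12 = (hostSum T.2 k n (bitT T.1 (s.reg 6)) E).natAbs ∧
        s'.reg 13 = (hostSum T.2 k n (bitT T.1 (s.reg 6)) zeroRel).natAbs)) s := by
  have hmL' : T.1 ≤ L := (Nat.le_mul_self _).trans hmL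
  rw [innerP, wp_seq]
  refine (wp_decodeP (by decide) (by decide)).frame.mono ?_
  rintro s₁ t₁ ⟨⟨ht₁, h₁⟩, hf₁⟩
  rw [hs.reg_seventeen] at h₁ ht₁
  have hs₁ : Ready T k n E s₁ := by
    refine hs.congr' ?_ ?_
    · simp only [List.forall_mem_cons]
      exact ⟨hf₁.1 _ rfl, hf₁.1 _ rfl, hf₁.1 _ rfl, hf₁.1 _ rfl, hf₁.1 _ rfl, hf₁.1 _ rfl, by simp⟩
    · simp only [List.forall_mem_cons]
      exact ⟨hf₁.2 _ rfl, hf₁.2 _ rfl, hf₁.2 _ rfl, by simp⟩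
  have hQ := tbl_of_decode h₁
  simp only [wp_seq, wp_const]
  set Q := bitT T.1 (s.reg 6) with hQd
  set s₂ := (((s₁.setReg 8 0).setReg 9 0).setReg 10 0).setReg 11 0 with hs₂
  refine (wp_forP (fun j s' => Ready T k n E s' ∧ s'.arr 2 = s₁.arr 2 ∧
    (s'.reg 8 : ℤ) - s'.reg 9 = ∑ w ∈ Finset.range j, sgn k T.1 w *
      inducedCount T (hostDigraph T.1 n k Q (bitT T.1 w) E) ∧
    (s'.reg 10 : ℤ) - s'.reg 11 = ∑ w ∈ Finset.range j, sgn k T.1 w *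
      inducedCount T (hostDigraph T.1 n k Q (bitT T.1 w) zeroRel))
    (800 * L ^ 5) (2 ^ (T.1 * T.1)) (by decide) (by decide) (by decide) rfl rfl ?_ ?_ ?_
    ?_).frame.mono ?_
  · rintro j s s' hr ha ⟨h1, h2, h3, h4⟩
    refine ⟨h1.congr' (fun r hr' => hr r ?_ ?_) (fun A _ => by rw [ha]), by rw [ha, h2], ?_, ?_⟩
    · rintro rfl; simp at hr'
    · rintro rfl; simp at hr'
    · rw [hr 8 (by decide) (by decide), hr 9 (by decide) (by decide), h3]
    · rw [hr 10 (by decide) (by decide), hr 11 (by decide) (by decide), h4]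
  · simpa [hs₂] using hs₁.reg_five
  · refine ⟨hs₁.congr' (fun r hr => ?_) fun A _ => rfl, rfl, by simp [hs₂], by simp [hs₂]⟩
    simp only [List.mem_cons, List.not_mem_nil, or_false] at hr
    simp only [hs₂, Mem.setReg_reg]
    rw [if_neg (by omega), if_neg (by omega), if_neg (by omega), if_neg (by omega)]
  · rintro j hj s₃ ⟨hs₃, ha₃, h3, h3'⟩ hj₃ hF₃
    refine (wp_roundP hT hb hs₃ (Q := Q) (by rw [ha₃]; exact hQ) hmL' hnL hL).frame.mono ?_
    rintro s₄ t₄ ⟨⟨ht₄, hs₄, h4, h4'⟩, hf₄⟩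
    refine ⟨ht₄, hs₄, (hf₄.2 2 rfl).trans ha₃, ?_, ?_⟩
    · rw [h4, h3, Finset.sum_range_succ, hj₃]
    · rw [h4', h3', Finset.sum_range_succ, hj₃]
  · rintro s₃ t₃ ⟨⟨ht₃, hs₃, -, h3, h3'⟩, hf₃⟩
    rw [← hostSum_eq_sum_inducedCount T.2] at h3 h3'
    have e12 : s₃.reg 12 = s.reg 12 := by
      rw [hf₃.1 12 rfl]; simp only [hs₂, Mem.setReg_reg]; exact hf₁.1 12 rfl
    have e13 : s₃.reg 13 = s.reg 13 := by
      rw [hf₃.1 13 rfl]; simp only [hs₂, Mem.setReg_reg]; exact hf₁.1 13 rfl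
    simp only [distP, wp_seq, wp_sub, wp_add]
    have htime : t₁ + (1 + (1 + (1 + (1 + (t₃ + 20))))) ≤ 900 * L ^ 6 := by
      have h1 : 2 ^ (T.1 * T.1) * (800 * L ^ 5 + 4) ≤ 804 * L ^ 6 := by
        have : 1 ≤ L ^ 5 := Nat.one_le_pow _ _ hL
        calc 2 ^ (T.1 * T.1) * (800 * L ^ 5 + 4) ≤ L * (804 * L ^ 5) :=
              Nat.mul_le_mul hBL (by omega)
          _ = _ := by ring
      have l1 : 1 ≤ L ^ 6 := Nat.one_le_pow _ _ hL
      have l2 : L ≤ L ^ 6 := Nat.le_self_pow (by decide) L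
      omega
    have hready : ∀ s' : Mem, (∀ r < 47, r ≠ 12 → r ≠ 13 → s'.reg r = s₃.reg r) →
        s'.arr = s₃.arr → Ready T k n E s' := by
      intro s' hr ha
      refine hs₃.congr' (fun r hr' => ?_) fun A _ => by rw [ha]
      simp only [List.mem_cons, List.not_mem_nil, or_false] at hr'
      exact hr r (by omega) (by omega) (by omega)
    rw [wp_ite]
    simp only [Mem.setReg_reg, Nat.reduceEqDiff, if_false, if_true]
    constructor
    · intro hne
      rw [wp_seq, wp_copyP (by decide), wp_copyP (by decide)]
      refine ⟨by omega, hready _ ?_ rfl, fun h0 => ?_, fun _ => ⟨?_, ?_⟩⟩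
      · intro r hr h12 h13
        simp [h12, h13, show r ≠ 47 by omega, show r ≠ 48 by omega, show r ≠ 49 by omega]
      · omega
      · simp only [Mem.setReg_reg, Nat.reduceEqDiff, if_false, if_true]
        rw [← h3]
        omega
      · simp only [Mem.setReg_reg, Nat.reduceEqDiff, if_false, if_true]
        rw [← h3']
        omega
    · intro h0
      rw [wp_const]
      refine ⟨by omega, hready _ ?_ rfl, fun _ => ⟨?_, ?_⟩, fun hne => ?_⟩
      · intro r hr h12 h13
        simp [show r ≠ 47 by omega, show r ≠ 48 by omega, show r ≠ 49 by omega]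
      · simpa using e12
      · simpa using e13
      · omega

/-- Leaves in the registers `12` and `13` two numbers whose quotient is the number of cliques,
unless the register `13` is zero. -/
def outerP : Prog := .seq (.const 12 0) (.seq (.const 13 0) (forP 6 5 50 innerP))

/-- The hypothesis `hcl` holds with the number of cliques as `cl`, whence the same quotient is found
for every table `c` with a nonzero denominator. -/
theorem wp_outerP {𝒯 : Set FinDigraph} {T : FinDigraph} (hT : T ∈ 𝒯) {k n b L cl : ℕ}
    (hb : T.1 ≤ b) {E : ℕ → ℕ → Bool} {s : Mem} (hs : Ready T k n E s)
    (hBL : 2 ^ (T.1 * T.1) ≤ L) (hmL : T.1 * T.1 ≤ L) (hnL : n ≤ L) (hL : 1 ≤ L)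
    (hcl : ∀ Q, hostSum T.2 k n Q E = hostSum T.2 k n Q zeroRel * cl) :
    wp ((indSubTo 𝒯).oracle b) outerP (fun s' t => t ≤ 1000 * L ^ 7 ∧
      s'.reg 12 = s'.reg 13 * cl ∧
      ((∃ c < 2 ^ (T.1 * T.1), hostSum T.2 k n (bitT T.1 c) zeroRel ≠ 0) → s'.reg 13 ≠ 0)) s := by
  rw [outerP, wp_seq, wp_const, wp_seq, wp_const]
  refine (wp_forP (fun j s' => Ready T k n E s' ∧ s'.reg 12 = s'.reg 13 * cl ∧
    ((∃ c < j, hostSum T.2 k n (bitT T.1 c) zeroRel ≠ 0) → s'.reg 13 ≠ 0))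
    (900 * L ^ 6) (2 ^ (T.1 * T.1)) (by decide) (by decide) (by decide) rfl rfl ?_ ?_ ?_
    ?_).mono ?_
  · rintro j s s' hr ha ⟨h1, h2, h3⟩
    refine ⟨h1.congr' (fun r hr' => hr r ?_ ?_) (fun A _ => by rw [ha]), ?_, ?_⟩
    · rintro rfl; simp at hr'
    · rintro rfl; simp at hr'
    · rw [hr 12 (by decide) (by decide), hr 13 (by decide) (by decide), h2]
    · rw [hr 13 (by decide) (by decide)]; exact h3
  · simpa using hs.reg_five
  · refine ⟨hs.congr' (fun r hr => ?_) fun A _ => rfl, by simp, by simp⟩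
    simp only [List.mem_cons, List.not_mem_nil, or_false] at hr
    simp only [Mem.setReg_reg]
    rw [if_neg (by omega), if_neg (by omega)]
  · rintro j hj s₁ ⟨hs₁, h1, h1'⟩ hj₁ -
    refine (wp_innerP hT hb hs₁ hBL hmL hnL hL).mono ?_
    rintro s₂ t₂ ⟨ht₂, hs₂, h2, h2'⟩
    rw [hj₁] at h2 h2'
    refine ⟨ht₂, hs₂, ?_⟩
    by_cases h0 : hostSum T.2 k n (bitT T.1 j) zeroRel = 0
    · obtain ⟨e1, e2⟩ := h2 h0
      refine ⟨by rw [e1, e2, h1], ?_⟩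
      rintro ⟨c, hc, hne⟩
      rw [e2]
      refine h1' ⟨c, ?_, hne⟩
      rcases Nat.lt_succ_iff_lt_or_eq.1 hc with h | rfl
      · exact h
      · exact absurd h0 hne
    · obtain ⟨e1, e2⟩ := h2' h0
      refine ⟨by rw [e1, e2, hcl, Int.natAbs_mul, Int.natAbs_natCast], fun _ => ?_⟩
      rw [e2]
      exact Int.natAbs_ne_zero.2 h0
  · rintro s₁ t₁ ⟨ht₁, -, h1, h1'⟩
    refine ⟨?_, h1, h1'⟩
    have h1 : 2 ^ (T.1 * T.1) * (900 * L ^ 6 + 4) ≤ 904 * L ^ 7 := by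
      have : 1 ≤ L ^ 6 := Nat.one_le_pow _ _ hL
      calc 2 ^ (T.1 * T.1) * (900 * L ^ 6 + 4) ≤ L * (904 * L ^ 6) :=
            Nat.mul_le_mul hBL (by omega)
        _ = _ := by ring
    have l1 : 1 ≤ L ^ 7 := Nat.one_le_pow _ _ hL
    omega

/-- Into the register `0`, the quotient of the registers `12` and `13`, which is less than
`2 ^ (n + 1)`, where `n` is in the register `2`.  This is long division in base two: the array `7`
is filled with the products of the divisor and the powers of two, which are then subtracted in
decreasing order as long as this is possible. -/
def divP : Prog :=
  .seq (.const 51 1) (.seq (copyP 52 13) (.seq (.add 53 2 51)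
    (.seq (forP 41 53 42 (.seq (.store 7 41 52) (.add 52 52 52))) (.seq (.const 0 0)
      (forP 41 53 42 (.seq (.sub 54 2 41) (.seq (.load 55 7 54) (.seq (.add 0 0 0)
        (.seq (.add 56 12 51) (.seq (.sub 56 56 55) (.ite 56
          (.seq (.sub 12 12 55) (.add 0 0 51)) (.const 56 0))))))))))))

theorem wp_divP {O : List Bool → ℕ → Prop} {s : Mem} {D q n : ℕ} (hn : s.reg 2 = n)
    (hD : s.reg 13 = D) (hD0 : D ≠ 0) (hX : s.reg 12 = D * q) (hq : q < 2 ^ (n + 1)) :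
    wp O divP (fun s' t => t ≤ 20 * n + 40 ∧ s'.reg 0 = q) s := by
  rw [divP, wp_seq, wp_const, wp_seq, wp_copyP (by decide), wp_seq, wp_add, wp_seq]
  refine (wp_forP (fun j s' => s'.reg 52 = D * 2 ^ j ∧ ∀ i < j, s'.arr 7 i = D * 2 ^ i)
    2 (n + 1) (by decide) (by decide) (by decide) rfl rfl ?_ ?_ ?_ ?_).frame.mono ?_
  · rintro j s s' hr ha ⟨h1, h2⟩
    exact ⟨by rw [hr 52 (by decide) (by decide), h1], by rw [ha]; exact h2⟩
  · simp [hn]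
  · simp [hD]
  · rintro j hj s₁ ⟨h1, h1'⟩ hj₁ -
    rw [wp_seq, wp_store, wp_add]
    refine ⟨le_rfl, ?_, ?_⟩
    · simp [h1, pow_succ]; ring
    · intro i hi
      simp only [Mem.setReg_arr, Mem.setArr_arr, hj₁, true_and, h1]
      split_ifs with h
      · rw [h]
      · exact h1' i (by omega)
  rintro s₁ t₁ ⟨⟨ht₁, -, h₁⟩, hf₁⟩
  rw [wp_seq, wp_const]
  have e2 : s₁.reg 2 = n := by rw [hf₁.1 2 rfl]; simpa using hn
  have e12 : s₁.reg 12 = D * q := by rw [hf₁.1 12 rfl]; simpa using hX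
  have e51 : s₁.reg 51 = 1 := by rw [hf₁.1 51 rfl]; simp
  have e53 : s₁.reg 53 = n + 1 := by rw [hf₁.1 53 rfl]; simp [hn]
  refine (wp_forP (fun j s' => s'.reg 12 = D * (q % 2 ^ (n + 1 - j)) ∧
    s'.reg 0 = q / 2 ^ (n + 1 - j)) 8 (n + 1) (by decide) (by decide) (by decide) rfl rfl
    ?_ ?_ ?_ ?_).mono ?_
  · rintro j s s' hr ha ⟨h1, h2⟩
    exact ⟨by rw [hr 12 (by decide) (by decide), h1], by rw [hr 0 (by decide) (by decide), h2]⟩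
  · simpa using e53
  · simp [e12, Nat.mod_eq_of_lt hq, Nat.div_eq_of_lt hq]
  · rintro j hj s₂ ⟨h2, h2'⟩ hj₂ hF₂
    have f2 : s₂.reg 2 = n := by rw [hF₂.1 2 rfl]; simpa using e2
    have f51 : s₂.reg 51 = 1 := by rw [hF₂.1 51 rfl]; simpa using e51
    have f7 : s₂.arr 7 (n - j) = D * 2 ^ (n - j) := by
      rw [hF₂.2 7 rfl]; exact h₁ _ (by omega)
    -- Position `n - j`: the dividend has been reduced modulo `D * (P * 2)`.
    have hexp : n + 1 - j = (n - j) + 1 := by omega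
    have hexp' : n + 1 - (j + 1) = n - j := by omega
    rw [hexp] at h2 h2'
    rw [hexp']
    set P := 2 ^ (n - j) with hP
    have hP0 : 0 < P := by positivity
    rw [pow_succ, ← hP] at h2 h2'
    have hmod : q % (P * 2) = q % P + P * (q / P % 2) := Nat.mod_mul
    have hdiv : q / (P * 2) = q / P / 2 := (Nat.div_div_eq_div_mul _ _ _).symm
    rw [hmod] at h2
    rw [hdiv] at h2'
    simp only [wp_seq, wp_sub, wp_load, wp_add]
    rw [wp_ite]
    simp only [Mem.setReg_reg, Mem.setReg_arr, Nat.reduceEqDiff, if_false, if_true, hj₂, f2, f51,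
      f7, OfNat.zero_ne_ofNat, OfNat.ofNat_ne_zero]
    have hlt : D * (q % P) < D * P := Nat.mul_lt_mul_of_pos_left (Nat.mod_lt _ hP0) (by omega)
    rcases Nat.mod_two_eq_zero_or_one (q / P) with hbit | hbit
    · rw [hbit, mul_zero, add_zero] at h2
      constructor
      · intro hne
        omega
      · intro _
        rw [wp_const]
        refine ⟨by omega, by simpa using h2, ?_⟩
        simp [h2']
        omega
    · rw [hbit, mul_one, mul_add] at h2
      constructor
      · intro _
        rw [wp_seq, wp_sub, wp_add]
        refine ⟨by omega, ?_, ?_⟩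
        · simp [h2]
        · simp [h2', f51]
          omega
      · intro h0
        omega
  · rintro s' t ⟨ht, -, h⟩
    refine ⟨by omega, ?_⟩
    simpa using h

/-! ### Reading the input and searching for a pattern -/

/-- Reads a number in unary from the array `0`, from the position in the register `p` on, into the
register `d`, and moves the position behind the end marker. -/
def unaryP (d p : ℕ) : Prog :=
  .seq (.const d 0) (.seq (.load 40 0 p) (.seq
    (.loop 40 (.seq (.const 41 1) (.seq (.add d d 41) (.seq (.add p p 41) (.load 40 0 p)))))
    (.seq (.const 41 1) (.add p p 41))))

theorem wp_unaryP {O : List Bool → ℕ → Prop} {d p a N : ℕ} {s : Mem} (hdp : d ≠ p)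
    (hd : d < 40) (hp : p ≠ 40 ∧ p ≠ 41) (ha : s.reg p = a)
    (h1 : ∀ i < N, s.arr 0 (a + i) ≠ 0) (h0 : s.arr 0 (a + N) = 0) :
    wp O (unaryP d p) (fun s' t => t ≤ 5 * N + 5 ∧ s'.reg d = N ∧ s'.reg p = a + N + 1) s := by
  have hd' : d ≠ 40 ∧ d ≠ 41 ∧ 40 ≠ d ∧ 41 ≠ d := by omega
  simp only [unaryP, wp_seq, wp_const, wp_load]
  refine (wp_loop N (fun j s' => s'.reg d = j ∧ s'.reg p = a + j ∧ s'.reg 40 = s.arr 0 (a + j) ∧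
    s'.arr = s.arr) (fun _ => 4) ?_ ?_ ?_).mono ?_
  · rintro j hj s₁ ⟨e1, e2, e3, e4⟩
    refine ⟨by rw [e3]; exact h1 j hj, ?_⟩
    simp only [wp_seq, wp_const, wp_load, wp_add]
    refine ⟨le_rfl, ?_, ?_, ?_, ?_⟩
    · simp [hd', hdp, e1]
    · simp [hp, hd', Ne.symm hdp, e2, add_assoc]
    · simp [hp, hd', Ne.symm hdp, e2, e4, add_assoc]
    · simpa using e4
  · rintro s₁ ⟨-, -, e3, -⟩
    rw [e3, h0]
  · refine ⟨?_, ?_, ?_, rfl⟩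
    · simp [hd']
    · simp [hp, Ne.symm hdp, ha]
    · simp [Ne.symm hdp, ha]
  · rintro s₁ t₁ ⟨ht₁, e1, e2, -⟩
    simp only [Finset.sum_const, Finset.card_range, smul_eq_mul] at ht₁
    rw [wp_add]
    refine ⟨by omega, ?_, ?_⟩
    · simp [hd', hdp, e1]
    · simp [hp, e2]

/-- Copies the entries above the diagonal of the matrix of order given by the register `2`, which
is stored in the array `0` from the position in the register `42` on, to the array `5`. -/
def fillP : Prog :=
  forP 21 2 25 (forP 22 2 26 (.seq (mulP 35 21 2 36 37) (.seq (.add 35 35 22)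
    (.seq (.add 39 42 35) (.seq (.load 34 0 39) (.seq (.sub 38 22 21)
      (.seq (.ite 38 (.const 37 0) (.const 34 0)) (.store 5 35 34))))))))

theorem wp_fillP {O : List Bool → ℕ → Prop} {s : Mem} {n a : ℕ} (hn : s.reg 2 = n)
    (ha : s.reg 42 = a) :
    wp O fillP (fun s' t => t ≤ n * (n * (5 * n + 16) + 7) + 3 ∧
      ∀ u v, u < n → v < n →
        tbl n (s'.arr 5) u v = (decide (u < v) && s.arr 0 (a + (u * n + v)) != 0)) s := by
  rw [fillP]
  refine (wp_forP (fun i s' => ∀ u v, u < i → v < n →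
    tbl n (s'.arr 5) u v = (decide (u < v) && s.arr 0 (a + (u * n + v)) != 0))
    (n * (5 * n + 16) + 3) n (by decide) (by decide) (by decide) rfl rfl ?_ hn ?_ ?_).mono ?_
  · intro i s₁ s₂ _ h hI
    rw [h]; exact hI
  · intro u v hu
    omega
  · intro i hi s₁ hI hi₁ hF₁
    refine (wp_forP (fun j s' => ∀ u v, u < n → v < n → (u < i ∨ u = i ∧ v < j) →
      tbl n (s'.arr 5) u v = (decide (u < v) && s.arr 0 (a + (u * n + v)) != 0))
      (5 * n + 12) n (by decide) (by decide) (by decide) rfl rfl ?_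
      (by rw [hF₁.1 2 rfl, hn]) ?_ ?_).mono ?_
    · intro i s₁ s₂ _ h hI
      rw [h]; exact hI
    · intro u v hu hv h
      exact hI u v (by omega) hv
    · intro j hj s₂ hI₂ hj₂ hF₂
      have e2 : s₂.reg 2 = n := by rw [hF₂.1 2 rfl, hF₁.1 2 rfl, hn]
      have e21 : s₂.reg 21 = i := by rw [hF₂.1 21 rfl, hi₁]
      have e42 : s₂.reg 42 = a := by rw [hF₂.1 42 rfl, hF₁.1 42 rfl, ha]
      have eA : s₂.arr 0 = s.arr 0 := by rw [hF₂.2 0 rfl, hF₁.2 0 rfl]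
      rw [wp_seq]
      refine (wp_mulP (by decide) (by decide) (by decide) (by decide)).frame.mono ?_
      rintro s₃ t₃ ⟨⟨ht₃, h₃⟩, hf₃⟩
      rw [e2, e21] at h₃
      rw [e2] at ht₃
      have e22 : s₃.reg 22 = j := by rw [hf₃.1 22 rfl, hj₂]
      have e21' : s₃.reg 21 = i := by rw [hf₃.1 21 rfl, e21]
      have e42' : s₃.reg 42 = a := by rw [hf₃.1 42 rfl, e42]
      have eA' : s₃.arr 0 = s.arr 0 := by rw [hf₃.2 0 rfl, eA]
      have eA5 : s₃.arr 5 = s₂.arr 5 := hf₃.2 5 rfl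
      have hmain : ∀ x : ℕ, (x != 0) = (decide (i < j) && s.arr 0 (a + (i * n + j)) != 0) →
          ∀ s₄ : Mem, s₄.arr = s₃.arr →
          ∀ u v, u < n → v < n → (u < i ∨ u = i ∧ v < j + 1) →
          tbl n ((s₄.setArr 5 (i * n + j) x).arr 5) u v =
            (decide (u < v) && s.arr 0 (a + (u * n + v)) != 0) := by
        intro x hx s₄ hs₄ u v hu hv huv
        unfold tbl
        simp only [Mem.setArr_arr, true_and]
        split_ifs with h
        · obtain ⟨rfl, rfl⟩ := pos_injective hv hj h
          exact hx
        · rw [hs₄, eA5]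
          refine hI₂ u v hu hv ?_
          rcases huv with h' | ⟨rfl, h'⟩
          · exact .inl h'
          · exact .inr ⟨rfl, by
              rcases Nat.lt_succ_iff_lt_or_eq.1 h' with h'' | rfl
              · exact h''
              · exact absurd rfl h⟩
      simp only [wp_seq, wp_add, wp_load, wp_sub]
      rw [wp_ite]
      simp only [Mem.setReg_reg, Mem.setReg_arr, Nat.reduceEqDiff, if_false, if_true, e22, e21',
        e42', eA', h₃]
      constructor
      · intro hne
        have hij : i < j := by omega
        rw [wp_const, wp_store]
        refine ⟨by omega, ?_⟩
        simp only [Mem.setReg_reg, Nat.reduceEqDiff, if_false, if_true, h₃]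
        exact hmain _ (by simp [hij]) _ rfl
      · intro h0
        have hij : ¬ i < j := by omega
        rw [wp_const, wp_store]
        refine ⟨by omega, ?_⟩
        simp only [Mem.setReg_reg, Nat.reduceEqDiff, if_false, if_true, h₃]
        exact hmain _ (by simp [hij]) _ rfl
    · rintro s' t ⟨ht, h⟩
      refine ⟨ht, fun u v hu hv => h u v (by omega) hv (by omega)⟩
  · rintro s' t ⟨ht, h⟩
    exact ⟨by omega, h⟩

/-- Reads a number and a graph into the registers `1`, `2` and the array `5`, and prepares the
array `6`. -/
def parseP : Prog :=
  .seq (.const 42 0) (.seq (unaryP 1 42) (.seq (unaryP 2 42) (.seq fillP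
    (.seq (.const 39 0) (.seq (.const 40 1) (.store 6 39 40))))))

theorem wp_parseP {O : List Bool → ℕ → Prop} {k n : ℕ} (G : SimpleGraph (Fin n)) :
    wp O parseP (fun s' t => t ≤ 100 * ((countClique.enc (k, ⟨n, G⟩)).length + 1) ^ 3 ∧
      s'.reg 1 = k ∧ s'.reg 2 = n ∧
      (∀ u v, u < n → v < n → tbl n (s'.arr 5) u v = upAdj G u v) ∧
      (∀ u v, u < n → v < n → tbl n (s'.arr 6) u v = zeroRel u v))
      (Mem.init (countClique.enc (k, ⟨n, G⟩))) := by
  classical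
  set w := countClique.enc (k, ⟨n, G⟩) with hw
  have hw' : w = unaryThen k (unaryThen n (adjBits G.Adj)) := rfl
  have hlen : w.length = k + 1 + (n + 1 + n * n) := by
    rw [hw', length_unaryThen, length_unaryThen, length_adjBits]
  have harr : ∀ i, (Mem.init w).arr 0 i = (w.getD i false).toNat := fun i => by simp [Mem.init]
  have harr6 : ∀ i, (Mem.init w).arr 6 i = 0 := fun i => by simp [Mem.init]
  have hk1 : ∀ i < k, (Mem.init w).arr 0 i = 1 := fun i hi => by
    rw [harr, hw', getD_unaryThen_lt _ hi]; rfl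
  have hk0 : (Mem.init w).arr 0 k = 0 := by
    rw [harr, hw', getD_unaryThen_self]; rfl
  have hn1 : ∀ i < n, (Mem.init w).arr 0 (k + 1 + i) = 1 := fun i hi => by
    rw [harr, hw', getD_unaryThen_add, getD_unaryThen_lt _ hi]; rfl
  have hn0 : (Mem.init w).arr 0 (k + 1 + n) = 0 := by
    rw [harr, hw', getD_unaryThen_add, getD_unaryThen_self]; rfl
  have hE : ∀ u v (hu : u < n) (hv : v < n), (Mem.init w).arr 0 (k + 1 + (n + 1) + (u * n + v)) =
      (decide (G.Adj ⟨u, hu⟩ ⟨v, hv⟩)).toNat := fun u v hu hv => by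
    rw [harr, hw', add_assoc (k + 1), getD_unaryThen_add, getD_unaryThen_add]
    have := getD_adjBits G.Adj [] hu hv
    rw [List.append_nil] at this
    rw [this]
  clear_value w
  set s := Mem.init w with hs
  rw [parseP, wp_seq, wp_const, wp_seq]
  refine (wp_unaryP (a := 0) (N := k) (by decide) (by decide) (by decide) (by simp) ?_
    ?_).frame.mono ?_
  · intro i hi
    simp [hk1 i hi]
  · simpa using hk0
  rintro s₁ t₁ ⟨⟨ht₁, e1, e42⟩, hf₁⟩
  have eA₁ : s₁.arr = s.arr := by
    funext A; exact hf₁.2 A rfl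
  rw [wp_seq]
  refine (wp_unaryP (a := k + 1) (N := n) (by decide) (by decide) (by decide) (by simpa using e42)
    ?_ ?_).frame.mono ?_
  · intro i hi
    simp [eA₁, hn1 i hi]
  · simpa [eA₁] using hn0
  rintro s₂ t₂ ⟨⟨ht₂, e2, e42'⟩, hf₂⟩
  have eA₂ : s₂.arr = s.arr := by
    rw [← eA₁]; funext A; exact hf₂.2 A rfl
  rw [wp_seq]
  refine (wp_fillP e2 e42').frame.mono ?_
  rintro s₃ t₃ ⟨⟨ht₃, h₃⟩, hf₃⟩
  simp only [wp_seq, wp_const, wp_store]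
  refine ⟨?_, ?_, ?_, ?_, ?_⟩
  · set X := w.length + 1 with hX
    have h1 : n * (5 * n + 16) ≤ 21 * X ^ 2 := by
      calc n * (5 * n + 16) ≤ X * (21 * X) := Nat.mul_le_mul (by omega) (by omega)
        _ = _ := by ring
    have l1 : 1 ≤ X ^ 2 := Nat.one_le_pow _ _ (by omega)
    have h2 : n * (n * (5 * n + 16) + 7) ≤ 28 * X ^ 3 := by
      calc n * (n * (5 * n + 16) + 7) ≤ X * (28 * X ^ 2) := Nat.mul_le_mul (by omega) (by omega)
        _ = _ := by ring
    have l2 : X ≤ X ^ 3 := Nat.le_self_pow (by decide) X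
    omega
  · simp only [Mem.setArr_reg, Mem.setReg_reg, OfNat.one_ne_ofNat, if_false]
    rw [hf₃.1 1 rfl, hf₂.1 1 rfl, e1]
  · simp only [Mem.setArr_reg, Mem.setReg_reg, Nat.reduceEqDiff, if_false]
    rw [hf₃.1 2 rfl, e2]
  · intro u v hu hv
    rw [Mem.setArr_arr_of_ne _ _ _ (by decide)]
    simp only [Mem.setReg_arr]
    rw [h₃ u v hu hv, eA₂, add_assoc (k + 1), hE u v hu hv, Bool.eq_iff_iff]
    have := @upAdj_eq_true n G ⟨u, hu⟩ ⟨v, hv⟩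
    rw [this]
    simp
  · intro u v hu hv
    have h6 : s₃.arr 6 = s.arr 6 := by rw [hf₃.2 6 rfl, eA₂]
    unfold tbl zeroRel
    simp only [Mem.setArr_arr, Mem.setReg_arr, true_and, Mem.setReg_reg, Nat.reduceEqDiff, if_false,
      if_true, h6, harr6]
    rw [Bool.eq_iff_iff]
    have hn : n ≠ 0 := by omega
    simp [hn]

/-- The least number at which the program `pχ` yields zero is left in the register `18`, and the
pattern that it stands for is written to the array `1`. -/
def searchP (pχ pm pl pz : Prog) : Prog :=
  .seq (.const 18 0) (.seq pχ (.seq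
    (.loop 40 (.seq (.const 41 1) (.seq (.add 18 18 41) pχ)))
    (.seq pm (.seq pl (.seq pz (.seq (decodeP 1 16 4) (.seq (mulP 17 3 3 36 37)
      (.seq (.const 5 1) (forP 41 17 42 (.add 5 5 5))))))))))

/-- The programs `pm`, `pl`, `pz` compute the functions `m`, `l`, `z` of the number found. -/
theorem wp_searchP {O : List Bool → ℕ → Prop} {pχ pm pl pz : Prog} {χ : ℕ → ℕ → ℕ}
    {m l z : ℕ → ℕ} {τχ τm τl τz : ℕ → ℕ → ℕ} {μ k : ℕ} {s : Mem}
    (hχ : ∀ r < 100, r ≠ 40 → pχ.wr r = false) (hm : ∀ r < 100, r ≠ 3 → pm.wr r = false)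
    (hl : ∀ r < 100, r ≠ 4 → pl.wr r = false) (hz : ∀ r < 100, r ≠ 16 → pz.wr r = false)
    (wχ : ∀ s, wp O pχ (fun s' t => t ≤ τχ (s.reg 1) (s.reg 18) ∧
      s'.reg 40 = χ (s.reg 1) (s.reg 18)) s)
    (wm : ∀ s, wp O pm (fun s' t => t ≤ τm (s.reg 1) (s.reg 18) ∧ s'.reg 3 = m (s.reg 18)) s)
    (wl : ∀ s, wp O pl (fun s' t => t ≤ τl (s.reg 1) (s.reg 18) ∧ s'.reg 4 = l (s.reg 18)) s)
    (wz : ∀ s, wp O pz (fun s' t => t ≤ τz (s.reg 1) (s.reg 18) ∧ s'.reg 16 = z (s.reg 18)) s)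
    (hμ : χ k μ = 0) (hμ' : ∀ j < μ, χ k j ≠ 0) (hk : s.reg 1 = k) :
    wp O (searchP pχ pm pl pz) (fun s' t =>
      t ≤ τχ k 0 + ∑ j ∈ Finset.range μ, (τχ k (j + 1) + 3) + τm k μ + τl k μ + τz k μ +
        10 * l μ + 5 * m μ + 5 * (m μ * m μ) + 50 ∧
      s'.reg 3 = m μ ∧ s'.reg 4 = l μ ∧ s'.reg 17 = m μ * m μ ∧ s'.reg 5 = 2 ^ (m μ * m μ) ∧
      ∀ i < l μ, s'.arr 1 i = ((z μ).testBit i).toNat) s := by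
  rw [searchP, wp_seq, wp_const, wp_seq]
  refine (wχ _).frame.mono ?_
  rintro s₁ t₁ ⟨⟨ht₁, h₁⟩, hf₁⟩
  simp only [Mem.setReg_reg, OfNat.one_ne_ofNat, if_false, if_true, hk] at h₁ ht₁
  rw [wp_seq]
  refine (wp_loop μ (fun j s' => s'.reg 1 = k ∧ s'.reg 18 = j ∧ s'.reg 40 = χ k j)
    (fun j => τχ k (j + 1) + 2) ?_ ?_ ?_).mono ?_
  · rintro j hj s₂ ⟨e1, e18, e40⟩
    refine ⟨by rw [e40]; exact hμ' j hj, ?_⟩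
    rw [wp_seq, wp_const, wp_seq, wp_add]
    refine (wχ _).frame.mono ?_
    rintro s₃ t₃ ⟨⟨ht₃, h₃⟩, hf₃⟩
    simp only [Mem.setReg_reg, OfNat.one_ne_ofNat, Nat.reduceEqDiff, if_false, if_true, e1, e18]
      at h₃ ht₃
    refine ⟨by omega, ?_, ?_, h₃⟩
    · rw [hf₃.1 1 (hχ 1 (by decide) (by decide))]
      simpa using e1
    · rw [hf₃.1 18 (hχ 18 (by decide) (by decide))]
      simpa using e18
  · rintro s₂ ⟨-, -, e40⟩
    rw [e40, hμ]
  · refine ⟨?_, ?_, h₁⟩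
    · rw [hf₁.1 1 (hχ 1 (by decide) (by decide))]
      simpa using hk
    · rw [hf₁.1 18 (hχ 18 (by decide) (by decide))]
      simp
  rintro s₂ t₂ ⟨ht₂, e1, e18, -⟩
  rw [wp_seq]
  refine (wm _).frame.mono ?_
  rintro s₃ t₃ ⟨⟨ht₃, h₃⟩, hf₃⟩
  rw [e1, e18] at ht₃
  rw [e18] at h₃
  have e1₃ : s₃.reg 1 = k := by rw [hf₃.1 1 (hm 1 (by decide) (by decide)), e1]
  have e18₃ : s₃.reg 18 = μ := by rw [hf₃.1 18 (hm 18 (by decide) (by decide)), e18]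
  rw [wp_seq]
  refine (wl _).frame.mono ?_
  rintro s₄ t₄ ⟨⟨ht₄, h₄⟩, hf₄⟩
  rw [e1₃, e18₃] at ht₄
  rw [e18₃] at h₄
  have e1₄ : s₄.reg 1 = k := by rw [hf₄.1 1 (hl 1 (by decide) (by decide)), e1₃]
  have e18₄ : s₄.reg 18 = μ := by rw [hf₄.1 18 (hl 18 (by decide) (by decide)), e18₃]
  have e3₄ : s₄.reg 3 = m μ := by rw [hf₄.1 3 (hl 3 (by decide) (by decide)), h₃]
  rw [wp_seq]
  refine (wz _).frame.mono ?_
  rintro s₅ t₅ ⟨⟨ht₅, h₅⟩, hf₅⟩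
  rw [e1₄, e18₄] at ht₅
  rw [e18₄] at h₅
  have e3₅ : s₅.reg 3 = m μ := by rw [hf₅.1 3 (hz 3 (by decide) (by decide)), e3₄]
  have e4₅ : s₅.reg 4 = l μ := by rw [hf₅.1 4 (hz 4 (by decide) (by decide)), h₄]
  rw [wp_seq]
  refine (wp_decodeP (by decide) (by decide)).frame.mono ?_
  rintro s₆ t₆ ⟨⟨ht₆, h₆⟩, hf₆⟩
  rw [e4₅] at ht₆ h₆
  rw [h₅] at h₆
  rw [wp_seq]
  refine (wp_mulP (by decide) (by decide) (by decide) (by decide)).frame.mono ?_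
  rintro s₇ t₇ ⟨⟨ht₇, h₇⟩, hf₇⟩
  rw [hf₆.1 3 rfl, e3₅] at ht₇ h₇
  rw [wp_seq, wp_const]
  refine (wp_forP (fun j s' => s'.reg 5 = 2 ^ j) 1 (m μ * m μ) (by decide) (by decide)
    (by decide) rfl rfl ?_ ?_ ?_ ?_).frame.mono ?_
  · intro j s s' hr _ h
    rw [hr 5 (by decide) (by decide), h]
  · simpa using h₇
  · simp
  · intro j hj s' h _ _
    rw [wp_add]
    refine ⟨le_rfl, ?_⟩
    simp only [Mem.setReg_reg, if_true, h, pow_succ]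
    ring
  rintro s₈ t₈ ⟨⟨ht₈, h₈⟩, hf₈⟩
  refine ⟨?_, ?_, ?_, ?_, h₈, ?_⟩
  · simp only [add_assoc, Nat.reduceAdd] at ht₂ ⊢
    omega
  · rw [hf₈.1 3 rfl]
    simp only [Mem.setReg_reg, Nat.reduceEqDiff, if_false]
    rw [hf₇.1 3 rfl, hf₆.1 3 rfl, e3₅]
  · rw [hf₈.1 4 rfl]
    simp only [Mem.setReg_reg, Nat.reduceEqDiff, if_false]
    rw [hf₇.1 4 rfl, hf₆.1 4 rfl, e4₅]
  · rw [hf₈.1 17 rfl]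
    simpa using h₇
  · rw [hf₈.2 1 rfl]
    simp only [Mem.setReg_arr]
    rw [hf₇.2 1 rfl]
    exact h₆

/-! ### Hardness -/

theorem primrec_sum {f : ℕ → ℕ → ℕ} (hf : Primrec₂ f) :
    Primrec₂ fun k u => ∑ j ∈ Finset.range u, f k j := by
  refine (Primrec.nat_rec (f := fun _ : ℕ => 0) (g := fun k p => p.2 + f k p.1)
    (Primrec.const 0) ?_).of_eq fun k u => ?_
  · exact Primrec.nat_add.comp (Primrec.snd.comp Primrec.snd)
      (hf.comp Primrec.fst (Primrec.fst.comp Primrec.snd))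
  · induction u with
    | zero => rfl
    | succ u ih => rw [Finset.sum_range_succ, ← ih]

theorem ncard_isNClique_zero {n : ℕ} (G : SimpleGraph (Fin n)) :
    {A : Finset (Fin n) | G.IsNClique 0 A}.ncard = 1 := by
  rw [Set.ncard_eq_one]
  refine ⟨∅, Set.ext fun A => ?_⟩
  simp [SimpleGraph.isNClique_zero]

theorem ncard_isNClique_one {n : ℕ} (G : SimpleGraph (Fin n)) :
    {A : Finset (Fin n) | G.IsNClique 1 A}.ncard = n := by
  have : {A : Finset (Fin n) | G.IsNClique 1 A} = Set.range fun a : Fin n => ({a} : Finset _) := by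
    ext A
    simp [SimpleGraph.isNClique_one, eq_comm]
  rw [this, ← Set.image_univ, Set.ncard_image_of_injective _ Finset.singleton_injective,
    Set.ncard_univ, Nat.card_eq_fintype_card, Fintype.card_fin]

theorem ncard_isNClique_le {n k : ℕ} (G : SimpleGraph (Fin n)) :
    {A : Finset (Fin n) | G.IsNClique k A}.ncard ≤ 2 ^ n := by
  refine (Set.ncard_le_ncard (Set.subset_univ _) (Set.toFinite _)).trans ?_
  rw [Set.ncard_univ, Nat.card_eq_fintype_card]
  simp

/-- The reduction from counting cliques.  The numbers `k ≤ 1`, for which the sums say nothing, are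
treated separately. -/
def reductionP (pχ pm pl pz : Prog) : Prog :=
  .seq parseP (.seq (.half 40 1) (.ite 40
    (.seq (searchP pχ pm pl pz) (.seq outerP (.ite 13 divP (.const 0 0))))
    (.ite 1 (copyP 0 2) (.const 0 1))))

/-- The word with the digits of `z`, the number that encodes the pattern, is the code of the
pattern. -/
theorem word_eq_encodeDigraph {T : FinDigraph} {s : Mem} {z : ℕ}
    (hs : ∀ i < (encodeDigraph T).length, s.arr 1 i = (z.testBit i).toNat)
    (hz : ∀ i, z.testBit i = (encodeDigraph T).getD i false) :
    s.word 1 (encodeDigraph T).length = encodeDigraph T := by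
  refine List.ext_getElem (Mem.length_word _ _ _) fun i h1 h2 => ?_
  simp only [Mem.word, List.getElem_map, List.getElem_range]
  rw [hs i h2, hz, List.getD_eq_getElem _ _ h2]
  cases (encodeDigraph T)[i] <;> rfl

/-- Cliques can be counted with an oracle that counts the copies of large tournaments of the
class. -/
theorem isSharpW1Hard_indSubTo {𝒯 : Set FinDigraph} (h𝒯 : RecursivelyEnumerable 𝒯)
    (hinf : {T ∈ 𝒯 | IsTournament T.2}.Infinite) : (indSubTo 𝒯).IsSharpW1Hard := by
  classical
  obtain ⟨χ, m, l, z, hχ, hm, hl, hz, hex, hT⟩ := exists_search h𝒯 hinf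
  obtain ⟨τχ, pχ, hτχ, fχ, aχ, wχ⟩ := exists_prog_of_primrec hχ (d := 40) (by decide) (by decide)
    (by decide)
  obtain ⟨τm, pm, hτm, fm, am, wm⟩ := exists_prog_of_primrec (hm.comp Primrec.snd).to₂ (d := 3)
    (by decide) (by decide) (by decide)
  obtain ⟨τl, pl, hτl, fl, al, wl⟩ := exists_prog_of_primrec (hl.comp Primrec.snd).to₂ (d := 4)
    (by decide) (by decide) (by decide)
  obtain ⟨τz, pz, hτz, fz, az, wz⟩ := exists_prog_of_primrec (hz.comp Primrec.snd).to₂ (d := 16)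
    (by decide) (by decide) (by decide)
  set μ : ℕ → ℕ := fun k => Nat.find (hex k)
  have hμ₀ : ∀ k, χ k (μ k) = 0 := fun k => Nat.find_spec (hex k)
  have hμ₁ : ∀ k, ∀ j < μ k, χ k j ≠ 0 := fun k j hj => Nat.find_min (hex k) hj
  have hμc : Computable μ := by
    refine Computable.find (P := fun k s => χ k s = 0) ?_ hex
    exact ⟨inferInstance, (Primrec.eq.comp (hχ.comp Primrec.fst Primrec.snd)
      (Primrec.const 0)).decide.to_comp⟩
  -- In terms of `k` and the number `u` found by the search, `σ` bounds the time of the search, and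
  -- `F k u * X` bounds the number of tables and all loops if the input has length less than `X`.
  set M : ℕ → ℕ → ℕ := fun _ u => m u * m u
  set σ : ℕ → ℕ → ℕ := fun k u => τχ k 0 + ∑ j ∈ Finset.range u, (τχ k (j + 1) + 3) + τm k u +
    τl k u + τz k u + 10 * l u + 5 * m u + 5 * M k u + 50
  set F : ℕ → ℕ → ℕ := fun k u => 2 ^ M k u + M k u + 1
  have hMp : Primrec₂ M := by
    exact Primrec.nat_mul.comp (hm.comp Primrec.snd) (hm.comp Primrec.snd)
  have hσp : Primrec₂ σ := by
    refine Primrec.nat_add.comp (Primrec.nat_add.comp (Primrec.nat_add.comp (Primrec.nat_add.comp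
      (Primrec.nat_add.comp (Primrec.nat_add.comp (Primrec.nat_add.comp (Primrec.nat_add.comp
        ?_ ?_) hτm) hτl) hτz) ?_) ?_) ?_) (Primrec.const 50)
    · exact hτχ.comp Primrec.fst (Primrec.const 0)
    · refine primrec_sum (f := fun k j => τχ k (j + 1) + 3) ?_
      exact Primrec.nat_add.comp (hτχ.comp Primrec.fst (Primrec.succ.comp Primrec.snd))
        (Primrec.const 3)
    · exact Primrec.nat_mul.comp (Primrec.const 10) (hl.comp Primrec.snd)
    · exact Primrec.nat_mul.comp (Primrec.const 5) (hm.comp Primrec.snd)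
    · exact Primrec.nat_mul.comp (Primrec.const 5) hMp
  have hpow : Primrec₂ ((· ^ ·) : ℕ → ℕ → ℕ) := Primrec₂.unpaired'.1 Nat.Primrec.pow
  have hFp : Primrec₂ F :=
    Primrec.succ.comp (Primrec.nat_add.comp (hpow.comp (Primrec.const 2) hMp) hMp)
  set f : ℕ → ℕ → ℕ := fun k u => σ k u + 1000 * (F k u * (F k u * (F k u * (F k u *
    (F k u * (F k u * F k u)))))) + 300
  have hfp : Primrec₂ f := by
    refine Primrec.nat_add.comp (Primrec.nat_add.comp hσp (Primrec.nat_mul.comp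
      (Primrec.const 1000) ?_)) (Primrec.const 300)
    exact Primrec.nat_mul.comp hFp (Primrec.nat_mul.comp hFp (Primrec.nat_mul.comp hFp
      (Primrec.nat_mul.comp hFp (Primrec.nat_mul.comp hFp (Primrec.nat_mul.comp hFp hFp)))))
  have hσe : ∀ k u, τχ k 0 + ∑ j ∈ Finset.range u, (τχ k (j + 1) + 3) + τm k u +
    τl k u + τz k u + 10 * l u + 5 * m u + 5 * (m u * m u) + 50 = σ k u := fun _ _ => rfl
  have hFe : ∀ k u, F k u = 2 ^ (m u * m u) + m u * m u + 1 := fun _ _ => rfl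
  have hfe : ∀ k u, f k u = σ k u + 1000 * F k u ^ 7 + 300 := fun k u => by
    simp only [f]; ring
  clear_value f F σ M μ
  refine ⟨reductionP pχ pm pl pz, fun k => f k (μ k), fun k => m (μ k), 7,
    hfp.to_comp.comp Computable.id hμc, hm.to_comp.comp hμc, ?_⟩
  intro i
  rw [countClique_param i]
  obtain ⟨k, n, G⟩ : ℕ × Σ n : ℕ, SimpleGraph (Fin n) := i
  set len := (countClique.enc (k, ⟨n, G⟩)).length with hlen
  have hnlen : n ≤ len := by
    have : countClique.enc (k, ⟨n, G⟩) = unaryThen k (unaryThen n (adjBits G.Adj)) := rfl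
    rw [hlen, this, length_unaryThen, length_unaryThen]
    omega
  set X := len + 1 with hX
  have hX1 : 1 ≤ X := by omega
  set cl := {A : Finset (Fin n) | G.IsNClique k A}.ncard with hcl
  suffices h : wp ((indSubTo 𝒯).oracle (m (μ k))) (reductionP pχ pm pl pz)
      (fun s' t => t ≤ f k (μ k) * X ^ 7 ∧ s'.reg 0 = cl)
      (Mem.init (countClique.enc (k, ⟨n, G⟩))) by
    obtain ⟨s', t, he, ht, h0⟩ := h
    exact ⟨t, ht, s', he, h0⟩
  have hX7 : 1 ≤ X ^ 7 := Nat.one_le_pow _ _ hX1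
  have hX3 : X ^ 3 ≤ X ^ 7 := Nat.pow_le_pow_right hX1 (by decide)
  have hXX : X ≤ X ^ 7 := Nat.le_self_pow (by decide) X
  have htime : ∀ {t : ℕ}, t ≤ 100 * X ^ 3 + σ k (μ k) + 1000 * (F k (μ k) * X) ^ 7 + 20 * X + 60 →
      t ≤ f k (μ k) * X ^ 7 := by
    intro t ht
    have e1 : f k (μ k) * X ^ 7 = σ k (μ k) * X ^ 7 + 1000 * (F k (μ k) * X) ^ 7 + 300 * X ^ 7 := by
      rw [hfe]; ring
    have e2 : σ k (μ k) ≤ σ k (μ k) * X ^ 7 := Nat.le_mul_of_pos_right _ hX7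
    omega
  rw [reductionP, wp_seq]
  refine (wp_parseP G).mono ?_
  rintro s₁ t₁ ⟨ht₁, e1, e2, hE, hE0⟩
  rw [← hlen, ← hX] at ht₁
  rw [wp_seq, wp_half, wp_ite]
  simp only [Mem.setReg_reg, if_true, e1]
  constructor
  · intro hne
    have hk : 2 ≤ k := by omega
    obtain ⟨T, hT𝒯, hTt, hTm, hmT, hlT, hzT⟩ := hT k (μ k) (hμ₀ k)
    have hkm : k ≤ T.1 := by
      refine (Nat.lt_two_pow_self (n := k)).le.trans
        ((Nat.pow_le_pow_right (by decide) ?_).trans hTm)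
      omega
    rw [wp_seq]
    refine (wp_searchP fχ fm fl fz (wχ _) (wm _) (wl _) (wz _) (hμ₀ k) (hμ₁ k)
      (by simpa using e1)).frame.mono ?_
    rintro s₂ t₂ ⟨⟨ht₂, e3, e4, e17, e5, h₂⟩, hf₂⟩
    rw [hσe] at ht₂
    have hr : ∀ r ∈ [1, 2], s₂.reg r = s₁.reg r := by
      intro r hr
      simp only [List.mem_cons, List.not_mem_nil, or_false] at hr
      rw [hf₂.1 r ?_]
      · simp [show r ≠ 40 by omega]
      · simp only [searchP, decodeP, copyP, mulP, forP, Prog.wr, fχ r (by omega) (by omega),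
          fm r (by omega) (by omega), fl r (by omega) (by omega), fz r (by omega) (by omega)]
        rcases hr with rfl | rfl <;> rfl
    have ha : ∀ A, A ≠ 1 → s₂.arr A = s₁.arr A := by
      intro A hA
      rw [hf₂.2 A]
      · rfl
      · simp [searchP, decodeP, copyP, mulP, forP, Prog.wra, aχ, am, al, az, hA]
    have hready : Ready T k n (upAdj G) s₂ := by
      refine ⟨?_, ?_, ?_, ?_, ?_, ?_, ?_, ?_⟩
      · rw [hr 1 (by simp), e1]
      · rw [hr 2 (by simp), e2]
      · rw [e3, hmT]
      · rw [e5, hmT]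
      · rw [e17, hmT]
      · rw [ha 5 (by decide)]; exact hE
      · rw [ha 6 (by decide)]; exact hE0
      · rw [e4, hlT]
        exact word_eq_encodeDigraph (by rw [← hlT]; exact h₂) hzT
    have hFm : F k (μ k) = 2 ^ (T.1 * T.1) + T.1 * T.1 + 1 := by rw [hFe, hmT]
    have hpos : 0 < 2 ^ (T.1 * T.1) := by positivity
    have hFX : F k (μ k) ≤ F k (μ k) * X := Nat.le_mul_of_pos_right _ hX1
    have hXF : X ≤ F k (μ k) * X := Nat.le_mul_of_pos_left _ (by omega)
    rw [wp_seq]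
    refine (wp_outerP hT𝒯 (b := m (μ k)) hmT.ge hready (L := F k (μ k) * X) (cl := cl) (by omega)
      (by omega) (by omega) (by omega)
      (fun Q => hostSum_upAdj T.2 Q G hk hkm)).frame.mono ?_
    rintro s₃ t₃ ⟨⟨ht₃, h₃, hne₃⟩, hf₃⟩
    have e2' : s₃.reg 2 = n := by rw [hf₃.1 2 rfl, hready.reg_two]
    rw [wp_ite]
    constructor
    · intro h13
      refine (wp_divP e2' rfl h13 h₃ ?_).mono ?_
      · exact (ncard_isNClique_le G).trans_lt (Nat.pow_lt_pow_right (by decide) (by omega))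
      · rintro s₄ t₄ ⟨ht₄, h₄⟩
        exact ⟨htime (by omega), h₄⟩
    · intro h13
      rw [wp_const]
      refine ⟨htime (by omega), ?_⟩
      -- For a nonempty graph some denominator is nonzero.
      have hn : n = 0 := by
        by_contra hn
        obtain ⟨c, hc, hc0⟩ := exists_hostCoeff_ne_zero hTt (by omega : 1 ≤ k) hTm
        exact hne₃ ⟨c, hc, hostSum_zeroRel_ne_zero T.2 _ hn hk hkm hc0⟩ h13
      subst hn
      have : cl = 0 := by
        rw [hcl, Set.ncard_eq_zero (Set.toFinite _), Set.eq_empty_iff_forall_notMem]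
        intro A hA
        have := hA.card_eq
        rw [Finset.eq_empty_of_isEmpty A, Finset.card_empty] at this
        omega
      simp [this]
  · intro h0
    rw [wp_ite]
    simp only [Mem.setReg_reg, OfNat.one_ne_ofNat, if_false, e1]
    constructor
    · intro hk
      obtain rfl : k = 1 := by omega
      rw [wp_copyP (by decide)]
      refine ⟨htime (by omega), ?_⟩
      rw [hcl, ncard_isNClique_one]
      simpa using e2
    · rintro rfl
      rw [wp_const]
      refine ⟨htime (by omega), ?_⟩
      rw [hcl, ncard_isNClique_zero]
      simp

/-! ### Counting copies of fixed tournaments -/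

/-- Runs `p` if all tests in the list succeed.  A test leaves a truth value in the register `34`,
which is compared with the prescribed one. -/
def guardP {ι : Type*} (test : ι → Prog) (p : Prog) : List (ι × Bool) → Prog
  | [] => p
  | x :: l => .seq (test x.1) (.ite 34 (if x.2 then guardP test p l else .const 34 0)
      (if x.2 then .const 34 0 else guardP test p l))

/-- The assertion `I` describes the states between the tests, whose results do not change; `P` holds
at the end, whether `p` is run or not. -/
theorem wp_guardP {ι : Type*} {O : List Bool → ℕ → Prop} {test : ι → Prog} {p : Prog}
    {I P : Mem → Prop} {f : ι → Bool} {τ τ' : ℕ} (l : List (ι × Bool))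
    (htest : ∀ x s, I s → wp O (test x) (fun s' t => t ≤ τ ∧ (s'.reg 34 != 0) = f x ∧ I s') s)
    (hst : ∀ s v, I s → I (s.setReg 34 v))
    (hp : (∀ x ∈ l, f x.1 = x.2) → ∀ s, I s → wp O p (fun s' t => t ≤ τ' ∧ P s') s)
    (hI : ¬ (∀ x ∈ l, f x.1 = x.2) → ∀ s, I s → P s) {s : Mem} (hs : I s) :
    wp O (guardP test p l) (fun s' t => t ≤ l.length * (τ + 2) + τ' ∧ P s') s := by
  induction l generalizing s with
  | nil => simpa [guardP] using hp (by simp) s hs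
  | cons x l ih =>
    obtain ⟨x, b⟩ := x
    rw [guardP, wp_seq]
    refine (htest x s hs).mono ?_
    rintro s₁ t₁ ⟨ht₁, h₁, hs₁⟩
    have hgood : f x = b → wp O (guardP test p l) (fun s' t =>
        t₁ + (1 + t) ≤ (l.length + 1) * (τ + 2) + τ' ∧ P s') s₁ := by
      intro hx
      refine (ih (fun hl => hp ?_) (fun hl => hI ?_) hs₁).mono ?_
      · simpa [hx] using hl
      · simpa [hx] using hl
      · rintro s₂ t₂ ⟨ht₂, h₂⟩
        refine ⟨?_, h₂⟩
        rw [Nat.add_mul]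
        omega
    have hbad : f x ≠ b → wp O (.const 34 0) (fun s' t =>
        t₁ + (1 + t) ≤ (l.length + 1) * (τ + 2) + τ' ∧ P s') s₁ := by
      intro hx
      rw [wp_const]
      refine ⟨?_, hI ?_ _ (hst _ _ hs₁)⟩
      · rw [Nat.add_mul]
        omega
      · simp [hx]
    rw [wp_ite, List.length_cons]
    constructor
    · intro h
      have hf : f x = true := by rw [← h₁]; simpa using h
      cases b with
      | true => exact hgood hf
      | false => exact hbad (by simp [hf])
    · intro h
      have hf : f x = false := by rw [← h₁]; simpa using h
      cases b with
      | true => exact hbad (by simp [hf])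
      | false => exact hgood hf

/-- `j` nested loops around `p`; the loop variables, which are bounded by the register `2`, are in
the registers `100`, `102`, and so on. -/
def nestP : ℕ → Prog → Prog
  | 0, p => p
  | j + 1, p => nestP j (forP (100 + 2 * j) 2 (101 + 2 * j) p)

/-- If `p` adds `g v` to the register `0` when the loop variables have the values `v`, then the
nested loops add the sum of `g` over all tuples of numbers below `n`. -/
theorem wp_nestP {O : List Bool → ℕ → Prop} {I : Mem → Prop} {n X : ℕ} (hnX : n ≤ X)
    (hX : 1 ≤ X) (hI2 : ∀ s, I s → s.reg 2 = n)
    (hI : ∀ s s' : Mem, (∀ r < 100, s'.reg r = s.reg r) → s'.arr = s.arr → I s → I s')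
    (j : ℕ) {p : Prog} {g : (Fin j → ℕ) → ℕ} {τ : ℕ} (hτ : 1 ≤ τ)
    (hpw : ∀ i < j, p.wr (100 + 2 * i) = false) (hpw2 : p.wr 2 = false)
    (hp : ∀ s, I s → (∀ i < j, s.reg (100 + 2 * i) < n) → wp O p (fun s' t => t ≤ τ ∧ I s' ∧
      s'.reg 0 = s.reg 0 + g fun i => s.reg (100 + 2 * i)) s)
    {s : Mem} (hs : I s) :
    wp O (nestP j p) (fun s' t => t ≤ (8 * X) ^ j * τ ∧ I s' ∧
      s'.reg 0 = s.reg 0 + ∑ v : Fin j → Fin n, g fun i => v i) s := by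
  induction j generalizing p τ s with
  | zero =>
    refine (hp s hs (by simp)).mono ?_
    rintro s' t ⟨ht, h, h'⟩
    refine ⟨by simpa using ht, h, ?_⟩
    rw [h', Fintype.sum_unique]
    congr 2
    funext i
    exact i.elim0
  | succ j ih =>
    have hτ' : n * (τ + 4) + 3 ≤ 8 * X * τ := by
      calc n * (τ + 4) + 3 ≤ X * (τ + 4) + 3 * X := by
            have := Nat.mul_le_mul_right (τ + 4) hnX
            omega
        _ = X * τ + X * 7 := by ring
        _ ≤ X * τ + X * (7 * τ) := by gcongr; omega
        _ = _ := by ring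
    rw [nestP]
    refine (ih (p := forP (100 + 2 * j) 2 (101 + 2 * j) p) (τ := 8 * X * τ)
      (g := fun v => ∑ x ∈ Finset.range n, g (Fin.snoc (α := fun _ => ℕ) v x)) ?_ ?_ ?_ ?_ hs).mono
      ?_
    · exact Nat.one_le_iff_ne_zero.2 (by positivity)
    · intro i hi
      simp [forP, Prog.wr, hpw i (by omega)]
      omega
    · simp [forP, Prog.wr, hpw2]
      omega
    · intro s hs hv
      refine (wp_forP (fun i s' => I s' ∧ (∀ i < j, s'.reg (100 + 2 * i) = s.reg (100 + 2 * i)) ∧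
        s'.reg 0 = s.reg 0 + ∑ x ∈ Finset.range i, g (Fin.snoc (α := fun _ => ℕ)
          (fun i : Fin j => s.reg (100 + 2 * i)) x)) τ n (by omega) (by omega) (by omega)
        (hpw j (by omega)) hpw2 ?_ (hI2 s hs) ?_ ?_).mono ?_
      · rintro i s₁ s₂ hr ha ⟨h1, h2, h3⟩
        refine ⟨hI s₁ s₂ (fun r hr' => hr r (by omega) (by omega)) ha h1, fun i hi => ?_, ?_⟩
        · rw [hr _ (by omega) (by omega), h2 i hi]
        · rw [hr 0 (by omega) (by omega), h3]
      · exact ⟨hs, fun _ _ => rfl, by simp⟩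
      · rintro i hi s₁ ⟨h1, h2, h3⟩ hi₁ -
        refine (hp s₁ h1 ?_).frame.mono ?_
        · intro i' hi'
          rcases Nat.lt_succ_iff_lt_or_eq.1 hi' with h | rfl
          · rw [h2 i' h]; exact hv i' h
          · rw [hi₁]; exact hi
        · rintro s₂ t₂ ⟨⟨ht₂, h₂, h₂'⟩, hf₂⟩
          refine ⟨ht₂, h₂, fun i' hi' => ?_, ?_⟩
          · rw [hf₂.1 _ (hpw i' (by omega)), h2 i' hi']
          · rw [h₂', h3, Finset.sum_range_succ, add_assoc]
            congr 3
            funext i'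
            refine Fin.lastCases ?_ (fun i' => ?_) i'
            · simp [hi₁]
            · simp [h2 i' i'.2]
      · rintro s' t ⟨ht, h1, -, h3⟩
        exact ⟨ht.trans hτ', h1, h3⟩
    · rintro s' t ⟨ht, h1, h2⟩
      refine ⟨?_, h1, ?_⟩
      · rw [pow_succ, mul_assoc]
        exact ht
      · rw [h2, ← (Fin.snocEquiv fun _ : Fin (j + 1) => Fin n).sum_comp,
          Fintype.sum_prod_type_right]
        congr 1
        refine Finset.sum_congr rfl fun v _ => ?_
        rw [Finset.sum_range]
        refine Finset.sum_congr rfl fun x _ => ?_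
        congr 1
        funext i
        refine Fin.lastCases ?_ (fun i => ?_) i
        · simp [Fin.snocEquiv]
        · simp [Fin.snocEquiv]

/-- The cells of the array `0` hold the letters of the encodings of `T` and `G`. -/
def HoldsInput (T G : FinDigraph) (s : Mem) : Prop :=
  ∀ i, s.arr 0 i = ((encodeDigraph T ++ encodeDigraph G).getD i false).toNat

/-- The function `val` of two directed graphs can be added to the register `0` in polynomial
time. -/
def PolyAddable (val : FinDigraph → FinDigraph → ℕ) : Prop :=
  ∃ (p : Prog) (C d : ℕ), ∀ T G s, HoldsInput T G s → wp noOracle p (fun s' t =>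
    t ≤ C * ((encodeDigraph T ++ encodeDigraph G).length + 1) ^ d ∧
      s'.reg 0 = s.reg 0 + val T G ∧ s'.arr 0 = s.arr 0) s

theorem PolyAddable.sum {ι : Type*} {val : ι → FinDigraph → FinDigraph → ℕ} (S : Finset ι)
    (h : ∀ i ∈ S, PolyAddable (val i)) : PolyAddable fun T G => ∑ i ∈ S, val i T G := by
  classical
  induction S using Finset.induction_on with
  | empty =>
    refine ⟨.const 34 0, 1, 0, fun T G s _ => ?_⟩
    rw [wp_const]
    exact ⟨by simp, by simp, rfl⟩
  | insert i S hi ih =>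
    obtain ⟨p, C, d, hp⟩ := h i (by simp)
    obtain ⟨q, C', d', hq⟩ := ih fun j hj => h j (by simp [hj])
    refine ⟨.seq p q, C + C', d + d', fun T G s hs => ?_⟩
    rw [wp_seq]
    refine (hp T G s hs).mono ?_
    rintro s₁ t₁ ⟨ht₁, h₁, ha₁⟩
    refine (hq T G s₁ (by unfold HoldsInput; rw [ha₁]; exact hs)).mono ?_
    rintro s₂ t₂ ⟨ht₂, h₂, ha₂⟩
    refine ⟨?_, ?_, ha₂.trans ha₁⟩
    · set X := (encodeDigraph T ++ encodeDigraph G).length + 1 with hX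
      have h1 : C * X ^ d ≤ C * X ^ (d + d') :=
        Nat.mul_le_mul_left _ (Nat.pow_le_pow_right (by omega) (by omega))
      have h2 : C' * X ^ d' ≤ C' * X ^ (d + d') :=
        Nat.mul_le_mul_left _ (Nat.pow_le_pow_right (by omega) (by omega))
      rw [Nat.add_mul]
      omega
    · beta_reduce
      rw [h₂, h₁, Finset.sum_insert hi, add_assoc]

/-- Tests whether the loop variables with the indices `a`, `b` are in increasing order, or whether
they are joined by an edge of the graph that is stored in the array `0` from the position in the
register `42` on. -/
def edgeTestP {m : ℕ} : Bool × Fin m × Fin m → Prog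
  | (false, a, b) => .sub 34 (100 + 2 * b) (100 + 2 * a)
  | (true, a, b) => .seq (mulP 35 (100 + 2 * a) 2 36 37)
      (.seq (.add 35 35 (100 + 2 * b)) (.seq (.add 35 35 42) (.load 34 0 35)))

/-- The prescribed results of the tests for increasing enumerations of copies of the relation
`r`. -/
def edgeReq {m : ℕ} (r : Fin m → Fin m → Bool) : Bool × Fin m × Fin m → Bool
  | (false, a, b) => decide (a < b)
  | (true, a, b) => r a b

/-- Adds the number of increasing enumerations of copies of the relation `r` to the register `0`,
provided that the input begins with the encoding of `T`. -/
noncomputable def copiesP (T : FinDigraph) (r : Fin T.1 → Fin T.1 → Bool) : Prog :=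
  guardP (fun i => .seq (.const 34 i) (.load 34 0 34))
    (.seq (.const 42 (encodeDigraph T).length) (.seq (unaryP 2 42)
      (nestP T.1 (guardP edgeTestP (.seq (.const 34 1) (.add 0 0 34))
        ((Finset.univ : Finset (Bool × Fin T.1 × Fin T.1)).toList.map fun x => (x, edgeReq r x))))))
    ((List.range (encodeDigraph T).length).map fun i => (i, (encodeDigraph T).getD i false))

open Classical in
/-- The number of increasing enumerations of sets that induce a copy of the relation `r`. -/
noncomputable def copies {m : ℕ} (r : Fin m → Fin m → Bool) (G : FinDigraph) : ℕ :=
  (Finset.univ.filter fun v : Fin m → Fin G.1 =>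
    (∀ a b, v a < v b ↔ a < b) ∧ ∀ a b, G.2.Adj (v a) (v b) ↔ r a b = true).card

theorem guardP_wr {ι : Type*} {test : ι → Prog} {p : Prog} {r : ℕ} (l : List (ι × Bool))
    (ht : ∀ x, (test x).wr r = false) (hp : p.wr r = false) (hr : r ≠ 34) :
    (guardP test p l).wr r = false := by
  induction l with
  | nil => exact hp
  | cons x l ih =>
    obtain ⟨x, b⟩ := x
    cases b <;> simp [guardP, Prog.wr, ht, ih, hr]

open Classical in
/-- Codes of directed graphs are prefix-free, hence a directed graph at the beginning of the input
is recognized by comparing letters. -/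
theorem eq_of_getD_encodeDigraph {T T₀ : FinDigraph} {l : List Bool}
    (h : ∀ i < (encodeDigraph T₀).length,
      (encodeDigraph T ++ l).getD i false = (encodeDigraph T₀).getD i false) : T = T₀ := by
  obtain ⟨m, T⟩ := T
  obtain ⟨m₀, T₀⟩ := T₀
  rw [length_encodeDigraph] at h
  have h0 : encodeDigraph ⟨m, T⟩ ++ l = unaryThen m (adjBits T.Adj ++ l) := encodeRel_append _ _
  have h1 : encodeDigraph ⟨m₀, T₀⟩ = unaryThen m₀ (adjBits T₀.Adj) := rfl
  have hm : m = m₀ := by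
    rcases lt_trichotomy m m₀ with hlt | heq | hlt
    · have := h m (by dsimp only; omega)
      rw [h0, h1, getD_unaryThen_self, getD_unaryThen_lt _ hlt] at this
      cases this
    · exact heq
    · have := h m₀ (by dsimp only; omega)
      rw [h0, h1, getD_unaryThen_self, getD_unaryThen_lt _ hlt] at this
      cases this
  subst hm
  congr 1
  refine Digraph.ext (funext fun u => funext fun v => ?_)
  have h2 := h (m + 1 + (u * m + v)) (by have := pos_lt u.2 v.2; dsimp only; omega)
  have h3 := getD_encodeDigraph T₀ [] u.2 v.2
  rw [List.append_nil] at h3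
  rw [getD_encodeDigraph T l u.2 v.2, h3, decide_eq_decide] at h2
  exact propext h2

open Classical in
/-- The exponent of the running time is the order of the fixed directed graph `T₀`, up to one. -/
theorem polyAddable_copies (T₀ : FinDigraph) (r : Fin T₀.1 → Fin T₀.1 → Bool) :
    PolyAddable fun T G => if T = T₀ then copies r G else 0 := by
  obtain ⟨m, T₀⟩ := T₀
  set ℓ := (encodeDigraph ⟨m, T₀⟩).length with hℓ
  set L : List ((Bool × Fin m × Fin m) × Bool) :=
    (Finset.univ : Finset (Bool × Fin m × Fin m)).toList.map fun x => (x, edgeReq r x) with hL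
  refine ⟨copiesP ⟨m, T₀⟩ r, 4 * ℓ + 6 + 8 ^ m * (9 * L.length + 2), m + 1, ?_⟩
  rintro T ⟨n, G⟩ s hs
  set X := (encodeDigraph T ++ encodeDigraph ⟨n, G⟩).length + 1 with hX
  have hnX : n + 1 ≤ X := by
    rw [hX, List.length_append, length_encodeDigraph ⟨n, G⟩]
    dsimp only
    omega
  have hXm : 1 ≤ X ^ m := Nat.one_le_pow _ _ (by omega)
  have hXm' : X ≤ X ^ (m + 1) := Nat.le_self_pow (by omega) X
  refine (wp_guardP (I := fun s' => s'.arr 0 = s.arr 0 ∧ s'.reg 0 = s.reg 0)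
    (f := fun i => (encodeDigraph T ++ encodeDigraph ⟨n, G⟩).getD i false)
    (P := fun s' => s'.reg 0 = s.reg 0 + (if T = ⟨m, T₀⟩ then copies r ⟨n, G⟩ else 0) ∧
      s'.arr 0 = s.arr 0) (τ := 2)
    (τ' := (6 + 8 ^ m * (9 * L.length + 2)) * X ^ (m + 1)) _ ?_ ?_ ?_ ?_ ⟨rfl, rfl⟩).mono ?_
  · rintro i s₁ ⟨h1, h2⟩
    rw [wp_seq, wp_const, wp_load]
    refine ⟨le_rfl, ?_, h1, ?_⟩
    · simp only [Mem.setReg_reg, Mem.setReg_arr, if_true, h1]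
      rw [hs i]
      cases (encodeDigraph T ++ encodeDigraph ⟨n, G⟩).getD i false <;> rfl
    · simpa using h2
  · rintro s₁ v ⟨h1, h2⟩
    exact ⟨h1, by simpa using h2⟩
  · rintro hmatch s₁ ⟨h1, h2⟩
    obtain rfl : T = ⟨m, T₀⟩ := by
      refine eq_of_getD_encodeDigraph (l := encodeDigraph ⟨n, G⟩) fun i hi => ?_
      exact hmatch (i, (encodeDigraph ⟨m, T₀⟩).getD i false)
        (List.mem_map.2 ⟨i, List.mem_range.2 hi, rfl⟩)
    have harr : ∀ i, s₁.arr 0 (ℓ + i) = ((encodeDigraph ⟨n, G⟩).getD i false).toNat := by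
      intro i
      rw [h1, hs, List.getD_append_right _ _ _ _ (by omega), ← hℓ, Nat.add_sub_cancel_left]
    have henc : encodeDigraph ⟨n, G⟩ = unaryThen n (adjBits G.Adj) := rfl
    rw [if_pos rfl, wp_seq, wp_const, wp_seq]
    refine (wp_unaryP (a := ℓ) (N := n) (by decide) (by decide) (by decide) (by simp [hℓ]) ?_
      ?_).frame.mono ?_
    · intro i hi
      simp only [Mem.setReg_arr]
      rw [harr, henc, getD_unaryThen_lt _ hi]
      simp
    · simp only [Mem.setReg_arr]
      rw [harr, henc, getD_unaryThen_self]
      rfl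
    rintro s₂ t₂ ⟨⟨ht₂, h3, h4⟩, hf₂⟩
    have hA₂ : s₂.arr 0 = s₁.arr 0 := hf₂.2 0 rfl
    have hr₂ : s₂.reg 0 = s.reg 0 := by
      rw [hf₂.1 0 rfl]
      simpa using h2
    -- The outcomes of the tests for the values `v` of the loop variables.
    let F : (Fin m → ℕ) → Bool × Fin m × Fin m → Bool := fun v x =>
      match x with
      | (false, a, b) => decide (v a < v b)
      | (true, a, b) => s.arr 0 (ℓ + n + 1 + (v a * n + v b)) != 0
    refine (wp_nestP (X := X) (n := n) (I := fun s' => s'.arr 0 = s.arr 0 ∧ s'.reg 2 = n ∧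
      s'.reg 42 = ℓ + n + 1) (by omega) (by omega) (fun s' h => h.2.1) ?_ m
      (g := fun v => if ∀ x, F v x = edgeReq r x then 1 else 0)
      (τ := (9 * L.length + 2) * X) ?_ ?_ ?_ ?_ ⟨hA₂.trans h1, h3, h4⟩).mono ?_
    · rintro s₃ s₄ hr ha ⟨h5, h6, h7⟩
      exact ⟨by rw [ha, h5], by rw [hr 2 (by decide), h6], by rw [hr 42 (by decide), h7]⟩
    · exact Nat.one_le_iff_ne_zero.2 (Nat.mul_ne_zero (by omega) (by omega))
    · intro i hi
      refine guardP_wr _ ?_ ?_ (by omega)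
      · rintro ⟨b, x, y⟩
        cases b <;> simp [edgeTestP, mulP, forP, Prog.wr] <;> omega
      · simp [Prog.wr]
        omega
    · refine guardP_wr _ ?_ ?_ (by omega)
      · rintro ⟨b, x, y⟩
        cases b <;> simp [edgeTestP, mulP, forP, Prog.wr]
      · simp [Prog.wr]
    · rintro s₃ ⟨h5, h6, h7⟩ hv
      refine (wp_guardP (I := fun s' => (∀ r', r' ∉ [34, 35, 36, 37] → s'.reg r' = s₃.reg r') ∧
        s'.arr = s₃.arr) (f := F fun i => s₃.reg (100 + 2 * i)) (τ := 5 * n + 7) (τ' := 2)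
        (P := fun s' => (s'.arr 0 = s.arr 0 ∧ s'.reg 2 = n ∧ s'.reg 42 = ℓ + n + 1) ∧
          s'.reg 0 = s₃.reg 0 + if ∀ x, F (fun i => s₃.reg (100 + 2 * i)) x = edgeReq r x
            then 1 else 0) _ ?_ ?_ ?_ ?_ ⟨fun _ _ => rfl, rfl⟩).mono ?_
      · rintro ⟨b, x, y⟩ s₄ ⟨h8, h9⟩
        have hnot : ∀ i : ℕ, 100 + 2 * i ∉ [34, 35, 36, 37] := by
          intro i
          simp only [List.mem_cons, List.not_mem_nil, or_false]
          omega
        cases b with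
        | false =>
          rw [edgeTestP, wp_sub]
          refine ⟨by omega, ?_, ?_, h9⟩
          · simp only [Mem.setReg_reg, if_true, h8 _ (hnot _), F]
            rw [Bool.eq_iff_iff]
            simp [Nat.sub_eq_zero_iff_le]
          · intro r' hr'
            rw [← h8 r' hr']
            simp only [List.mem_cons, List.not_mem_nil, or_false, not_or] at hr'
            simp [hr'.1]
        | true =>
          rw [edgeTestP, wp_seq]
          refine (wp_mulP ?_ (by decide) (by decide) (by decide)).frame.mono ?_
          · simp
            omega
          rintro s₅ t₅ ⟨⟨ht₅, h10⟩, hf₅⟩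
          rw [h8 2 (by decide), h6] at ht₅ h10
          rw [h8 _ (hnot _)] at h10
          have hw : ∀ r', r' ∉ [34, 35, 36, 37] → s₅.reg r' = s₃.reg r' := by
            intro r' hr'
            rw [← h8 r' hr']
            refine hf₅.1 r' ?_
            simp only [List.mem_cons, List.not_mem_nil, or_false, not_or] at hr'
            simp [mulP, forP, Prog.wr, hr']
          have ha : s₅.arr = s₃.arr := by
            rw [← h9]
            funext A
            exact hf₅.2 A (by simp [mulP, forP, Prog.wra])
          simp only [wp_seq, wp_add, wp_load]
          refine ⟨by omega, ?_, ?_, ha⟩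
          · simp only [Mem.setReg_reg, Mem.setReg_arr, if_true, if_false, Nat.reduceEqDiff, ha,
              h5, h10, hw _ (hnot _), hw 42 (by decide), h7, F]
            rw [Nat.add_comm (ℓ + n + 1)]
          · intro r' hr'
            rw [← hw r' hr']
            simp only [List.mem_cons, List.not_mem_nil, or_false, not_or] at hr'
            simp [hr'.1, hr'.2.1]
      · rintro s₄ v ⟨h8, h9⟩
        refine ⟨fun r' hr' => ?_, h9⟩
        rw [← h8 r' hr']
        simp only [List.mem_cons, List.not_mem_nil, or_false, not_or] at hr'
        simp [hr'.1]
      · rintro hall s₄ ⟨h8, h9⟩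
        rw [wp_seq, wp_const, wp_add, if_pos]
        · refine ⟨le_rfl, ⟨by simp [h9, h5], ?_, ?_⟩, ?_⟩
          · simp [h8 2, h6]
          · simp [h8 42, h7]
          · simp [h8 0]
        · intro x
          exact hall (x, edgeReq r x) (List.mem_map.2 ⟨x, Finset.mem_toList.2 (Finset.mem_univ _),
            rfl⟩)
      · rintro hall s₄ ⟨h8, h9⟩
        rw [if_neg]
        · refine ⟨⟨by rw [h9, h5], ?_, ?_⟩, ?_⟩
          · rw [h8 2 (by decide), h6]
          · rw [h8 42 (by decide), h7]
          · rw [h8 0 (by decide), add_zero]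
        · intro h
          refine hall fun x hx => ?_
          obtain ⟨y, -, rfl⟩ := List.mem_map.1 hx
          exact h y
      · rintro s₄ t₄ ⟨ht₄, h8, h9⟩
        refine ⟨ht₄.trans ?_, h8, h9⟩
        change L.length * (5 * n + 7 + 2) + 2 ≤ _
        calc L.length * (5 * n + 7 + 2) + 2 ≤ L.length * (9 * X) + 2 * X := by
              have := Nat.mul_le_mul_left L.length (show 5 * n + 7 + 2 ≤ 9 * X by omega)
              omega
          _ = _ := by ring
    · rintro s₃ t₃ ⟨ht₃, ⟨h5, -⟩, h6⟩
      refine ⟨?_, ?_, h5⟩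
      · have e : (8 * X) ^ m * ((9 * L.length + 2) * X) =
            8 ^ m * (9 * L.length + 2) * X ^ (m + 1) := by rw [mul_pow, pow_succ]; ring
        rw [e] at ht₃
        rw [Nat.add_mul]
        omega
      · rw [h6, hr₂, copies, Finset.card_filter]
        congr 1
        refine Finset.sum_congr rfl fun v _ => if_congr ?_ rfl rfl
        have hF : ∀ a b, F (fun i => v i) (true, a, b) = decide (G.Adj (v a) (v b)) := by
          intro a b
          have hg := getD_encodeDigraph G [] (v a).2 (v b).2
          rw [List.append_nil] at hg
          simp only [F]
          rw [← h1, add_assoc ℓ, add_assoc ℓ, harr, hg]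
          by_cases h : G.Adj (v a) (v b) <;> simp [h]
        constructor
        · intro h
          refine ⟨fun a b => ?_, fun a b => ?_⟩
          · have := h (false, a, b)
            simpa [F, edgeReq] using this
          · have := h (true, a, b)
            rw [hF] at this
            simp only [edgeReq] at this
            rw [← this, decide_eq_true_eq]
        · rintro ⟨h, h'⟩ ⟨b, x, y⟩
          cases b with
          | false => simpa [F, edgeReq] using h x y
          | true =>
            rw [hF]
            simp only [edgeReq]
            rw [Bool.eq_iff_iff, decide_eq_true_eq]
            exact h' x y
  · rintro hmatch s₁ ⟨h1, h2⟩
    rw [if_neg]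
    · exact ⟨h2, h1⟩
    · rintro rfl
      refine hmatch fun x hx => ?_
      obtain ⟨i, hi, rfl⟩ := List.mem_map.1 hx
      exact List.getD_append _ _ _ _ (List.mem_range.1 hi)
  · rintro s' t ⟨ht, h⟩
    refine ⟨ht.trans ?_, h⟩
    rw [List.length_map, List.length_range]
    have h1 : ℓ * (2 + 2) ≤ 4 * ℓ * X ^ (m + 1) := by
      calc ℓ * (2 + 2) = 4 * ℓ * 1 := by ring
        _ ≤ _ := Nat.mul_le_mul_left _ (Nat.one_le_pow _ _ (by omega))
    change _ ≤ (4 * ℓ + 6 + 8 ^ m * (9 * L.length + 2)) * X ^ (m + 1)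
    rw [add_assoc (4 * ℓ), Nat.add_mul (4 * ℓ)]
    exact Nat.add_le_add_right h1 _

/-! ### Tractability -/

theorem inducedCount_eq_zero {T G : FinDigraph} (hT : ¬ IsTournament T.2)
    (hG : IsTournament G.2) : inducedCount T G = 0 := by
  rw [inducedCount, Set.ncard_eq_zero (Set.toFinite _), Set.eq_empty_iff_forall_notMem]
  rintro A ⟨e⟩
  have h : ∀ u v, T.2.Adj u v ↔ G.2.Adj (e u).1 (e v).1 := fun u v => e.map_rel_iff.symm
  refine hT ⟨fun u => ?_, fun u v huv => ?_⟩
  · rw [h]; exact hG.1 _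
  · rw [h, h]
    exact hG.2 _ _ fun h' => huv (e.injective (Subtype.ext h'))

open Classical in
/-- Induced copies are counted by the increasing enumerations of their vertices. -/
theorem inducedCount_eq_sum_copies (T G : FinDigraph) :
    inducedCount T G = ∑ r : Fin T.1 → Fin T.1 → Bool,
      if Nonempty (T.2.Adj ≃r fun a b => r a b = true) then copies r G else 0 := by
  obtain ⟨m, T⟩ := T
  obtain ⟨n, G⟩ := G
  simp only [copies, Finset.card_filter]
  -- The relation `r` is determined by the enumeration.
  have key : (∑ r : Fin m → Fin m → Bool,
      if Nonempty (T.Adj ≃r fun a b => r a b = true) then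
        ∑ v : Fin m → Fin n, if (∀ a b, v a < v b ↔ a < b) ∧
          ∀ a b, G.Adj (v a) (v b) ↔ r a b = true then 1 else 0 else 0) =
      (Finset.univ.filter fun v : Fin m → Fin n => StrictMono v ∧
        Nonempty (T.Adj ≃r fun a b => G.Adj (v a) (v b))).card := by
    rw [Finset.card_filter]
    have : ∀ r : Fin m → Fin m → Bool, (if Nonempty (T.Adj ≃r fun a b => r a b = true) then
        ∑ v : Fin m → Fin n, if (∀ a b, v a < v b ↔ a < b) ∧
          ∀ a b, G.Adj (v a) (v b) ↔ r a b = true then 1 else 0 else 0) =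
        ∑ v : Fin m → Fin n, if r = (fun a b => decide (G.Adj (v a) (v b))) then
          (if StrictMono v ∧ Nonempty (T.Adj ≃r fun a b => G.Adj (v a) (v b)) then 1 else 0)
          else 0 := by
      intro r
      have hmono : ∀ v : Fin m → Fin n, StrictMono v ↔ ∀ a b, v a < v b ↔ a < b := fun v =>
        ⟨fun h a b => h.lt_iff_lt, fun h a b => (h a b).2⟩
      have hr : ∀ v : Fin m → Fin n, (r = fun a b => decide (G.Adj (v a) (v b))) ↔
          ∀ a b, G.Adj (v a) (v b) ↔ r a b = true := fun v => by
        simp only [funext_iff, Bool.eq_iff_iff (b := decide _), decide_eq_true_eq, iff_comm]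
      have hiso : ∀ v : Fin m → Fin n, (r = fun a b => decide (G.Adj (v a) (v b))) →
          (Nonempty (T.Adj ≃r fun a b => G.Adj (v a) (v b)) ↔
            Nonempty (T.Adj ≃r fun a b => r a b = true)) := by
        rintro v rfl
        simp only [decide_eq_true_eq]
      by_cases h : Nonempty (T.Adj ≃r fun a b => r a b = true)
      · rw [if_pos h]
        refine Finset.sum_congr rfl fun v _ => ?_
        rw [← ite_and]
        refine if_congr ?_ rfl rfl
        rw [← hr, ← hmono]
        constructor
        · exact fun h' => ⟨h'.2, h'.1, (hiso v h'.2).2 h⟩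
        · exact fun h' => ⟨h'.2.1, h'.1⟩
      · rw [if_neg h]
        refine (Finset.sum_eq_zero fun v _ => ?_).symm
        rw [← ite_and]
        exact if_neg fun h' => h ((hiso v h'.1).1 h'.2.2)
    rw [Finset.sum_congr rfl fun r _ => this r, Finset.sum_comm]
    refine Finset.sum_congr rfl fun v _ => ?_
    rw [Finset.sum_ite_eq' , if_pos (Finset.mem_univ _)]
  refine Eq.trans ?_ key.symm
  rw [inducedCount, ← Set.ncard_coe_finset]
  symm
  simp only [Finset.coe_filter, Finset.mem_univ, true_and]
  refine Set.ncard_congr (fun v _ => Finset.univ.image v) ?_ ?_ ?_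
  · rintro v ⟨hv, ⟨e⟩⟩
    have hmem : ∀ a, v a ∈ Finset.univ.image v := fun a =>
      Finset.mem_image_of_mem v (Finset.mem_univ a)
    refine ⟨e.trans ⟨Equiv.ofBijective (fun a => ⟨v a, hmem a⟩) ⟨fun a b hab => ?_, ?_⟩, Iff.rfl⟩⟩
    · exact hv.injective (congrArg Subtype.val hab)
    · rintro ⟨x, hx⟩
      obtain ⟨a, -, rfl⟩ := Finset.mem_image.1 hx
      exact ⟨a, rfl⟩
  · rintro v v' ⟨hv, -⟩ ⟨hv', -⟩ h
    refine hv.range_inj hv' |>.1 ?_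
    have := congrArg (fun s : Finset (Fin n) => (s : Set (Fin n))) h
    simpa using this
  · rintro A ⟨e⟩
    have hA : A.card = m := by
      have := Fintype.card_congr e.toEquiv
      simpa using this.symm
    refine ⟨A.orderEmbOfFin hA, ⟨(A.orderEmbOfFin hA).strictMono, ⟨?_⟩⟩,
      Finset.image_orderEmbOfFin_univ A hA⟩
    exact e.trans (RelIso.symm ⟨(A.orderIsoOfFin hA).toEquiv, Iff.rfl⟩)

open Classical in
/-- The program adds up the contributions of all labelled copies of the tournaments in the class; an
input pattern that is not a tournament matches none of them, as it should. -/
theorem isFPT_indSubTo {𝒯 : Set FinDigraph} (hfin : {T ∈ 𝒯 | IsTournament T.2}.Finite) :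
    (indSubTo 𝒯).IsFPT := by
  set S := hfin.toFinset.sigma fun T => Finset.univ.filter fun r : Fin T.1 → Fin T.1 → Bool =>
    Nonempty (T.2.Adj ≃r fun a b => r a b = true) with hS
  obtain ⟨p, C, d, hp⟩ := PolyAddable.sum (val := fun (x : Σ T : FinDigraph,
    Fin T.1 → Fin T.1 → Bool) T G => if T = x.1 then copies x.2 G else 0) S
    fun x _ => polyAddable_copies x.1 x.2
  refine ⟨.seq (.const 0 0) p, fun _ => C + 1, d, Computable.const _, ?_⟩
  intro i
  obtain ⟨⟨T, G⟩, hT, hG⟩ := i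
  suffices h : wp noOracle (.seq (.const 0 0) p) (fun s' t =>
      t ≤ (C + 1) * ((encodeDigraph T ++ encodeDigraph G).length + 1) ^ d ∧
        s'.reg 0 = inducedCount T G) (Mem.init (encodeDigraph T ++ encodeDigraph G)) by
    obtain ⟨s', t, he, ht, h0⟩ := h
    exact ⟨t, ht, s', he, h0⟩
  rw [wp_seq, wp_const]
  refine (hp T G _ fun i => ?_).mono ?_
  · simp [Mem.init]
  · rintro s' t ⟨ht, h, -⟩
    constructor
    · have : 1 ≤ ((encodeDigraph T ++ encodeDigraph G).length + 1) ^ d :=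
        Nat.one_le_pow _ _ (by omega)
      rw [Nat.add_mul, one_mul]
      omega
    · rw [h]
      beta_reduce
      rw [hS, Finset.sum_sigma]
      simp only [Mem.setReg_reg, if_true, zero_add]
      by_cases hTt : IsTournament T.2
      · rw [Finset.sum_eq_single T, Finset.sum_filter, inducedCount_eq_sum_copies]
        · simp
        · intro T' _ hne
          exact Finset.sum_eq_zero fun r _ => if_neg (Ne.symm hne)
        · intro h
          exact absurd (hfin.mem_toFinset.2 ⟨hT, hTt⟩) h
      · rw [inducedCount_eq_zero hTt hG]
        refine Finset.sum_eq_zero fun T' hT' => Finset.sum_eq_zero fun r _ => if_neg ?_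
        rintro rfl
        exact hTt (hfin.mem_toFinset.1 hT').2

end TourCount

theorem mainTheorem1 (𝒯 : Set TourCount.FinDigraph) (h𝒯 : TourCount.RecursivelyEnumerable 𝒯) :
    ({T ∈ 𝒯 | TourCount.IsTournament T.2}.Infinite → (TourCount.indSubTo 𝒯).IsSharpW1Hard) ∧
      (¬ {T ∈ 𝒯 | TourCount.IsTournament T.2}.Infinite → (TourCount.indSubTo 𝒯).IsFPT) :=
  ⟨TourCount.isSharpW1Hard_indSubTo h𝒯,
    fun h => TourCount.isFPT_indSubTo (Set.not_infinite.1 h)⟩
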